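/- Let $n\in\mathbb N$, $1<p<n$, $1\le\beta<n/p$, $\gamma\ge 0$, let $\Omega\subseteq\mathbb R^n$ be open (for instance a domain), and let $\sigma(x)=\mathrm{dist}(x,\mathbb R^n\setminus\Omega)\in[0,\infty]$, with $\sigma\equiv\infty$ if $\Omega=\mathbb R^n$. Put $\varphi(t)=(1+t)^\gamma$. For a set $I\subseteq(0,\infty)$ of radii, $0\le\alpha<n$ and a (real or vector valued) function $u$ on $\Omega$ let $$M^{I}_{\varphi,\alpha,\Omega}u(x)=\sup_{r\in I,\ 0<r<\sigma(x)}\frac{r^{\alpha}(1+r^n)^{\gamma\alpha/n}}{\varphi(|B(x,r)|)\,|B(x,r)|}\int_{B(x,r)}|u(y)|\,dy ,$$ where the supremum over no radius is $0$, and write $M_{\varphi,\alpha,\Omega}=M^{(0,\infty)}_{\varphi,\alpha,\Omega}$, $M^{<1}_{\varphi,\alpha,\Omega}=M^{(0,1)}_{\varphi,\alpha,\Omega}$, $M^{\ge1}_{\varphi,\alpha,\Omega}=M^{[1,\infty)}_{\varphi,\alpha,\Omega}$. Here $W^{1,s}(U)$ is the space of functions in $L^s(U)$ whose weak gradient $\nabla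 u$ exists and is in $L^s(U)$ (membership includes finiteness almost everywhere). We say that $\Omega$ admits a $p$-Sobolev embedding if there is $C<\infty$ with $\|u\|_{L^{p^*}(\Omega)}\le C(\|u\|_{L^p(\Omega)}+\|\nabla u\|_{L^p(\Omega)})$ for all $u\in W^{1,p}(\Omega)$, where $1/p^*=1/p-1/n$. Let $f\in W^{1,p}(\Omega)$. (i) Suppose that $0\le\gamma\le n$ and that one of the following holds: (a) $\Omega$ admits a $p$-Sobolev embedding and $\frac1q=\frac1p-\frac\beta n$; (b) $|\Omega|<\infty$ and $\frac1q=\frac1p-\frac{\beta-1}n$. Then $M_{\varphi,\beta,\Omega}f\in W^{1,q}(\Omega)$, and for almost every $x\in\Omega$: - if $M_{\varphi,\beta,\Omega}f(x)=M^{<1}_{\varphi,\beta,\Omega}f(x)$, then $|\nabla M_{\varphi,\beta,\Omega}f(x)|\le(\gamma n+2\beta)\,M_{\varphi,\beta-1,\Omega}f(x)+2M_{\varphi,\beta,\Omega}|\nabla f|(x)$; - if $M_{\varphi,\beta,\Omega}f(x)=M^{\ge1}_{\varphi,\beta,\Omega}f(x)$, then $|\nabla M_{\varphi,\beta,\Omega}f(x)|\le(\gamma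 n+\beta)\,M_{\varphi,\beta,\Omega}f(x)+2M_{\varphi,\beta,\Omega}|\nabla f|(x)$. Moreover, for the radii $0<r<1$ alone, $M^{<1}_{\varphi,\beta,\Omega}f\in W^{1,q}(\Omega)$, and for almost every $x\in\Omega$ $$|\nabla M^{<1}_{\varphi,\beta,\Omega}f(x)|\le(\gamma n+2\beta)\,M^{<1}_{\varphi,\beta-1,\Omega}f(x)+2M^{<1}_{\varphi,\beta,\Omega}|\nabla f|(x).$$ (ii) Let $\gamma\ge0$ and $\frac1q=\frac1p-\frac\beta n$, with neither (a) nor (b) assumed. For the radii $1\le r<\sigma(x)$, on the open set $\Omega_1=\{x:\sigma(x)>1\}$ of the points that have such a radius, $M^{\ge1}_{\varphi,\beta,\Omega}f\in W^{1,q}(\Omega_1)$, and for almost every $x\in\Omega_1$ $$|\nabla M^{\ge1}_{\varphi,\beta,\Omega}f(x)|\le(\gamma n+\beta)\,M^{\ge1}_{\varphi,\beta,\Omega}f(x)+2M^{\ge1}_{\varphi,\beta,\Omega}|\nabla f|(x).$$ -/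

import Mathlib

open MeasureTheory
open scoped ENNReal NNReal ContDiff

/-- `g` is a weak gradient of the real function `f` on the open set `Ω ⊆ ℝⁿ`: both are locally
integrable on `Ω` and `∫_Ω f ∂ᵢψ = - ∫_Ω gᵢ ψ` for every `ψ ∈ C_c^∞(Ω)` and every `i`. -/
def HasWeakGradient {n : ℕ} (Ω : Set (EuclideanSpace ℝ (Fin n)))
    (f : EuclideanSpace ℝ (Fin n) → ℝ)
    (g : EuclideanSpace ℝ (Fin n) → EuclideanSpace ℝ (Fin n)) : Prop :=
  LocallyIntegrableOn f Ω volume ∧ LocallyIntegrableOn g Ω volume ∧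
    ∀ ψ : EuclideanSpace ℝ (Fin n) → ℝ, ContDiff ℝ ∞ ψ → HasCompactSupport ψ → tsupport ψ ⊆ Ω →
      ∀ i : Fin n,
        ∫ x in Ω, f x * fderiv ℝ ψ x (EuclideanSpace.single i 1) = - ∫ x in Ω, g x i * ψ x

/-- Membership in the Sobolev space `W^{1,p}(Ω)`, for a real exponent `p`. -/
def MemSobolev {n : ℕ} (Ω : Set (EuclideanSpace ℝ (Fin n))) (p : ℝ)
    (f : EuclideanSpace ℝ (Fin n) → ℝ) : Prop :=
  MemLp f (ENNReal.ofReal p) (volume.restrict Ω) ∧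
    ∃ g : EuclideanSpace ℝ (Fin n) → EuclideanSpace ℝ (Fin n),
      HasWeakGradient Ω f g ∧ MemLp g (ENNReal.ofReal p) (volume.restrict Ω)

/-- `Ω` admits a `p`-Sobolev embedding: there is a finite constant `C` such that
`‖f‖_{L^{p*}(Ω)} ≤ C (‖f‖_{L^p(Ω)} + ‖∇f‖_{L^p(Ω)})` for all `f ∈ W^{1,p}(Ω)`, where
`p* = n p / (n - p)`, that is `1 / p* = 1 / p - 1 / n` (used for `1 ≤ p < n`). -/
def AdmitsSobolevEmbedding {n : ℕ} (Ω : Set (EuclideanSpace ℝ (Fin n))) (p : ℝ) : Prop :=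
  ∃ C : ℝ≥0, ∀ (f : EuclideanSpace ℝ (Fin n) → ℝ)
    (g : EuclideanSpace ℝ (Fin n) → EuclideanSpace ℝ (Fin n)),
    MemLp f (ENNReal.ofReal p) (volume.restrict Ω) → HasWeakGradient Ω f g →
    MemLp g (ENNReal.ofReal p) (volume.restrict Ω) →
      eLpNorm f (ENNReal.ofReal (n * p / (n - p))) (volume.restrict Ω) ≤
        C * (eLpNorm f (ENNReal.ofReal p) (volume.restrict Ω) +
          eLpNorm g (ENNReal.ofReal p) (volume.restrict Ω))

/-- The weight `φ(t) = (1 + t)^γ`. -/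
noncomputable def phi (γ t : ℝ) : ℝ := (1 + t) ^ γ

/-- The local fractional new maximal function, with the radii confined to a set `I`: the supremum
over all `r ∈ I` with `0 < r < dist(x, Ωᶜ)` of
`r^β (1 + r^n)^{γβ/n} / (φ(|B(x,r)|) |B(x,r)|) * ∫_{B(x,r)} |f|`, as an element of `[0, ∞]`.
The distance to the empty set is `∞`, and a supremum over no radius is `0`. The function `f` may
be vector valued, `|f|` being its norm. -/
noncomputable def maximalOn {n : ℕ} {F : Type*} [NormedAddCommGroup F] (I : Set ℝ) (γ β : ℝ)
    (Ω : Set (EuclideanSpace ℝ (Fin n))) (f : EuclideanSpace ℝ (Fin n) → F)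
    (x : EuclideanSpace ℝ (Fin n)) : ℝ≥0∞ :=
  ⨆ r ∈ {r : ℝ | r ∈ I ∧ 0 < r ∧ ENNReal.ofReal r < Metric.infEDist x Ωᶜ},
    ENNReal.ofReal (r ^ β * (1 + r ^ n) ^ (γ * β / n) /
        (phi γ (volume.real (Metric.ball x r)) * volume.real (Metric.ball x r))) *
      ∫⁻ y in Metric.ball x r, ‖f y‖ₑ

/-- The local fractional new maximal function `M_{φ,β,Ω} f` (all radii). -/
noncomputable def maximal {n : ℕ} {F : Type*} [NormedAddCommGroup F] (γ β : ℝ)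
    (Ω : Set (EuclideanSpace ℝ (Fin n))) (f : EuclideanSpace ℝ (Fin n) → F) :
    EuclideanSpace ℝ (Fin n) → ℝ≥0∞ :=
  maximalOn Set.univ γ β Ω f

/-- `M_{φ,β,Ω} f` in the regime `0 < r < 1`. -/
noncomputable def maximalSmall {n : ℕ} {F : Type*} [NormedAddCommGroup F] (γ β : ℝ)
    (Ω : Set (EuclideanSpace ℝ (Fin n))) (f : EuclideanSpace ℝ (Fin n) → F) :
    EuclideanSpace ℝ (Fin n) → ℝ≥0∞ :=
  maximalOn (Set.Iio 1) γ β Ω f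

/-- `M_{φ,β,Ω} f` in the regime `1 ≤ r < dist(x, Ωᶜ)`. -/
noncomputable def maximalLarge {n : ℕ} {F : Type*} [NormedAddCommGroup F] (γ β : ℝ)
    (Ω : Set (EuclideanSpace ℝ (Fin n))) (f : EuclideanSpace ℝ (Fin n) → F) :
    EuclideanSpace ℝ (Fin n) → ℝ≥0∞ :=
  maximalOn (Set.Ici 1) γ β Ω f

/-- The points `x` that have a radius `r` with `1 ≤ r < dist(x, Ωᶜ)`. -/
def largePart {n : ℕ} (Ω : Set (EuclideanSpace ℝ (Fin n))) : Set (EuclideanSpace ℝ (Fin n)) :=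
  {x | 1 < Metric.infEDist x Ωᶜ}

/-- A `[0, ∞]`-valued function belongs to `W^{1,q}(Ω)`: it is finite almost everywhere on `Ω`, and
as a real function it is in `W^{1,q}(Ω)`. -/
def MemSobolevENN {n : ℕ} (Ω : Set (EuclideanSpace ℝ (Fin n))) (q : ℝ)
    (u : EuclideanSpace ℝ (Fin n) → ℝ≥0∞) : Prop :=
  (∀ᵐ x ∂(volume.restrict Ω), u x < ⊤) ∧ MemSobolev Ω q (fun x => (u x).toReal)

open Filter Set Metric
open scoped Topology

variable {n : ℕ}

/-! After rescaling to the unit ball, every competitor of the maximal function has the form k(r)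
∫_{B(0,1)} |f(x + r y)| dy, with k = `radialWeight`. Move the centre along the segment from x to x +
z and let the radius shrink by an amount c ≤ |z|. The points x + s z + (r - s c) y move with speed
at most 2|z|, which produces the term 2 M|∇f|. The change of the weight costs at most |z| D(r) k(r),
where D = `radialGrowth` bounds the logarithmic derivative of k from above. For r < 1 and γ ≤ n, D k
is at most (γn + 2β) times the weight of order β - 1; for r ≥ 1, D itself is at most γn + β.

Shrinking the radius as fast as the centre moves keeps the ball inside Ω. The supremum over r
therefore yields M f(x) ≤ M f(x + z) + |z| ∫₀¹ G(x + s z) ds, with G the right-hand side of the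
claimed estimate: G is an upper gradient of M f along short segments
(`HasWeakGradient.isLocalUpperGradient_maximalOn`). The inequality is proved first for smooth
functions and carried over to f by mollification.

An upper gradient in L^q controls the weak gradient. Difference quotients moved onto a test function
give |∫ u ∂_v ψ| ≤ |v| ∫ G |ψ|; a Riesz representation in a weighted L² space then produces the weak
derivatives, and testing locally gives |∇u| ≤ G almost everywhere
(`IsLocalUpperGradient.memSobolevENN`).

That M f and G lie in L^q follows from the bounds for the classical fractional maximal function,
obtained from the Hardy–Littlewood theorem and Hedberg's inequality. The term of order β - 1 has the
right integrability either because f ∈ L^{p*} by the Sobolev embedding, or because |Ω| < ∞ bounds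
the radii, so that order β may be traded for order β - 1.

For the full maximal function the upper gradient is only the sum of the two regimes. The separate
estimates come from locality: weak gradients of two functions agree almost everywhere on the set
where the functions agree (`HasWeakGradient.ae_eq_zero_of_eq_zero` applied to the difference). -/

/-! ### Test functions and pointwise bounds for weak gradients. -/

/-- A sequence of smooth bumps at the origin with radii tending to zero. -/
noncomputable def shrinkingBump (n j : ℕ) : ContDiffBump (0 : EuclideanSpace ℝ (Fin n)) where
  rIn := 1 / (j + 2)
  rOut := 2 / (j + 2)
  rIn_pos := by positivity
  rIn_lt_rOut := by gcongr; norm_num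

theorem tendsto_shrinkingBump_rOut (n : ℕ) :
    Tendsto (fun j => (shrinkingBump n j).rOut) atTop (𝓝 0) := by
  have h : Tendsto (fun j : ℕ => (2 : ℝ) / ((j : ℝ) + 2)) atTop (𝓝 0) :=
    Tendsto.div_atTop tendsto_const_nhds
      (tendsto_atTop_add_const_right _ _ tendsto_natCast_atTop_atTop)
  exact h

/-- A locally integrable function whose integrals against nonnegative test functions are
nonnegative is nonnegative almost everywhere. -/
theorem ae_nonneg_of_integral_mul_contDiff_nonneg {U : Set (EuclideanSpace ℝ (Fin n))}
    (hU : IsOpen U) {F : EuclideanSpace ℝ (Fin n) → ℝ} (hF : LocallyIntegrableOn F U volume)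
    (h : ∀ ψ : EuclideanSpace ℝ (Fin n) → ℝ, ContDiff ℝ ∞ ψ → HasCompactSupport ψ →
      tsupport ψ ⊆ U → (∀ x, 0 ≤ ψ x) → 0 ≤ ∫ x in U, F x * ψ x) :
    ∀ᵐ x ∂(volume.restrict U), 0 ≤ F x := by
  rw [ae_restrict_iff' hU.measurableSet, ae_iff]
  refine measure_null_of_locally_null _ fun x₀ hx₀ => ?_
  have hx₀U : x₀ ∈ U := by
    by_contra hc
    exact hx₀ fun hx => absurd hx hc
  obtain ⟨R, hR, hRU⟩ := Metric.nhds_basis_closedBall.mem_iff.1 (hU.mem_nhds hx₀U)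
  set F₁ := indicator (closedBall x₀ R) F with hF₁
  have hint : Integrable F₁ volume := by
    rw [hF₁, integrable_indicator_iff measurableSet_closedBall]
    exact hF.integrableOn_compact_subset hRU (isCompact_closedBall _ _)
  -- The ratio of outer to inner radius is 2 for every bump; a bounded ratio is what gives
  -- convergence at almost every point, by Lebesgue differentiation. The cutoff `F₁` makes the
  -- function globally integrable without changing it near `x₀`.
  have hconv := ContDiffBump.ae_convolution_tendsto_right_of_locallyIntegrable
    (μ := (volume : Measure (EuclideanSpace ℝ (Fin n)))) (φ := shrinkingBump n) (K := 2)
    (tendsto_shrinkingBump_rOut n)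
    (Eventually.of_forall fun j => le_of_eq (by simp only [shrinkingBump]; ring))
    hint.locallyIntegrable
  refine ⟨ball x₀ R ∩ {x | ¬ (x ∈ U → 0 ≤ F x)},
    inter_mem (mem_nhdsWithin_of_mem_nhds (ball_mem_nhds x₀ hR)) self_mem_nhdsWithin, ?_⟩
  refine measure_mono_null (fun x hx => ?_) (ae_iff.1 hconv)
  intro hlim
  refine hx.2 fun _ => ?_
  have hxb : x ∈ closedBall x₀ R := ball_subset_closedBall hx.1
  have hFx : F₁ x = F x := indicator_of_mem hxb F
  rw [hFx] at hlim
  have hpos : 0 < R - dist x x₀ := by have := mem_ball.1 hx.1; linarith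
  refine ge_of_tendsto hlim ?_
  filter_upwards [(tendsto_shrinkingBump_rOut n).eventually_lt_const hpos] with j hj
  have hsub : closedBall x (shrinkingBump n j).rOut ⊆ closedBall x₀ R :=
    closedBall_subset_closedBall' (by linarith)
  -- The reflected bump is itself an admissible nonnegative test function, so the convolution at `x`
  -- is one of the integrals assumed nonnegative.
  set ψ := fun t => (shrinkingBump n j).normed volume (x - t) with hψ
  have hsupp : tsupport ψ ⊆ closedBall x (shrinkingBump n j).rOut := by
    refine closure_minimal (fun t ht => ?_) isClosed_closedBall
    have : x - t ∈ Function.support ((shrinkingBump n j).normed volume) := ht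
    rw [ContDiffBump.support_normed_eq] at this
    rw [mem_closedBall, dist_comm, dist_eq_norm]
    simpa using (mem_ball_zero_iff.1 this).le
  have hψ0 : ∀ t ∉ closedBall x₀ R, ψ t = 0 := fun t ht => by
    by_contra hne
    exact ht (hsub (hsupp (subset_tsupport _ hne)))
  have key := h ψ ((ContDiffBump.contDiff_normed _).comp (contDiff_const.sub contDiff_id))
    (HasCompactSupport.of_support_subset_isCompact (isCompact_closedBall x _)
      ((subset_tsupport _).trans hsupp)) ((hsupp.trans hsub).trans hRU)
    (fun t => ContDiffBump.nonneg_normed _ _)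
  rw [convolution_lsmul_swap]
  refine key.trans_eq ?_
  rw [← integral_indicator hU.measurableSet]
  congr 1
  ext t
  by_cases ht : t ∈ closedBall x₀ R
  · rw [indicator_of_mem (hRU ht), hF₁, indicator_of_mem ht, smul_eq_mul, mul_comm]
  · rw [hF₁, indicator_of_notMem ht, smul_zero, indicator_apply_eq_zero]
    intro _
    rw [hψ0 t ht, mul_zero]

/-- The product of a locally integrable function and a continuous function
compactly supported in `U` is integrable. -/
theorem MeasureTheory.LocallyIntegrableOn.integrableOn_mul_test
    {U : Set (EuclideanSpace ℝ (Fin n))}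
    {F : EuclideanSpace ℝ (Fin n) → ℝ} (hF : LocallyIntegrableOn F U volume)
    {ψ : EuclideanSpace ℝ (Fin n) → ℝ} (hψ : Continuous ψ) (hc : HasCompactSupport ψ)
    (hs : tsupport ψ ⊆ U) : IntegrableOn (fun x => F x * ψ x) U volume := by
  have h1 : IntegrableOn (fun x => F x * ψ x) (tsupport ψ) volume :=
    (hF.integrableOn_compact_subset hs hc).mul_continuousOn hψ.continuousOn hc
  refine (integrableOn_iff_integrable_of_support_subset (fun x hx => ?_)).1 h1 |>.integrableOn
  exact subset_tsupport _ (right_ne_zero_of_mul hx)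

theorem inner_eq_sum_coord (x y : EuclideanSpace ℝ (Fin n)) :
    inner ℝ x y = ∑ i, x i * y i := by
  simp [PiLp.inner_apply, mul_comm]

theorem locallyIntegrableOn_coord {U : Set (EuclideanSpace ℝ (Fin n))}
    {g : EuclideanSpace ℝ (Fin n) → EuclideanSpace ℝ (Fin n)}
    (hg : LocallyIntegrableOn g U volume) (i : Fin n) :
    LocallyIntegrableOn (fun x => g x i) U volume := by
  intro x hx
  obtain ⟨s, hs, hi⟩ := hg x hx
  refine ⟨s, hs, ?_⟩
  exact (EuclideanSpace.proj (𝕜 := ℝ) i).integrable_comp hi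

theorem fderiv_eq_sum_coord (ψ : EuclideanSpace ℝ (Fin n) → ℝ) (x v : EuclideanSpace ℝ (Fin n)) :
    fderiv ℝ ψ x v = ∑ i, v i * fderiv ℝ ψ x (EuclideanSpace.single i 1) := by
  conv_lhs => rw [← (EuclideanSpace.basisFun (Fin n) ℝ).sum_repr v]
  simp [map_sum]

section fderivTest
variable {ψ : EuclideanSpace ℝ (Fin n) → ℝ} 

theorem tsupport_fderiv_apply_subset' (v : EuclideanSpace ℝ (Fin n)) :
    tsupport (fun x => fderiv ℝ ψ x v) ⊆ tsupport ψ := by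
  refine closure_minimal (fun x hx => ?_) (isClosed_tsupport _)
  refine support_fderiv_subset ℝ (fun h0 => hx ?_)
  simp [h0]

theorem continuous_fderiv_apply_const (hψ : ContDiff ℝ ∞ ψ) (v : EuclideanSpace ℝ (Fin n)) :
    Continuous fun x => fderiv ℝ ψ x v :=
  (hψ.continuous_fderiv (by simp)).clm_apply continuous_const

end fderivTest

namespace HasWeakGradient

variable {U : Set (EuclideanSpace ℝ (Fin n))} {u : EuclideanSpace ℝ (Fin n) → ℝ}
  {h : EuclideanSpace ℝ (Fin n) → EuclideanSpace ℝ (Fin n)}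

theorem integral_mul_fderiv (H : HasWeakGradient U u h) {ψ : EuclideanSpace ℝ (Fin n) → ℝ}
    (hψ : ContDiff ℝ ∞ ψ) (hc : HasCompactSupport ψ) (hs : tsupport ψ ⊆ U)
    (v : EuclideanSpace ℝ (Fin n)) :
    ∫ x in U, u x * fderiv ℝ ψ x v = - ∫ x in U, inner ℝ (h x) v * ψ x := by
  have h1 : ∀ x, u x * fderiv ℝ ψ x v
      = ∑ i, v i * (u x * fderiv ℝ ψ x (EuclideanSpace.single i 1)) := fun x => by
    rw [fderiv_eq_sum_coord, Finset.mul_sum]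
    exact Finset.sum_congr rfl fun i _ => by ring
  have h2 : ∀ x, inner ℝ (h x) v * ψ x = ∑ i, v i * (h x i * ψ x) := fun x => by
    rw [inner_eq_sum_coord, Finset.sum_mul]
    exact Finset.sum_congr rfl fun i _ => by ring
  simp_rw [h1, h2]
  rw [integral_finsetSum, integral_finsetSum, ← Finset.sum_neg_distrib]
  · refine Finset.sum_congr rfl fun i _ => ?_
    rw [integral_const_mul, integral_const_mul, H.2.2 ψ hψ hc hs i]
    ring
  · intro i _
    exact ((locallyIntegrableOn_coord H.2.1 i).integrableOn_mul_test hψ.continuous hc hs).const_mul _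
  · intro i _
    refine Integrable.const_mul ?_ _
    refine H.1.integrableOn_mul_test (continuous_fderiv_apply_const hψ _) ?_
      ((tsupport_fderiv_apply_subset' _).trans hs)
    exact hc.of_isClosed_subset (isClosed_tsupport _) (tsupport_fderiv_apply_subset' _)

theorem mono (H : HasWeakGradient U u h) {V : Set (EuclideanSpace ℝ (Fin n))}
    (hVU : V ⊆ U) : HasWeakGradient V u h := by
  refine ⟨H.1.mono_set hVU, H.2.1.mono_set hVU, fun ψ hψ hc hs i => ?_⟩
  have aux : ∀ F : EuclideanSpace ℝ (Fin n) → ℝ, (∀ x, x ∉ tsupport ψ → F x = 0) →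
      ∫ x in V, F x = ∫ x in U, F x := by
    intro F hF
    rw [setIntegral_eq_integral_of_forall_compl_eq_zero fun x hx => hF x fun hx' => hx (hs hx'),
      setIntegral_eq_integral_of_forall_compl_eq_zero
        fun x hx => hF x fun hx' => hx (hVU (hs hx'))]
  rw [aux, aux, H.2.2 ψ hψ hc (hs.trans hVU) i]
  · intro x hx
    simp [image_eq_zero_of_notMem_tsupport hx]
  · intro x hx
    have : fderiv ℝ ψ x = 0 := by
      by_contra hne
      exact hx (support_fderiv_subset ℝ hne)
    simp [this]

theorem sub {u' : EuclideanSpace ℝ (Fin n) → ℝ}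
    {h' : EuclideanSpace ℝ (Fin n) → EuclideanSpace ℝ (Fin n)}
    (H : HasWeakGradient U u h) (H' : HasWeakGradient U u' h') :
    HasWeakGradient U (fun x => u x - u' x) (fun x => h x - h' x) := by
  refine ⟨H.1.sub H'.1, H.2.1.sub H'.2.1, fun ψ hψ hc hs i => ?_⟩
  have hc' : HasCompactSupport fun x => fderiv ℝ ψ x (EuclideanSpace.single i 1) :=
    hc.of_isClosed_subset (isClosed_tsupport _) (tsupport_fderiv_apply_subset' _)
  have hs' := (tsupport_fderiv_apply_subset' (ψ := ψ) (EuclideanSpace.single i 1)).trans hs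
  have hcont := continuous_fderiv_apply_const hψ (EuclideanSpace.single i 1)
  simp only [sub_mul, PiLp.sub_apply]
  rw [integral_sub (H.1.integrableOn_mul_test hcont hc' hs') (H'.1.integrableOn_mul_test hcont hc' hs'),
    integral_sub ((locallyIntegrableOn_coord H.2.1 i).integrableOn_mul_test hψ.continuous hc hs)
     ((locallyIntegrableOn_coord H'.2.1 i).integrableOn_mul_test hψ.continuous hc hs),
    H.2.2 ψ hψ hc hs i, H'.2.2 ψ hψ hc hs i]
  ring

/-- Weak gradients are unique almost everywhere. -/
theorem ae_eq (hU : IsOpen U) {h' : EuclideanSpace ℝ (Fin n) → EuclideanSpace ℝ (Fin n)}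
    (H : HasWeakGradient U u h) (H' : HasWeakGradient U u h') :
    ∀ᵐ x ∂(volume.restrict U), h x = h' x := by
  have key : ∀ i, ∀ᵐ x ∂(volume.restrict U), (h x - h' x) i = 0 := fun i => by
    rw [ae_restrict_iff' hU.measurableSet]
    refine hU.ae_eq_zero_of_integral_contDiff_smul_eq_zero
      (locallyIntegrableOn_coord (H.2.1.sub H'.2.1) i) fun ψ hψ hc hs => ?_
    have := (H.sub H').2.2 ψ hψ hc hs i
    simp only [sub_self, zero_mul, integral_zero] at this
    rw [← setIntegral_eq_integral_of_forall_compl_eq_zero (s := U)]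
    · simp_rw [smul_eq_mul, mul_comm (ψ _)]
      simpa using this.symm
    · intro x hx
      rw [image_eq_zero_of_notMem_tsupport fun hx' => hx (hs hx'), zero_smul]
  filter_upwards [ae_all_iff.2 key] with x hx
  rw [← sub_eq_zero]
  ext i
  simpa using hx i

/-- If the distributional derivatives are dominated by `G`, so is the weak gradient. -/
theorem ae_enorm_le (hU : IsOpen U) (H : HasWeakGradient U u h)
    {G : EuclideanSpace ℝ (Fin n) → ℝ≥0∞} (hG : Measurable G)
    (hGK : ∀ K ⊆ U, IsCompact K → ∫⁻ x in K, G x ≠ ⊤)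
    (hb : ∀ ψ : EuclideanSpace ℝ (Fin n) → ℝ, ContDiff ℝ ∞ ψ → HasCompactSupport ψ →
      tsupport ψ ⊆ U → ∀ v, ‖∫ x in U, u x * fderiv ℝ ψ x v‖ₑ ≤
        ‖v‖ₑ * ∫⁻ x in U, G x * ‖ψ x‖ₑ) :
    ∀ᵐ x ∂(volume.restrict U), ‖h x‖ₑ ≤ G x := by
  have hGi : LocallyIntegrableOn (fun x => (G x).toReal) U volume := by
    rw [locallyIntegrableOn_iff hU.isLocallyClosed]
    exact fun K hK hKc => integrable_toReal_of_lintegral_ne_top hG.aemeasurable (hGK K hK hKc)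
  have hinner : ∀ v, LocallyIntegrableOn (fun x => inner ℝ (h x) v) U volume := fun v => by
    intro x hx
    obtain ⟨s, hs, hi⟩ := H.2.1 x hx
    exact ⟨s, hs, hi.inner_const v⟩
  have step : ∀ v, ∀ᵐ x ∂(volume.restrict U), 0 ≤ ‖v‖ * (G x).toReal - inner ℝ (h x) v := by
    intro v
    have hvG : LocallyIntegrableOn (fun x => ‖v‖ * (G x).toReal) U volume := by
      intro x hx
      obtain ⟨s, hs, hi⟩ := hGi x hx
      exact ⟨s, hs, hi.const_mul _⟩
    refine ae_nonneg_of_integral_mul_contDiff_nonneg hU (hvG.sub (hinner v))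
      fun ψ hψ hc hs hpos => ?_
    have hi1 := hvG.integrableOn_mul_test hψ.continuous hc hs
    have hi2 := (hinner v).integrableOn_mul_test hψ.continuous hc hs
    simp only [sub_mul]
    rw [integral_sub hi1 hi2, sub_nonneg]
    have e1 : ∫⁻ x in U, G x * ‖ψ x‖ₑ = ENNReal.ofReal (∫ x in U, (G x).toReal * ψ x) := by
      rw [ofReal_integral_eq_lintegral_ofReal (hGi.integrableOn_mul_test hψ.continuous hc hs)
        (Eventually.of_forall fun x => mul_nonneg ENNReal.toReal_nonneg (hpos x))]
      have hfin : ∀ᵐ x ∂(volume.restrict (tsupport ψ)), G x < ⊤ :=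
        ae_lt_top hG (hGK _ hs hc)
      rw [ae_restrict_iff' hc.isCompact.measurableSet] at hfin
      refine lintegral_congr_ae ?_
      filter_upwards [ae_restrict_of_ae hfin] with x hx
      by_cases hxs : x ∈ tsupport ψ
      · rw [ENNReal.ofReal_mul ENNReal.toReal_nonneg, ENNReal.ofReal_toReal (hx hxs).ne,
          Real.enorm_of_nonneg (hpos x)]
      · simp [image_eq_zero_of_notMem_tsupport hxs]
    have h1 := hb ψ hψ hc hs v
    rw [H.integral_mul_fderiv hψ hc hs v, enorm_neg, e1, ← ofReal_norm v,
      ← ENNReal.ofReal_mul (norm_nonneg _), ← ofReal_norm, ENNReal.ofReal_le_ofReal_iff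
        (mul_nonneg (norm_nonneg _) (integral_nonneg fun x =>
          mul_nonneg ENNReal.toReal_nonneg (hpos x)))] at h1
    refine (le_abs_self _).trans (h1.trans (le_of_eq ?_))
    rw [← integral_const_mul]
    simp_rw [mul_assoc]
  -- The exceptional null set depends on the direction. A countable dense set of directions and
  -- continuity in `v` give all directions at once; the direction `h x` then yields the norm of `h
  -- x`.
  have hall := ae_all_iff.2 fun k => step (TopologicalSpace.denseSeq _ k)
  filter_upwards [hall] with x hx
  have hv : ∀ v, 0 ≤ ‖v‖ * (G x).toReal - inner ℝ (h x) v := by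
    intro v
    have hcl : IsClosed {v | 0 ≤ ‖v‖ * (G x).toReal - inner ℝ (h x) v} :=
      isClosed_le continuous_const (by fun_prop)
    have := (TopologicalSpace.denseRange_denseSeq (EuclideanSpace ℝ (Fin n))).closure_eq
    refine hcl.closure_subset_iff.2 (Set.range_subset_iff.2 hx) ?_
    rw [this]; trivial
  by_cases htop : G x = ⊤
  · simp [htop]
  rw [← ofReal_norm, ← ENNReal.ofReal_toReal htop]
  refine ENNReal.ofReal_le_ofReal ?_
  have := hv (h x)
  rw [real_inner_self_eq_norm_sq] at this
  rcases (norm_nonneg (h x)).eq_or_lt with h0 | h0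
  · rw [← h0]; exact ENNReal.toReal_nonneg
  · nlinarith

end HasWeakGradient

/-! ### Mollification and approximation by smooth functions. -/

section Mollify

variable {V : Type*} [NormedAddCommGroup V] [NormedSpace ℝ V]

/-- Convolution with a normalized smooth bump. -/
noncomputable def mollify (j : ℕ) (F : EuclideanSpace ℝ (Fin n) → V)
    (x : EuclideanSpace ℝ (Fin n)) : V :=
  convolution ((shrinkingBump n j).normed volume) F (ContinuousLinearMap.lsmul ℝ ℝ) volume x

theorem mollify_eq (j : ℕ) (F : EuclideanSpace ℝ (Fin n) → V) (x : EuclideanSpace ℝ (Fin n)) :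
    mollify j F x = ∫ y, (shrinkingBump n j).normed volume (x - y) • F y :=
  convolution_lsmul_swap

theorem continuous_mollify (j : ℕ) {F : EuclideanSpace ℝ (Fin n) → V}
    (hF : LocallyIntegrable F volume) : Continuous (mollify j F) :=
  (ContDiffBump.hasCompactSupport_normed _).continuous_convolution_left _
    (ContDiffBump.continuous_normed _) hF

theorem contDiff_mollify (j : ℕ) {F : EuclideanSpace ℝ (Fin n) → V}
    (hF : LocallyIntegrable F volume) : ContDiff ℝ ∞ (mollify j F) :=
  (ContDiffBump.hasCompactSupport_normed _).contDiff_convolution_left _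
    (ContDiffBump.contDiff_normed _) hF

/-- Tonelli and the unit mass of the kernel. This uniform contraction reduces L¹ convergence to a
dense class. -/
theorem lintegral_enorm_mollify_le (j : ℕ) {F : EuclideanSpace ℝ (Fin n) → V}
    (hF : Integrable F volume) : ∫⁻ x, ‖mollify j F x‖ₑ ≤ ∫⁻ x, ‖F x‖ₑ := by
  set b := (shrinkingBump n j).normed volume with hb
  have hbc : Continuous b := ContDiffBump.continuous_normed _
  have hbn : ∀ x, 0 ≤ b x := ContDiffBump.nonneg_normed _
  have hb1 : ∫⁻ x, ‖b x‖ₑ = 1 := by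
    simp_rw [Real.enorm_of_nonneg (hbn _)]
    rw [← ofReal_integral_eq_lintegral_ofReal (ContDiffBump.integrable_normed _)
      (Eventually.of_forall hbn), ContDiffBump.integral_normed, ENNReal.ofReal_one]
  calc ∫⁻ x, ‖mollify j F x‖ₑ ≤ ∫⁻ x, ∫⁻ y, ‖b (x - y)‖ₑ * ‖F y‖ₑ := by
        refine lintegral_mono fun x => ?_
        rw [mollify_eq]
        refine (enorm_integral_le_lintegral_enorm _).trans (le_of_eq ?_)
        simp_rw [enorm_smul]
        rfl
    _ = ∫⁻ y, ∫⁻ x, ‖b (x - y)‖ₑ * ‖F y‖ₑ := by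
        refine lintegral_lintegral_swap ?_
        change AEMeasurable (fun z : EuclideanSpace ℝ (Fin n) × EuclideanSpace ℝ (Fin n) =>
          ‖b (z.1 - z.2)‖ₑ * ‖F z.2‖ₑ) _
        have h1 : AEMeasurable (fun z : EuclideanSpace ℝ (Fin n) × EuclideanSpace ℝ (Fin n) =>
            ‖b (z.1 - z.2)‖ₑ) (volume.prod volume) :=
          (hbc.comp (continuous_fst.sub continuous_snd)).enorm.measurable.aemeasurable
        exact h1.mul hF.1.enorm.comp_snd
    _ = ∫⁻ x, ‖F x‖ₑ := by
        refine lintegral_congr fun y => ?_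
        rw [lintegral_mul_const'' _ (by fun_prop),
          lintegral_sub_right_eq_self (fun x => ‖b x‖ₑ) y, hb1, one_mul]

theorem mollify_sub (j : ℕ) {F F' : EuclideanSpace ℝ (Fin n) → V}
    (hF : LocallyIntegrable F volume) (hF' : LocallyIntegrable F' volume) :
    mollify j (F - F') = mollify j F - mollify j F' := by
  ext x
  have hex : ∀ {H : EuclideanSpace ℝ (Fin n) → V}, LocallyIntegrable H volume →
      Integrable (fun y => (shrinkingBump n j).normed volume (x - y) • H y) := by
    intro H hH
    refine hH.integrable_smul_left_of_hasCompactSupport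
      ((ContDiffBump.continuous_normed _).comp (continuous_const.sub continuous_id)) ?_
    exact (ContDiffBump.hasCompactSupport_normed _).comp_homeomorph (Homeomorph.subLeft x)
  simp only [Pi.sub_apply, mollify_eq, smul_sub]
  exact integral_sub (hex hF) (hex hF')

theorem tendsto_lintegral_mollify_sub_of_continuous [CompleteSpace V]
    {c : EuclideanSpace ℝ (Fin n) → V}
    (hc : Continuous c) (hs : HasCompactSupport c) :
    Tendsto (fun j => ∫⁻ x, ‖mollify j c x - c x‖ₑ) atTop (𝓝 0) := by
  -- Once the bump radius is below 1, the mollified function and `c` both vanish off this fixed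
  -- compact set, so the uniform bound coming from uniform continuity integrates to an L¹ bound.
  set S := cthickening 1 (tsupport c) with hS
  have hSc : IsCompact S := hs.isCompact.cthickening
  have hvol : volume S ≠ ⊤ := hSc.measure_lt_top.ne
  rw [ENNReal.tendsto_nhds_zero]
  intro ε hε
  obtain ⟨η, hη, hηε⟩ : ∃ η : ℝ, 0 < η ∧ ENNReal.ofReal η * volume S ≤ ε := by
    rcases eq_or_ne ε ⊤ with rfl | hεt
    · exact ⟨1, one_pos, le_top⟩
    · refine ⟨(ε / (volume S + 1)).toReal, ENNReal.toReal_pos ?_ ?_, ?_⟩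
      · exact (ENNReal.div_pos hε.ne' (by finiteness)).ne'
      · exact (ENNReal.div_lt_top hεt (by simp)).ne
      · rw [ENNReal.ofReal_toReal (ENNReal.div_lt_top hεt (by simp)).ne]
        calc ε / (volume S + 1) * volume S ≤ ε / (volume S + 1) * (volume S + 1) := by
              gcongr; exact le_self_add
          _ = ε := ENNReal.div_mul_cancel (by simp) (by finiteness)
  obtain ⟨δ, hδ, huc⟩ := Metric.uniformContinuous_iff.1
    (hs.uniformContinuous_of_continuous hc) η hη
  filter_upwards [(tendsto_shrinkingBump_rOut n).eventually_lt_const (lt_min hδ one_pos)]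
    with j hj
  have hpt : ∀ x, ‖mollify j c x - c x‖ₑ ≤ S.indicator (fun _ => ENNReal.ofReal η) x := by
    intro x
    by_cases hx : x ∈ S
    · rw [indicator_of_mem hx, ← ofReal_norm, ← dist_eq_norm]
      refine ENNReal.ofReal_le_ofReal ?_
      refine ContDiffBump.dist_normed_convolution_le hc.aestronglyMeasurable fun y hy => ?_
      exact (huc ((mem_ball.1 hy).trans (hj.trans_le (min_le_left _ _)))).le
    · have h0 : ∀ y ∈ ball x (shrinkingBump n j).rOut, c y = 0 := by
        intro y hy
        by_contra hne
        refine hx (mem_cthickening_of_dist_le x y 1 _ (subset_tsupport _ hne) ?_)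
        rw [dist_comm]
        exact ((mem_ball.1 hy).trans (hj.trans_le (min_le_right _ _))).le
      have hcx : c x = 0 := h0 x (mem_ball_self (ContDiffBump.rOut_pos _))
      have : mollify j c x = c x :=
        ContDiffBump.normed_convolution_eq_right fun y hy => (h0 y hy).trans hcx.symm
      rw [this, sub_self, enorm_zero]
      exact zero_le
  calc ∫⁻ x, ‖mollify j c x - c x‖ₑ ≤ ∫⁻ x, S.indicator (fun _ => ENNReal.ofReal η) x :=
        lintegral_mono hpt
    _ = ENNReal.ofReal η * volume S := by
        rw [lintegral_indicator_const hSc.measurableSet]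
    _ ≤ ε := hηε

theorem tendsto_lintegral_mollify_sub [CompleteSpace V]
    {F : EuclideanSpace ℝ (Fin n) → V}
    (hF : Integrable F volume) :
    Tendsto (fun j => ∫⁻ x, ‖mollify j F x - F x‖ₑ) atTop (𝓝 0) := by
  rw [ENNReal.tendsto_nhds_zero]
  intro ε hε
  have hε3 : ε / 3 ≠ 0 := (ENNReal.div_pos hε.ne' (by simp)).ne'
  obtain ⟨c, hcs, hFc, hcc, hci⟩ := hF.exists_hasCompactSupport_lintegral_sub_le hε3
  filter_upwards [(ENNReal.tendsto_nhds_zero.1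
    (tendsto_lintegral_mollify_sub_of_continuous hcc hcs)) _ hε3.bot_lt] with j hj
  have hm : mollify j F = mollify j (F - c) + mollify j c := by
    rw [mollify_sub j hF.locallyIntegrable hci.locallyIntegrable, sub_add_cancel]
  have hmeas : AEMeasurable fun x => ‖F x - c x‖ₑ := (hF.1.sub hci.1).enorm
  have hcm : Measurable fun x => ‖mollify j c x - c x‖ₑ :=
    ((continuous_mollify j hci.locallyIntegrable).sub hcc).enorm.measurable
  calc ∫⁻ x, ‖mollify j F x - F x‖ₑ
      ≤ ∫⁻ x, (‖mollify j (F - c) x‖ₑ + ‖mollify j c x - c x‖ₑ + ‖F x - c x‖ₑ) := by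
        refine lintegral_mono fun x => ?_
        have : mollify j F x - F x
            = mollify j (F - c) x + (mollify j c x - c x) - (F x - c x) := by
          rw [hm, Pi.add_apply]; abel
        rw [this]
        refine (enorm_sub_le).trans ?_
        gcongr
        exact enorm_add_le _ _
    _ = (∫⁻ x, ‖mollify j (F - c) x‖ₑ) + (∫⁻ x, ‖mollify j c x - c x‖ₑ) + ∫⁻ x, ‖F x - c x‖ₑ := by
        rw [lintegral_add_right' _ hmeas, lintegral_add_right _ hcm]
    _ ≤ ε / 3 + ε / 3 + ε / 3 := by
        gcongr
        exact (lintegral_enorm_mollify_le j (hF.sub hci)).trans hFc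
    _ = ε := ENNReal.add_thirds ε

end Mollify

/-- On a compact part of `U`, a function with a weak gradient is approximated in `L¹`, together
with its gradient, by smooth functions. -/
theorem HasWeakGradient.exists_contDiff_approx {U : Set (EuclideanSpace ℝ (Fin n))}
    (hU : IsOpen U) {f : EuclideanSpace ℝ (Fin n) → ℝ}
    {g : EuclideanSpace ℝ (Fin n) → EuclideanSpace ℝ (Fin n)} (H : HasWeakGradient U f g)
    {K : Set (EuclideanSpace ℝ (Fin n))} (hK : IsCompact K) (hKU : K ⊆ U) {ε : ℝ≥0∞}
    (hε : ε ≠ 0) :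
    ∃ (φ : EuclideanSpace ℝ (Fin n) → ℝ)
      (Φ : EuclideanSpace ℝ (Fin n) → EuclideanSpace ℝ (Fin n)),
      ContDiff ℝ ∞ φ ∧ Continuous Φ ∧ (∀ x ∈ K, ∀ v, fderiv ℝ φ x v = inner ℝ (Φ x) v) ∧
      ∫⁻ x in K, ‖φ x - f x‖ₑ ≤ ε ∧ ∫⁻ x in K, ‖Φ x - g x‖ₑ ≤ ε := by
  -- For x in `K` and bump radius below δ, the kernel t ↦ b(x - t) is a test function supported in
  -- `K'` ⊆ U. The weak gradient identity tested against it says that the derivative of the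
  -- mollified function is the mollified gradient. Off `K` the cutoff to `K'` may spoil this, which
  -- is why the identity is claimed on `K` only.
  obtain ⟨δ, hδ, hδU⟩ := hK.exists_cthickening_subset_open hU hKU
  set K' := cthickening δ K with hK'
  have hK'c : IsCompact K' := hK.cthickening
  have hKK' : K ⊆ K' := self_subset_cthickening K
  set f₁ := K'.indicator f with hf₁
  set g₁ := K'.indicator g with hg₁
  have hfi : Integrable f₁ volume :=
    (integrable_indicator_iff hK'c.measurableSet).2 (H.1.integrableOn_compact_subset hδU hK'c)
  have hgi : Integrable g₁ volume :=
    (integrable_indicator_iff hK'c.measurableSet).2 (H.2.1.integrableOn_compact_subset hδU hK'c)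
  obtain ⟨j, hj1, hj2, hj3⟩ := (((tendsto_shrinkingBump_rOut n).eventually_lt_const hδ).and
    ((ENNReal.tendsto_nhds_zero.1 (tendsto_lintegral_mollify_sub hfi) ε hε.bot_lt).and
    (ENNReal.tendsto_nhds_zero.1 (tendsto_lintegral_mollify_sub hgi) ε hε.bot_lt))).exists
  refine ⟨mollify j f₁, mollify j g₁, contDiff_mollify j hfi.locallyIntegrable,
    continuous_mollify j hgi.locallyIntegrable, fun x hx v => ?_, ?_, ?_⟩
  · set b := (shrinkingBump n j).normed volume with hb
    have hbs : ContDiff ℝ ∞ b := ContDiffBump.contDiff_normed _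
    have hbc : HasCompactSupport b := ContDiffBump.hasCompactSupport_normed _
    set ψ := fun t => b (x - t) with hψ
    have hψs : ContDiff ℝ ∞ ψ := hbs.comp (contDiff_const.sub contDiff_id)
    have hsupp : tsupport ψ ⊆ closedBall x (shrinkingBump n j).rOut := by
      refine closure_minimal (fun t ht => ?_) isClosed_closedBall
      have : x - t ∈ Function.support b := ht
      rw [hb, ContDiffBump.support_normed_eq] at this
      rw [mem_closedBall, dist_comm, dist_eq_norm]
      simpa using (mem_ball_zero_iff.1 this).le
    have hψK : tsupport ψ ⊆ K' := fun t ht => by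
      refine mem_cthickening_of_dist_le t x δ K hx ?_
      exact (mem_closedBall.1 (hsupp ht)).trans hj1.le
    have hψc : HasCompactSupport ψ :=
      HasCompactSupport.of_support_subset_isCompact (isCompact_closedBall x _)
        ((subset_tsupport _).trans hsupp)
    have hψd : ∀ t, fderiv ℝ ψ t v = - fderiv ℝ b (x - t) v := fun t => by
      have h1 : HasFDerivAt ψ _ t :=
        HasFDerivAt.comp t ((hbs.differentiable (by simp)) (x - t)).hasFDerivAt
          ((hasFDerivAt_const x t).sub (hasFDerivAt_id t))
      rw [h1.fderiv]
      simp
    have hψd0 : ∀ t ∉ K', fderiv ℝ ψ t v = 0 := fun t ht => by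
      have : fderiv ℝ ψ t = 0 := by
        by_contra hne
        exact ht (hψK (support_fderiv_subset ℝ hne))
      simp [this]
    have hψ0 : ∀ t ∉ K', ψ t = 0 := fun t ht =>
      image_eq_zero_of_notMem_tsupport fun h => ht (hψK h)
    let L := (ContinuousLinearMap.lsmul ℝ ℝ : ℝ →L[ℝ] ℝ →L[ℝ] ℝ).flip
    have h0 := hbc.hasFDerivAt_convolution_right L hfi.locallyIntegrable (hbs.of_le (by simp)) x
    have hL : convolution f₁ b L volume = mollify j f₁ := convolution_flip _
    rw [hL] at h0
    rw [h0.fderiv, convolution_precompR_apply L hfi.locallyIntegrable (hbc.fderiv ℝ)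
      (hbs.continuous_fderiv (by simp)), convolution_def]
    have hint := H.integral_mul_fderiv hψs hψc (hψK.trans hδU) v
    rw [mollify_eq, real_inner_comm, ← integral_inner (𝕜 := ℝ)]
    · rw [setIntegral_eq_integral_of_forall_compl_eq_zero,
        setIntegral_eq_integral_of_forall_compl_eq_zero] at hint
      · rw [← neg_eq_iff_eq_neg, ← integral_neg] at hint
        refine Eq.trans ?_ (hint.trans ?_)
        · refine integral_congr_ae (Eventually.of_forall fun t => ?_)
          by_cases ht : t ∈ K'
          · simp [hf₁, ht, hψd, L, mul_comm]
          · have := hψd0 t ht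
            simp [hf₁, ht, this]
        · refine integral_congr_ae (Eventually.of_forall fun t => ?_)
          by_cases ht : t ∈ K'
          · simp [hg₁, ht, hψ, hb, inner_smul_right, real_inner_comm, mul_comm]
          · simp [hg₁, ht, hψ0 t ht]
      · intro t ht
        rw [hψ0 t fun h => ht (hδU h), mul_zero]
      · intro t ht
        rw [hψd0 t fun h => ht (hδU h), mul_zero]
    · exact hgi.locallyIntegrable.integrable_smul_left_of_hasCompactSupport hψs.continuous hψc
  · refine le_trans ?_ hj2
    rw [← lintegral_indicator hK.measurableSet]
    refine lintegral_mono (indicator_le fun y hy => ?_)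
    rw [hf₁, indicator_of_mem (hKK' hy)]
  · refine le_trans ?_ hj3
    rw [← lintegral_indicator hK.measurableSet]
    refine lintegral_mono (indicator_le fun y hy => ?_)
    rw [hg₁, indicator_of_mem (hKK' hy)]

/-! ### Chain rule and locality of the weak gradient. -/

namespace HasWeakGradient

variable {U : Set (EuclideanSpace ℝ (Fin n))} {u : EuclideanSpace ℝ (Fin n) → ℝ}
  {h : EuclideanSpace ℝ (Fin n) → EuclideanSpace ℝ (Fin n)}

/-- Passing to a subsequence adds almost everywhere convergence, which is needed to take limits
inside a merely continuous derivative `deriv S`. -/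
theorem exists_contDiff_seq (hU : IsOpen U) (H : HasWeakGradient U u h)
    {K : Set (EuclideanSpace ℝ (Fin n))} (hK : IsCompact K) (hKU : K ⊆ U) :
    ∃ (φ : ℕ → EuclideanSpace ℝ (Fin n) → ℝ)
      (Φ : ℕ → EuclideanSpace ℝ (Fin n) → EuclideanSpace ℝ (Fin n)),
      (∀ j, ContDiff ℝ ∞ (φ j)) ∧ (∀ j, Continuous (Φ j)) ∧
      (∀ j, ∀ x ∈ K, ∀ v, fderiv ℝ (φ j) x v = inner ℝ (Φ j x) v) ∧
      Tendsto (fun j => ∫⁻ x in K, ‖φ j x - u x‖ₑ) atTop (𝓝 0) ∧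
      Tendsto (fun j => ∫⁻ x in K, ‖Φ j x - h x‖ₑ) atTop (𝓝 0) ∧
      ∀ᵐ x ∂(volume.restrict K), Tendsto (fun j => φ j x) atTop (𝓝 (u x)) := by
  have hpos : ∀ j : ℕ, ((j : ℝ≥0∞) + 1)⁻¹ ≠ 0 := fun j => ENNReal.inv_ne_zero.2 (by finiteness)
  choose φ Φ h1 h2 h3 h4 h5 using fun j : ℕ => H.exists_contDiff_approx hU hK hKU (hpos j)
  have hlim : Tendsto (fun j : ℕ => ((j : ℝ≥0∞) + 1)⁻¹) atTop (𝓝 0) := by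
    have := (tendsto_add_atTop_iff_nat 1).2 ENNReal.tendsto_inv_nat_nhds_zero
    simpa using this
  have t1 : Tendsto (fun j => ∫⁻ x in K, ‖φ j x - u x‖ₑ) atTop (𝓝 0) :=
    tendsto_of_tendsto_of_tendsto_of_le_of_le tendsto_const_nhds hlim (fun _ => zero_le) h4
  have t2 : Tendsto (fun j => ∫⁻ x in K, ‖Φ j x - h x‖ₑ) atTop (𝓝 0) :=
    tendsto_of_tendsto_of_tendsto_of_le_of_le tendsto_const_nhds hlim (fun _ => zero_le) h5
  have hm : TendstoInMeasure (volume.restrict K) φ atTop u := by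
    refine tendstoInMeasure_of_tendsto_eLpNorm one_ne_zero
      (fun j => (h1 j).continuous.aestronglyMeasurable)
      (H.1.integrableOn_compact_subset hKU hK).1 ?_
    simpa only [eLpNorm_one_eq_lintegral_enorm, Pi.sub_apply] using t1
  obtain ⟨ns, hns, hae⟩ := hm.exists_seq_tendsto_ae
  exact ⟨fun j => φ (ns j), fun j => Φ (ns j), fun j => h1 _, fun j => h2 _, fun j => h3 _,
    t1.comp hns.tendsto_atTop, t2.comp hns.tendsto_atTop, hae⟩

/-- The chain rule for weak gradients, in integrated form. -/
theorem integral_comp_mul_fderiv (hU : IsOpen U) (H : HasWeakGradient U u h) {S : ℝ → ℝ}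
    (hS : ContDiff ℝ 1 S) (hS' : ∀ t, ‖deriv S t‖ ≤ 1) {ψ : EuclideanSpace ℝ (Fin n) → ℝ}
    (hψ : ContDiff ℝ ∞ ψ) (hc : HasCompactSupport ψ) (hs : tsupport ψ ⊆ U)
    (v : EuclideanSpace ℝ (Fin n)) :
    ∫ x in tsupport ψ, S (u x) * fderiv ℝ ψ x v
      = - ∫ x in tsupport ψ, deriv S (u x) * inner ℝ (h x) v * ψ x := by
  set K := tsupport ψ with hK
  have hKc : IsCompact K := hc
  obtain ⟨φ, Φ, h1, h2, h3, h4, h5, h6⟩ := H.exists_contDiff_seq hU hKc hs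
  have hui : IntegrableOn u K volume := H.1.integrableOn_compact_subset hs hKc
  have hhi : IntegrableOn h K volume := H.2.1.integrableOn_compact_subset hs hKc
  have hSd : Continuous (deriv S) := hS.continuous_deriv le_rfl
  have hψd := continuous_fderiv_apply_const hψ v
  have hψdc : HasCompactSupport fun x => fderiv ℝ ψ x v :=
    hc.of_isClosed_subset (isClosed_tsupport _) (tsupport_fderiv_apply_subset' _)
  obtain ⟨M, hM⟩ := hψ.continuous.bounded_above_of_compact_support hc
  obtain ⟨M', hM'⟩ := hψd.bounded_above_of_compact_support hψdc
  have hLip : LipschitzWith 1 S := lipschitzWith_of_nnnorm_deriv_le (hS.differentiable one_ne_zero)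
    fun t => by exact_mod_cast hS' t
  have lhs : Tendsto (fun j => ∫ x in K, S (φ j x) * fderiv ℝ ψ x v) atTop
      (𝓝 (∫ x in K, S (u x) * fderiv ℝ ψ x v)) := by
    refine tendsto_integral_of_L1 _ ?_ ?_ ?_
    · exact (hS.continuous.comp_aestronglyMeasurable hui.1).mul hψd.aestronglyMeasurable
    · refine Eventually.of_forall fun j => ?_
      exact ((hS.continuous.comp (h1 j).continuous).mul hψd).continuousOn.integrableOn_compact hKc
    · have hb : Tendsto (fun j => ENNReal.ofReal M' * ∫⁻ x in K, ‖φ j x - u x‖ₑ) atTop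
          (𝓝 (ENNReal.ofReal M' * 0)) :=
        ENNReal.Tendsto.const_mul h4 (Or.inr ENNReal.ofReal_ne_top)
      rw [mul_zero] at hb
      refine tendsto_of_tendsto_of_tendsto_of_le_of_le tendsto_const_nhds hb
        (fun _ => zero_le) fun j => ?_
      rw [← lintegral_const_mul' _ _ ENNReal.ofReal_ne_top]
      refine lintegral_mono fun x => ?_
      rw [← sub_mul, enorm_mul, mul_comm]
      gcongr
      · rw [← ofReal_norm]; exact ENNReal.ofReal_le_ofReal (hM' x)
      · have := hLip (φ j x) (u x)
        simpa [edist_eq_enorm_sub] using this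
  have rhs : Tendsto (fun j => ∫ x in K, deriv S (φ j x) * inner ℝ (Φ j x) v * ψ x) atTop
      (𝓝 (∫ x in K, deriv S (u x) * inner ℝ (h x) v * ψ x)) := by
    refine tendsto_integral_of_L1 _ ?_ ?_ ?_
    · exact ((hSd.comp_aestronglyMeasurable hui.1).mul (hhi.inner_const v).1).mul
        hψ.continuous.aestronglyMeasurable
    · refine Eventually.of_forall fun j => ?_
      exact (((hSd.comp (h1 j).continuous).mul ((h2 j).inner continuous_const)).mul
        hψ.continuous).continuousOn.integrableOn_compact hKc
    -- The error splits as S'(φⱼ)⟨Φⱼ - h, v⟩ψ + (S'(φⱼ) - S'(u))⟨h, v⟩ψ. The first term tends to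
    -- zero by L¹ convergence and |S'| ≤ 1, the second by dominated convergence.
    · have hb1 : Tendsto (fun j => ENNReal.ofReal (‖v‖ * M) * ∫⁻ x in K, ‖Φ j x - h x‖ₑ) atTop
          (𝓝 (ENNReal.ofReal (‖v‖ * M) * 0)) :=
        ENNReal.Tendsto.const_mul h5 (Or.inr ENNReal.ofReal_ne_top)
      have hb2 : Tendsto (fun j => ∫⁻ x in K,
          ‖(deriv S (φ j x) - deriv S (u x)) * (inner ℝ (h x) v * ψ x)‖ₑ) atTop
          (𝓝 (∫⁻ x in K, 0)) := by
        refine tendsto_lintegral_of_dominated_convergence'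
          (fun x => 2 * ‖inner ℝ (h x) v * ψ x‖ₑ) (fun j => ?_) (fun j => ?_) ?_ ?_
        · exact ((((hSd.comp (h1 j).continuous).aestronglyMeasurable.sub
            (hSd.comp_aestronglyMeasurable hui.1)).mul
            ((hhi.inner_const v).1.mul hψ.continuous.aestronglyMeasurable))).enorm
        · refine Eventually.of_forall fun x => ?_
          simp only [enorm_mul (_ - _)]
          gcongr
          refine enorm_sub_le.trans ?_
          have hle : ∀ t, ‖deriv S t‖ₑ ≤ 1 := fun t => by
            rw [← ofReal_norm]; exact ENNReal.ofReal_le_one.2 (hS' t)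
          exact (add_le_add (hle _) (hle _)).trans_eq one_add_one_eq_two
        · rw [lintegral_const_mul' _ _ (by simp)]
          refine ENNReal.mul_ne_top (by simp) ?_
          exact (Integrable.mul_bdd (hhi.inner_const v)
            hψ.continuous.aestronglyMeasurable (Eventually.of_forall hM)).2.ne
        · filter_upwards [h6] with x hx
          have h7 : Tendsto (fun j => (deriv S (φ j x) - deriv S (u x)) * (inner ℝ (h x) v * ψ x))
              atTop (𝓝 ((deriv S (u x) - deriv S (u x)) * (inner ℝ (h x) v * ψ x))) :=
            (((hSd.tendsto _).comp hx).sub_const _).mul_const _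
          rw [sub_self, zero_mul] at h7
          simpa using h7.enorm
      rw [lintegral_zero] at hb2
      have hb := hb1.add hb2
      rw [mul_zero, zero_add] at hb
      refine tendsto_of_tendsto_of_tendsto_of_le_of_le tendsto_const_nhds hb
        (fun _ => zero_le) fun j => ?_
      rw [← lintegral_const_mul' _ _ ENNReal.ofReal_ne_top, ← lintegral_add_left']
      · refine lintegral_mono fun x => ?_
        have e1 : deriv S (φ j x) * inner ℝ (Φ j x) v * ψ x - deriv S (u x) * inner ℝ (h x) v * ψ x
            = deriv S (φ j x) * inner ℝ (Φ j x - h x) v * ψ x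
              + (deriv S (φ j x) - deriv S (u x)) * (inner ℝ (h x) v * ψ x) := by
          rw [inner_sub_left]; ring
        rw [e1]
        refine (enorm_add_le _ _).trans ?_
        gcongr
        rw [← ofReal_norm, ← ofReal_norm, ← ENNReal.ofReal_mul (by
          have := (norm_nonneg _).trans (hM x); positivity)]
        refine ENNReal.ofReal_le_ofReal ?_
        rw [norm_mul, norm_mul]
        calc ‖deriv S (φ j x)‖ * ‖inner ℝ (Φ j x - h x) v‖ * ‖ψ x‖
            ≤ 1 * (‖Φ j x - h x‖ * ‖v‖) * M := by
              gcongr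
              · exact hS' _
              · exact norm_inner_le_norm _ _
              · exact hM x
          _ = ‖v‖ * M * ‖Φ j x - h x‖ := by ring
      · exact (((h2 j).aestronglyMeasurable.sub hhi.1).enorm).const_mul _
  have heq : ∀ j, ∫ x in K, S (φ j x) * fderiv ℝ ψ x v
      = - ∫ x in K, deriv S (φ j x) * inner ℝ (Φ j x) v * ψ x := by
    intro j
    have hSφ : ContDiff ℝ 1 fun x => S (φ j x) := hS.comp ((h1 j).of_le (by simp))
    have hdd : ∀ x, fderiv ℝ (fun x => S (φ j x)) x v
        = deriv S (φ j x) * fderiv ℝ (φ j) x v := fun x => by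
      have : HasFDerivAt (fun x => S (φ j x)) _ x :=
        ((hS.differentiable one_ne_zero (φ j x)).hasDerivAt).comp_hasFDerivAt x
          (((h1 j).differentiable (by simp)) x).hasFDerivAt
      rw [this.fderiv]; simp
    have hdc : Continuous fun x => fderiv ℝ (fun x => S (φ j x)) x v :=
      (hSφ.continuous_fderiv one_ne_zero).clm_apply continuous_const
    have key := integral_mul_fderiv_eq_neg_fderiv_mul_of_integrable (μ := volume) (v := v)
      (f := fun x => S (φ j x)) (g := ψ)
      ((hdc.mul hψ.continuous).integrable_of_hasCompactSupport hc.mul_left)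
      ((hSφ.continuous.mul hψd).integrable_of_hasCompactSupport hψdc.mul_left)
      ((hSφ.continuous.mul hψ.continuous).integrable_of_hasCompactSupport hc.mul_left)
      (fun x _ => hSφ.differentiable one_ne_zero x)
      (fun x _ => hψ.differentiable (by simp) x)
    rw [setIntegral_eq_integral_of_forall_compl_eq_zero fun x hx => ?_, key]
    · congr 1
      rw [← setIntegral_eq_integral_of_forall_compl_eq_zero (s := K) fun x hx => ?_]
      · refine setIntegral_congr_fun hKc.measurableSet fun x hx => ?_
        simp only [hdd, h3 j x hx v]
      · rw [image_eq_zero_of_notMem_tsupport hx, mul_zero]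
    · have : fderiv ℝ ψ x = 0 := by
        by_contra hne
        exact hx (support_fderiv_subset ℝ hne)
      simp [this]
  simp_rw [heq] at lhs
  exact tendsto_nhds_unique lhs rhs.neg

/-- The weak gradient vanishes almost everywhere on the zero set of the function. -/
theorem ae_eq_zero_of_eq_zero (hU : IsOpen U) (H : HasWeakGradient U u h) :
    ∀ᵐ x ∂(volume.restrict U), u x = 0 → h x = 0 := by
  classical
  -- These functions tend to zero uniformly, while their derivatives are bounded by 1 and converge
  -- to the indicator of {0}. In the limit the chain rule says that the indicator of {u = 0} times
  -- `h` integrates to zero against every test function.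
  let S : ℕ → ℝ → ℝ := fun k t => Real.arctan ((k + 1) * t) / (k + 1)
  have hSd : ∀ k t, HasDerivAt (S k) (1 / (1 + ((k + 1) * t) ^ 2)) t := by
    intro k t
    have h1 := (((hasDerivAt_id t).const_mul ((k : ℝ) + 1)).arctan).div_const ((k : ℝ) + 1)
    have hk : (k : ℝ) + 1 ≠ 0 := by positivity
    refine h1.congr_deriv ?_
    rw [mul_one, mul_div_assoc, div_self hk, mul_one]
    rfl
  have hSd' : ∀ k t, deriv (S k) t = 1 / (1 + ((k + 1) * t) ^ 2) := fun k t => (hSd k t).deriv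
  have hSc : ∀ k, ContDiff ℝ 1 (S k) := fun k =>
    (Real.contDiff_arctan.comp (contDiff_const.mul contDiff_id)).div_const _
  have hS1 : ∀ k t, ‖deriv (S k) t‖ ≤ 1 := fun k t => by
    rw [hSd', Real.norm_of_nonneg (by positivity)]
    exact div_le_one_of_le₀ (by nlinarith [sq_nonneg (((k : ℝ) + 1) * t)]) (by positivity)
  have hSb : ∀ k t, ‖S k t‖ ≤ 2 / (k + 1) := fun k t => by
    have h1 : (0 : ℝ) < k + 1 := by positivity
    simp only [S]
    rw [norm_div, Real.norm_of_nonneg h1.le]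
    gcongr
    rw [Real.norm_eq_abs, abs_le]
    have := Real.arctan_lt_pi_div_two (((k : ℝ) + 1) * t)
    have := Real.neg_pi_div_two_lt_arctan (((k : ℝ) + 1) * t)
    have := Real.pi_lt_four
    constructor <;> linarith
  have hlimd : ∀ t : ℝ, Tendsto (fun k => deriv (S k) t) atTop (𝓝 (if t = 0 then 1 else 0)) := by
    intro t
    simp_rw [hSd']
    split_ifs with ht
    · simp [ht]
    · have h1 : Tendsto (fun k : ℕ => (k : ℝ) + 1) atTop atTop :=
        tendsto_atTop_add_const_right _ _ tendsto_natCast_atTop_atTop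
      have h2 : Tendsto (fun k : ℕ => 1 + (((k : ℝ) + 1) * t) ^ 2) atTop atTop := by
        refine tendsto_atTop_add_const_left _ _ ?_
        simp_rw [mul_pow]
        exact ((tendsto_pow_atTop two_ne_zero).comp h1).atTop_mul_const (by positivity)
      exact Tendsto.div_atTop tendsto_const_nhds h2
  have hloc : ∀ i, ∀ K ⊆ U, IsCompact K →
      IntegrableOn (fun x => (if u x = 0 then (1 : ℝ) else 0) * h x i) K volume := by
    intro i K hKU hK
    have hi : IntegrableOn (fun x => h x i) K volume :=
      (locallyIntegrableOn_coord H.2.1 i).integrableOn_compact_subset hKU hK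
    refine Integrable.mono hi ?_ (Eventually.of_forall fun x => ?_)
    · refine aestronglyMeasurable_of_tendsto_ae atTop
        (f := fun k x => deriv (S k) (u x) * h x i) (fun k => ?_)
        (Eventually.of_forall fun x => (hlimd (u x)).mul_const _)
      exact (((hSc k).continuous_deriv le_rfl).comp_aestronglyMeasurable
        (H.1.integrableOn_compact_subset hKU hK).1).mul hi.1
    · split_ifs <;> simp
  have key : ∀ i, ∀ᵐ x ∂(volume.restrict U), (if u x = 0 then (1 : ℝ) else 0) * h x i = 0 := by
    intro i
    rw [ae_restrict_iff' hU.measurableSet]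
    refine hU.ae_eq_zero_of_integral_contDiff_smul_eq_zero
      ((locallyIntegrableOn_iff hU.isLocallyClosed).2 (hloc i)) fun ψ hψ hc hs => ?_
    set K := tsupport ψ with hK
    have hKc : IsCompact K := hc
    have hi : IntegrableOn (fun x => h x i) K volume :=
      (locallyIntegrableOn_coord H.2.1 i).integrableOn_compact_subset hs hKc
    obtain ⟨M, hM⟩ := hψ.continuous.bounded_above_of_compact_support hc
    have hψd := continuous_fderiv_apply_const hψ (EuclideanSpace.single i 1)
    have heq := fun k => H.integral_comp_mul_fderiv hU (hSc k) (hS1 k) hψ hc hs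
      (EuclideanSpace.single i 1)
    have l1 : Tendsto (fun k => ∫ x in K, S k (u x) * fderiv ℝ ψ x (EuclideanSpace.single i 1))
        atTop (𝓝 0) := by
      have hb : Tendsto (fun k : ℕ => 2 / ((k : ℝ) + 1) *
          ∫ x in K, ‖fderiv ℝ ψ x (EuclideanSpace.single i 1)‖) atTop (𝓝 (0 * _)) :=
        (Tendsto.div_atTop tendsto_const_nhds
          (tendsto_atTop_add_const_right _ _ tendsto_natCast_atTop_atTop)).mul_const _
      rw [zero_mul] at hb
      refine squeeze_zero_norm (fun k => ?_) hb
      rw [← integral_const_mul]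
      refine norm_integral_le_of_norm_le
        ((hψd.norm.continuousOn.integrableOn_compact hKc).const_mul _)
        (Eventually.of_forall fun x => ?_)
      rw [norm_mul]
      gcongr
      exact hSb k _
    have l2 : Tendsto (fun k => ∫ x in K, deriv (S k) (u x) *
        inner ℝ (h x) (EuclideanSpace.single i 1) * ψ x) atTop
        (𝓝 (∫ x in K, (if u x = 0 then (1 : ℝ) else 0) *
          inner ℝ (h x) (EuclideanSpace.single i 1) * ψ x)) := by
      have hii : IntegrableOn (fun x => inner ℝ (h x) (EuclideanSpace.single i 1)) K volume := by
        simpa [EuclideanSpace.inner_single_right] using hi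
      refine tendsto_integral_of_dominated_convergence
        (fun x => ‖inner ℝ (h x) (EuclideanSpace.single i (1 : ℝ))‖ * M) (fun k => ?_)
        (hii.norm.mul_const _) (fun k => Eventually.of_forall fun x => ?_)
        (Eventually.of_forall fun x => ((hlimd (u x)).mul_const _).mul_const _)
      · exact ((((hSc k).continuous_deriv le_rfl).comp_aestronglyMeasurable
          (H.1.integrableOn_compact_subset hs hKc).1).mul hii.1).mul
          hψ.continuous.aestronglyMeasurable
      · rw [norm_mul, norm_mul]
        calc _ ≤ 1 * ‖inner ℝ (h x) (EuclideanSpace.single i (1 : ℝ))‖ * M := by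
              gcongr
              · exact hS1 k _
              · exact hM x
          _ = _ := by rw [one_mul]
    have l3 := tendsto_nhds_unique l2.neg (l1.congr heq)
    rw [neg_eq_zero] at l3
    rw [← setIntegral_eq_integral_of_forall_compl_eq_zero (s := K)]
    · refine Eq.trans ?_ l3
      refine integral_congr_ae (Eventually.of_forall fun x => ?_)
      simp [EuclideanSpace.inner_single_right, mul_comm]
    · intro x hx
      rw [image_eq_zero_of_notMem_tsupport hx, zero_smul]
  filter_upwards [ae_all_iff.2 key] with x hx hux
  ext i
  simpa [hux] using hx i

end HasWeakGradient

/-! ### Upper gradients bound distributional derivatives. -/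

/-- `G` is an upper gradient of `u` along all short segments starting in a compact part of `U`. -/
def IsLocalUpperGradient (U : Set (EuclideanSpace ℝ (Fin n)))
    (u G : EuclideanSpace ℝ (Fin n) → ℝ≥0∞) : Prop :=
  ∀ K ⊆ U, IsCompact K → ∃ δ > 0, ∀ x ∈ K, ∀ z, ‖z‖ < δ →
    u x ≤ u (x + z) + ‖z‖ₑ * ∫⁻ s in Icc (0 : ℝ) 1, G (x + s • z)

theorem enorm_toReal_sub_le {a b c : ℝ≥0∞} (ha : a ≠ ⊤) (hb : b ≠ ⊤) (h1 : a ≤ b + c)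
    (h2 : b ≤ a + c) : ‖a.toReal - b.toReal‖ₑ ≤ c := by
  rcases eq_or_ne c ⊤ with rfl | hc
  · exact le_top
  rw [← ofReal_norm, ← ENNReal.ofReal_toReal hc]
  refine ENNReal.ofReal_le_ofReal ?_
  have h1' := ENNReal.toReal_mono (by finiteness) h1
  have h2' := ENNReal.toReal_mono (by finiteness) h2
  rw [ENNReal.toReal_add hb hc] at h1'
  rw [ENNReal.toReal_add ha hc] at h2'
  rw [Real.norm_eq_abs, abs_le]
  constructor <;> linarith

theorem setLIntegral_Icc_one_sub (F : ℝ → ℝ≥0∞) :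
    ∫⁻ s in Icc (0 : ℝ) 1, F (1 - s) = ∫⁻ s in Icc (0 : ℝ) 1, F s := by
  rw [← lintegral_indicator measurableSet_Icc, ← lintegral_indicator measurableSet_Icc,
    ← lintegral_sub_left_eq_self _ (1 : ℝ)]
  refine lintegral_congr fun s => ?_
  have : 1 - s ∈ Icc (0 : ℝ) 1 ↔ s ∈ Icc (0 : ℝ) 1 := by
    simp only [mem_Icc]
    constructor <;> rintro ⟨_, _⟩ <;> constructor <;> linarith
  by_cases hs : s ∈ Icc (0 : ℝ) 1
  · rw [indicator_of_mem (this.2 hs), indicator_of_mem hs, sub_sub_cancel]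
  · rw [indicator_of_notMem (fun h => hs (this.1 h)), indicator_of_notMem hs]

namespace IsLocalUpperGradient

variable {U : Set (EuclideanSpace ℝ (Fin n))} {u G : EuclideanSpace ℝ (Fin n) → ℝ≥0∞}

/-- The defining inequality is one-sided. Its reverse is the same inequality started at x + z with
increment -z, which is legitimate on a slightly thickened compact set; the integral over the segment
does not see its orientation. -/
theorem exists_enorm_sub_le (hU : IsOpen U) (H : IsLocalUpperGradient U u G)
    {K : Set (EuclideanSpace ℝ (Fin n))} (hK : IsCompact K) (hKU : K ⊆ U) :
    ∃ δ > 0, cthickening δ K ⊆ U ∧ ∀ x ∈ K, ∀ z, ‖z‖ < δ → u x ≠ ⊤ → u (x + z) ≠ ⊤ →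
      ‖(u x).toReal - (u (x + z)).toReal‖ₑ ≤
        ‖z‖ₑ * ∫⁻ s in Icc (0 : ℝ) 1, G (x + s • z) := by
  obtain ⟨δ₀, hδ₀, hsub⟩ := hK.exists_cthickening_subset_open hU hKU
  obtain ⟨δ₁, hδ₁, h1⟩ := H _ hsub hK.cthickening
  refine ⟨min δ₀ δ₁, lt_min hδ₀ hδ₁, (cthickening_mono (min_le_left _ _) _).trans hsub,
    fun x hx z hz hx1 hx2 => enorm_toReal_sub_le hx1 hx2 ?_ ?_⟩
  · exact h1 x (self_subset_cthickening _ hx) z (hz.trans_le (min_le_right _ _))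
  · have hmem : x + z ∈ cthickening δ₀ K := by
      refine mem_cthickening_of_dist_le _ x _ _ hx ?_
      simpa using (hz.trans_le (min_le_left _ _)).le
    have := h1 (x + z) hmem (-z) (by rw [norm_neg]; exact hz.trans_le (min_le_right _ _))
    rw [add_neg_cancel_right, enorm_neg] at this
    refine this.trans (le_of_eq ?_)
    rw [← setLIntegral_Icc_one_sub fun s => G (x + s • z)]
    congr 3
    ext s
    congr 1
    module

/-- A translation turns ∫ u(x)(ψ(x) - ψ(x - z)) into ∫ (u(x) - u(x + z))ψ(x), to which the upper
gradient applies. Tonelli and a translation back leave averages of ∫ G(x)|ψ(x - s z)|, which differ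
from ∫ G|ψ| by O(|z|) since ψ is Lipschitz. With z = t v, dividing by t and letting t → 0 gives the
claim. -/
theorem enorm_integral_mul_fderiv_le (hU : IsOpen U) (hu : Measurable u) (hG : Measurable G)
    (H : IsLocalUpperGradient U u G)
    (huK : ∀ K ⊆ U, IsCompact K → ∫⁻ x in K, u x ≠ ⊤)
    (hGK : ∀ K ⊆ U, IsCompact K → ∫⁻ x in K, G x ≠ ⊤)
    {ψ : EuclideanSpace ℝ (Fin n) → ℝ} (hψ : ContDiff ℝ ∞ ψ) (hc : HasCompactSupport ψ)
    (hs : tsupport ψ ⊆ U) (v : EuclideanSpace ℝ (Fin n)) :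
    ‖∫ x in U, (u x).toReal * fderiv ℝ ψ x v‖ₑ ≤ ‖v‖ₑ * ∫⁻ x in U, G x * ‖ψ x‖ₑ := by
  set K := tsupport ψ with hKdef
  have hKc : IsCompact K := hc
  obtain ⟨δ, hδ, hδU, hδH⟩ := H.exists_enorm_sub_le hU hKc hs
  set K' := cthickening δ K with hK'
  have hK'c : IsCompact K' := hKc.cthickening
  have hKK' : K ⊆ K' := self_subset_cthickening K
  set w := K'.indicator fun x => (u x).toReal with hw
  have hwi : Integrable w volume := (integrable_indicator_iff hK'c.measurableSet).2
    (integrable_toReal_of_lintegral_ne_top hu.aemeasurable (huK _ hδU hK'c))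
  have hfin : ∀ᵐ x ∂(volume : Measure (EuclideanSpace ℝ (Fin n))), x ∈ K' → u x ≠ ⊤ := by
    rw [← ae_restrict_iff' hK'c.measurableSet]
    exact (ae_lt_top hu (huK _ hδU hK'c)).mono fun x hx => hx.ne
  obtain ⟨L, hL⟩ := (hψ.continuous_fderiv (by simp)).bounded_above_of_compact_support
    (hc.fderiv ℝ)
  have hL0 : 0 ≤ L := (norm_nonneg _).trans (hL 0)
  have hLip : ∀ x y, ‖ψ x - ψ y‖ ≤ L * ‖x - y‖ := fun x y =>
    convex_univ.norm_image_sub_le_of_norm_fderiv_le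
      (fun z _ => hψ.differentiable (by simp) z) (fun z _ => hL z) (mem_univ y) (mem_univ x)
  -- The second term is the Lipschitz error; after division by |z| it still carries a factor |z| and
  -- vanishes in the limit.
  have bound : ∀ z, ‖z‖ < δ → ‖∫ x, w x * (ψ x - ψ (x - z))‖ₑ ≤
      ‖z‖ₑ * ((∫⁻ x in U, G x * ‖ψ x‖ₑ) + ENNReal.ofReal (L * ‖z‖) * ∫⁻ x in K', G x) := by
    intro z hz
    have hi1 : Integrable fun x => w x * ψ x := by
      refine hwi.mul_bdd hψ.continuous.aestronglyMeasurable
        (c := (hψ.continuous.bounded_above_of_compact_support hc).choose)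
        (Eventually.of_forall (hψ.continuous.bounded_above_of_compact_support hc).choose_spec)
    have hi2 : Integrable fun x => w x * ψ (x - z) := by
      refine hwi.mul_bdd (hψ.continuous.comp (continuous_id.sub
        continuous_const)).aestronglyMeasurable
        (c := (hψ.continuous.bounded_above_of_compact_support hc).choose)
        (Eventually.of_forall fun x =>
          (hψ.continuous.bounded_above_of_compact_support hc).choose_spec _)
    have hi3 : Integrable fun x => w (x + z) * ψ x := by
      simpa using hi2.comp_add_right z
    have e1 : ∫ x, w x * (ψ x - ψ (x - z)) = ∫ x, (w x - w (x + z)) * ψ x := by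
      simp only [mul_sub, sub_mul]
      rw [integral_sub hi1 hi2, integral_sub hi1 hi3]
      congr 1
      rw [← integral_add_right_eq_self _ z]
      simp
    have hfin' : ∀ᵐ x ∂(volume : Measure (EuclideanSpace ℝ (Fin n))), x + z ∈ K' → u (x + z) ≠ ⊤ :=
      (measurePreserving_add_right volume z).quasiMeasurePreserving.ae hfin
    rw [e1]
    calc ‖∫ x, (w x - w (x + z)) * ψ x‖ₑ ≤ ∫⁻ x, ‖(w x - w (x + z)) * ψ x‖ₑ :=
          enorm_integral_le_lintegral_enorm _
      _ ≤ ∫⁻ x, ‖z‖ₑ * ∫⁻ s in Icc (0 : ℝ) 1, G (x + s • z) * ‖ψ x‖ₑ := by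
          refine lintegral_mono_ae ?_
          filter_upwards [hfin, hfin'] with x hx1 hx2
          by_cases hxK : x ∈ K
          · have hxz : x + z ∈ K' := by
              refine mem_cthickening_of_dist_le _ x _ _ hxK ?_
              simpa using hz.le
            rw [enorm_mul, lintegral_mul_const _ (by fun_prop), ← mul_assoc, hw,
              indicator_of_mem (hKK' hxK), indicator_of_mem hxz]
            gcongr
            exact hδH x hxK z hz (hx1 (hKK' hxK)) (hx2 hxz)
          · simp [image_eq_zero_of_notMem_tsupport hxK]
      _ = ‖z‖ₑ * ∫⁻ s in Icc (0 : ℝ) 1, ∫⁻ x, G (x + s • z) * ‖ψ x‖ₑ := by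
          rw [lintegral_const_mul' _ _ (by simp), lintegral_lintegral_swap]
          have hψc := hψ.continuous
          change AEMeasurable (fun y : EuclideanSpace ℝ (Fin n) × ℝ =>
            G (y.1 + y.2 • z) * ‖ψ y.1‖ₑ) _
          fun_prop
      _ ≤ ‖z‖ₑ * ∫⁻ s in Icc (0 : ℝ) 1, ((∫⁻ x in U, G x * ‖ψ x‖ₑ) +
            ENNReal.ofReal (L * ‖z‖) * ∫⁻ x in K', G x) := by
          gcongr ‖z‖ₑ * ?_
          refine setLIntegral_mono' measurableSet_Icc fun s hs01 => ?_
          have hsz : ‖s • z‖ ≤ ‖z‖ := by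
            rw [norm_smul, Real.norm_of_nonneg hs01.1]
            exact mul_le_of_le_one_left (norm_nonneg _) hs01.2
          rw [← lintegral_sub_right_eq_self _ (s • z)]
          simp only [sub_add_cancel]
          calc ∫⁻ x, G x * ‖ψ (x - s • z)‖ₑ
              ≤ ∫⁻ x, (U.indicator (fun x => G x * ‖ψ x‖ₑ) x +
                  K'.indicator (fun x => ENNReal.ofReal (L * ‖z‖) * G x) x) := by
                refine lintegral_mono fun x => ?_
                by_cases hx : x ∈ K'
                · simp only [indicator_of_mem hx, indicator_of_mem (hδU hx)]
                  rw [mul_comm (ENNReal.ofReal _), ← mul_add]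
                  gcongr
                  have e2 : ψ (x - s • z) = ψ x + (ψ (x - s • z) - ψ x) := by ring
                  rw [e2]
                  refine (enorm_add_le _ _).trans ?_
                  gcongr
                  rw [← ofReal_norm]
                  refine ENNReal.ofReal_le_ofReal ((hLip _ _).trans ?_)
                  gcongr
                  simpa using hsz
                · have : ψ (x - s • z) = 0 := by
                    refine image_eq_zero_of_notMem_tsupport fun hmem => hx ?_
                    refine mem_cthickening_of_dist_le _ _ _ _ hmem ?_
                    rw [dist_eq_norm, sub_sub_cancel]
                    exact hsz.trans hz.le
                  simp [this]
            _ = _ := by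
                have hψc := hψ.continuous
                rw [lintegral_add_left (by
                  refine Measurable.indicator ?_ hU.measurableSet
                  fun_prop), lintegral_indicator hU.measurableSet,
                  lintegral_indicator hK'c.measurableSet,
                  lintegral_const_mul' _ _ ENNReal.ofReal_ne_top]
      _ = _ := by simp
  -- difference quotients along a sequence of increments
  let t : ℕ → ℝ := fun j => (δ / (‖v‖ + 1)) * (1 / ((j : ℝ) + 2))
  have htpos : ∀ j, 0 < t j := fun j => by positivity
  have htlim : Tendsto t atTop (𝓝 0) := by
    have h1 : Tendsto (fun j : ℕ => 1 / ((j : ℝ) + 2)) atTop (𝓝 0) :=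
      Tendsto.div_atTop tendsto_const_nhds
        (tendsto_atTop_add_const_right _ _ tendsto_natCast_atTop_atTop)
    have h2 := h1.const_mul (δ / (‖v‖ + 1))
    rw [mul_zero] at h2
    exact h2
  have htv : ∀ j, ‖t j • v‖ < δ := fun j => by
    rw [norm_smul, Real.norm_of_nonneg (htpos j).le]
    have h1 : 1 / ((j : ℝ) + 2) < 1 := by
      rw [div_lt_one (by positivity)]
      have : (0 : ℝ) ≤ j := j.cast_nonneg
      linarith
    have h2 : t j < δ / (‖v‖ + 1) := by
      have : 0 < δ / (‖v‖ + 1) := by positivity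
      exact mul_lt_of_lt_one_right this h1
    calc t j * ‖v‖ ≤ t j * (‖v‖ + 1) := by gcongr; linarith
      _ < δ / (‖v‖ + 1) * (‖v‖ + 1) := by gcongr
      _ = δ := by field_simp
  have hlim : Tendsto (fun j => ∫ x, w x * ((t j)⁻¹ * (ψ x - ψ (x - t j • v)))) atTop
      (𝓝 (∫ x, w x * fderiv ℝ ψ x v)) := by
    refine tendsto_integral_of_dominated_convergence (fun x => ‖w x‖ * (L * ‖v‖)) (fun j => ?_)
      (hwi.norm.mul_const _) (fun j => Eventually.of_forall fun x => ?_)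
      (Eventually.of_forall fun x => ?_)
    · have hψc := hψ.continuous
      exact hwi.1.mul (Continuous.aestronglyMeasurable (by fun_prop))
    · rw [norm_mul, norm_mul, norm_inv, Real.norm_of_nonneg (htpos j).le]
      refine mul_le_mul_of_nonneg_left ?_ (norm_nonneg _)
      have := hLip x (x - t j • v)
      rw [sub_sub_cancel, norm_smul, Real.norm_of_nonneg (htpos j).le] at this
      rw [inv_mul_le_iff₀ (htpos j)]
      linarith
    · have hd : HasFDerivAt ψ (fderiv ℝ ψ x) x := (hψ.differentiable (by simp) x).hasFDerivAt
      have hl := hd.lim_real (-v) |>.comp (tendsto_inv_nhdsGT_zero.comp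
        (tendsto_nhdsWithin_iff.2 ⟨htlim, Eventually.of_forall htpos⟩))
      refine Tendsto.const_mul _ ?_
      have hl' := hl.neg
      simp only [map_neg, neg_neg] at hl'
      refine hl'.congr fun j => ?_
      simp only [Function.comp, inv_inv, smul_neg, smul_eq_mul, sub_eq_add_neg]
      ring
  have hle : ∀ j, ‖∫ x, w x * ((t j)⁻¹ * (ψ x - ψ (x - t j • v)))‖ₑ ≤
      ‖v‖ₑ * ((∫⁻ x in U, G x * ‖ψ x‖ₑ) + ENNReal.ofReal (L * ‖t j • v‖) * ∫⁻ x in K', G x) := by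
    intro j
    have e : ∫ x, w x * ((t j)⁻¹ * (ψ x - ψ (x - t j • v)))
        = (t j)⁻¹ * ∫ x, w x * (ψ x - ψ (x - t j • v)) := by
      rw [← integral_const_mul]
      congr 1; ext x; ring
    rw [e, enorm_mul]
    calc _ ≤ ‖(t j)⁻¹‖ₑ * (‖t j • v‖ₑ * ((∫⁻ x in U, G x * ‖ψ x‖ₑ) +
          ENNReal.ofReal (L * ‖t j • v‖) * ∫⁻ x in K', G x)) := by
          gcongr
          exact bound _ (htv j)
      _ = _ := by
          rw [enorm_smul, ← mul_assoc, ← mul_assoc, ← enorm_mul, inv_mul_cancel₀ (htpos j).ne',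
            enorm_one, one_mul]
  have hrhs : Tendsto (fun j => ‖v‖ₑ * ((∫⁻ x in U, G x * ‖ψ x‖ₑ) +
      ENNReal.ofReal (L * ‖t j • v‖) * ∫⁻ x in K', G x)) atTop
      (𝓝 (‖v‖ₑ * ((∫⁻ x in U, G x * ‖ψ x‖ₑ) + 0 * ∫⁻ x in K', G x))) := by
    refine ENNReal.Tendsto.const_mul (tendsto_const_nhds.add ?_) (Or.inr (by simp))
    refine ENNReal.Tendsto.mul_const ?_ (Or.inr (hGK _ hδU hK'c))
    have h1 : Tendsto (fun j => L * ‖t j • v‖) atTop (𝓝 (L * ‖(0 : ℝ) • v‖)) :=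
      ((htlim.smul_const v).norm).const_mul L
    simpa using ENNReal.tendsto_ofReal h1
  rw [zero_mul, add_zero] at hrhs
  have hfinal := le_of_tendsto_of_tendsto' hlim.enorm hrhs hle
  refine le_trans (le_of_eq ?_) hfinal
  congr 1
  rw [← integral_indicator hU.measurableSet]
  congr 1
  ext x
  by_cases hx : x ∈ K'
  · rw [indicator_of_mem (hδU hx), hw, indicator_of_mem hx]
  · have : fderiv ℝ ψ x v = 0 := by
      have : fderiv ℝ ψ x = 0 := by
        by_contra hne
        exact hx (hKK' (support_fderiv_subset ℝ hne))
      simp [this]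
    rw [this, mul_zero, indicator_apply_eq_zero]
    intro _
    rw [this, mul_zero]

end IsLocalUpperGradient

/-! ### Existence of weak gradients by duality. -/

/-- A linear functional dominated by the norm of a linear map factors through it. -/
theorem exists_continuousLinearMap_comp_eq {T H : Type*} [AddCommGroup T] [Module ℝ T]
    [NormedAddCommGroup H] [NormedSpace ℝ H] (j : T →ₗ[ℝ] H) (Λ : T →ₗ[ℝ] ℝ) (C : ℝ)
    (hb : ∀ ψ, ‖Λ ψ‖ ≤ C * ‖j ψ‖) : ∃ ℓ : H →L[ℝ] ℝ, ∀ ψ, ℓ (j ψ) = Λ ψ := by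
  have hker : LinearMap.ker j ≤ LinearMap.ker Λ := fun ψ hψ => by
    rw [LinearMap.mem_ker] at hψ ⊢
    have := hb ψ
    rw [hψ, norm_zero, mul_zero] at this
    exact norm_le_zero_iff.1 this
  let Λ' : LinearMap.range j →ₗ[ℝ] ℝ :=
    ((LinearMap.ker j).liftQ Λ hker).comp j.quotKerEquivRange.symm.toLinearMap
  have hΛ' : ∀ ψ, Λ' ⟨j ψ, LinearMap.mem_range_self j ψ⟩ = Λ ψ := fun ψ => by
    have : j.quotKerEquivRange.symm ⟨j ψ, LinearMap.mem_range_self j ψ⟩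
        = (LinearMap.ker j).mkQ ψ := by
      rw [LinearEquiv.symm_apply_eq]
      rfl
    simp only [Λ', LinearMap.comp_apply, LinearEquiv.coe_coe, this]
    simp
  let Λ'' : LinearMap.range j →L[ℝ] ℝ := Λ'.mkContinuous C (by
    rintro ⟨_, ψ, rfl⟩
    rw [hΛ']
    exact hb ψ)
  obtain ⟨ℓ, hℓ, -⟩ := exists_extension_norm_eq _ Λ''
  exact ⟨ℓ, fun ψ => (hℓ ⟨j ψ, LinearMap.mem_range_self j ψ⟩).trans (hΛ' ψ)⟩

/-- The space of test functions on `U`. -/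
def testFunctions (U : Set (EuclideanSpace ℝ (Fin n))) :
    Submodule ℝ (EuclideanSpace ℝ (Fin n) → ℝ) where
  carrier := {ψ | ContDiff ℝ ∞ ψ ∧ HasCompactSupport ψ ∧ tsupport ψ ⊆ U}
  zero_mem' := ⟨contDiff_const, HasCompactSupport.zero, by simp [tsupport_zero]⟩
  add_mem' := fun {_ _} h1 h2 => ⟨h1.1.add h2.1, h1.2.1.add h2.2.1,
    (tsupport_add _ _).trans (union_subset h1.2.2 h2.2.2)⟩
  smul_mem' := fun c _ h => ⟨contDiff_const.smul h.1, h.2.1.smul_left,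
    (tsupport_smul_subset_right (fun _ => c) _).trans h.2.2⟩

/-- The weight `(1 + ‖x‖)^(n+1)`, whose reciprocal is integrable. -/
noncomputable def polyWeight (x : EuclideanSpace ℝ (Fin n)) : ℝ≥0 := (1 + ‖x‖₊) ^ (n + 1)

theorem continuous_polyWeight : Continuous (polyWeight (n := n)) := by
  unfold polyWeight; fun_prop

theorem one_le_polyWeight (x : EuclideanSpace ℝ (Fin n)) : 1 ≤ polyWeight x :=
  one_le_pow₀ (le_add_of_nonneg_right zero_le)

theorem lintegral_inv_polyWeight_ne_top :
    ∫⁻ x : EuclideanSpace ℝ (Fin n), ((polyWeight x)⁻¹ : ℝ≥0) ≠ ⊤ := by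
  have h := integrable_one_add_norm (E := EuclideanSpace ℝ (Fin n)) (μ := volume)
    (r := (n : ℝ) + 1) (by simp)
  refine ne_of_eq_of_ne ?_ h.2.ne
  refine lintegral_congr fun x => ?_
  rw [Real.enorm_of_nonneg (by positivity), ENNReal.ofReal]
  simp only []
  rw [Real.rpow_neg (by positivity)]
  congr 1
  rw [← NNReal.coe_inj, Real.coe_toNNReal _ (by positivity)]
  simp only [polyWeight, NNReal.coe_inv, NNReal.coe_pow, NNReal.coe_add, NNReal.coe_one,
    coe_nnnorm]
  congr 1
  exact_mod_cast (Real.rpow_natCast (1 + ‖x‖) (n + 1)).symm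

/-- A distributional derivative dominated by `G` is represented by a locally integrable
function. -/
theorem exists_weak_partial_derivative {U : Set (EuclideanSpace ℝ (Fin n))} (hU : IsOpen U)
    {u : EuclideanSpace ℝ (Fin n) → ℝ} (hu : LocallyIntegrableOn u U volume)
    {G : EuclideanSpace ℝ (Fin n) → ℝ≥0∞} (hG : Measurable G)
    (hGi : ∫⁻ x in U, G x * ((polyWeight x)⁻¹ : ℝ≥0) ≠ ⊤) (v : EuclideanSpace ℝ (Fin n))
    (hb : ∀ ψ ∈ testFunctions U, ‖∫ x in U, u x * fderiv ℝ ψ x v‖ₑ ≤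
      ‖v‖ₑ * ∫⁻ x in U, G x * ‖ψ x‖ₑ) :
    ∃ d : EuclideanSpace ℝ (Fin n) → ℝ, LocallyIntegrableOn d U volume ∧
      ∀ ψ ∈ testFunctions U, ∫ x in U, u x * fderiv ℝ ψ x v = - ∫ x in U, d x * ψ x := by
  set m := polyWeight (n := n) with hm
  have hmm : Measurable m := continuous_polyWeight.measurable
  have hm0 : ∀ x, m x ≠ 0 := fun x => (one_pos.trans_le (one_le_polyWeight x)).ne'
  -- With dν = G m dx on U, Cauchy–Schwarz gives ∫ G|ψ| = ∫ m⁻¹|ψ| dν ≤ (∫ m⁻² dν)^{1/2}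
  -- ‖ψ‖_{L²(ν)}, and ∫ m⁻² dν = ∫ G m⁻¹ is finite by `hGi`. The derivative is thus a bounded
  -- functional for the norm of the Hilbert space L²(ν), and Hahn–Banach and the Riesz theorem
  -- represent it by some F ∈ L²(ν); relative to Lebesgue measure its density is ρF.
  set ρ : EuclideanSpace ℝ (Fin n) → ℝ≥0 := fun x => (G x).toNNReal * m x with hρ
  have hρm : Measurable ρ := hG.ennreal_toNNReal.mul hmm
  have hGfin : ∀ᵐ x ∂(volume.restrict U), G x ≠ ⊤ := by
    filter_upwards [ae_lt_top (hG.mul hmm.inv.coe_nnreal_ennreal) hGi] with x hx h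
    rw [Pi.mul_apply, h, ENNReal.top_mul (by simpa using hm0 x)] at hx
    exact lt_irrefl _ hx
  set ν : Measure (EuclideanSpace ℝ (Fin n)) :=
    (volume.restrict U).withDensity (fun x => (ρ x : ℝ≥0∞)) with hν
  have hlint : ∀ F : EuclideanSpace ℝ (Fin n) → ℝ≥0∞, Measurable F →
      ∫⁻ x, F x ∂ν = ∫⁻ x in U, G x * m x * F x := by
    intro F hF
    rw [hν, lintegral_withDensity_eq_lintegral_mul _ hρm.coe_nnreal_ennreal hF]
    refine lintegral_congr_ae ?_
    filter_upwards [hGfin] with x hx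
    simp [hρ, ENNReal.coe_toNNReal hx]
  -- Finiteness on compact sets puts the test functions into L²(ν), and makes L²(ν) functions
  -- locally ν-integrable, hence ρF locally integrable.
  have hfoc : IsFiniteMeasureOnCompacts ν := by
    refine ⟨fun K hK => ?_⟩
    obtain ⟨M, hM⟩ := (hK.image continuous_polyWeight).bddAbove
    rw [← lintegral_indicator_one hK.measurableSet,
      hlint _ (measurable_one.indicator hK.measurableSet)]
    refine lt_of_le_of_lt (b := ∫⁻ x in U, (M : ℝ≥0∞) ^ 2 * (G x * ((m x)⁻¹ : ℝ≥0)))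
      (lintegral_mono fun x => ?_) ?_
    · by_cases hx : x ∈ K
      · rw [indicator_of_mem hx, Pi.one_apply, mul_one]
        have h1 : (m x : ℝ≥0∞) = (m x : ℝ≥0∞) ^ 2 * ((m x)⁻¹ : ℝ≥0) := by
          rw [← ENNReal.coe_pow, ← ENNReal.coe_mul]
          congr 1
          field_simp [hm0 x]
        have h2 : m x ≤ M := hM (mem_image_of_mem _ hx)
        calc G x * m x = (m x : ℝ≥0∞) ^ 2 * (G x * ((m x)⁻¹ : ℝ≥0)) := by
              conv_lhs => rw [h1]
              ring
          _ ≤ _ := by gcongr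
      · simp [hx]
    · rw [lintegral_const_mul' _ _ (by simp)]
      exact ENNReal.mul_lt_top (by simp) hGi.lt_top
  have hmem : ∀ ψ : testFunctions U, MemLp ψ.1 2 ν := fun ψ =>
    ψ.2.1.continuous.memLp_of_hasCompactSupport ψ.2.2.1
  let j : testFunctions U →ₗ[ℝ] Lp ℝ 2 ν :=
    { toFun := fun ψ => (hmem ψ).toLp ψ.1
      map_add' := fun ψ₁ ψ₂ => MemLp.toLp_add (hmem ψ₁) (hmem ψ₂)
      map_smul' := fun c ψ => MemLp.toLp_const_smul c (hmem ψ) }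
  have hdint : ∀ ψ : testFunctions U, IntegrableOn (fun x => u x * fderiv ℝ ψ.1 x v) U volume := by
    intro ψ
    refine hu.integrableOn_mul_test (continuous_fderiv_apply_const ψ.2.1 _) ?_
      ((tsupport_fderiv_apply_subset' _).trans ψ.2.2.2)
    exact ψ.2.2.1.of_isClosed_subset (isClosed_tsupport _) (tsupport_fderiv_apply_subset' _)
  let Λ : testFunctions U →ₗ[ℝ] ℝ :=
    { toFun := fun ψ => ∫ x in U, u x * fderiv ℝ ψ.1 x v
      map_add' := fun ψ₁ ψ₂ => by
        rw [← integral_add (hdint ψ₁) (hdint ψ₂)]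
        congr 1
        ext x
        have := fderiv_add (𝕜 := ℝ) (ψ₁.2.1.differentiable (by simp) x)
          (ψ₂.2.1.differentiable (by simp) x)
        rw [Submodule.coe_add, this, add_apply, mul_add]
      map_smul' := fun c ψ => by
        rw [RingHom.id_apply, smul_eq_mul, ← integral_const_mul]
        congr 1
        ext x
        have := fderiv_const_smul (𝕜 := ℝ) (ψ.2.1.differentiable (by simp) x) c
        rw [Submodule.coe_smul, this, smul_apply, smul_eq_mul]
        ring }
  set A : ℝ≥0∞ := (∫⁻ x, ((m x)⁻¹ : ℝ≥0) ^ (2 : ℝ) ∂ν) ^ (1 / (2 : ℝ)) with hA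
  have hAfin : A ≠ ⊤ := by
    refine ENNReal.rpow_ne_top_of_nonneg (by norm_num) ?_
    rw [hlint _ (by fun_prop)]
    refine ne_of_eq_of_ne (lintegral_congr fun x => ?_) hGi
    rw [mul_assoc]
    congr 1
    rw [ENNReal.rpow_two, ← ENNReal.coe_pow, ← ENNReal.coe_mul]
    congr 1
    field_simp [hm0 x]
  have hbound : ∀ ψ, ‖Λ ψ‖ ≤ (‖v‖ₑ * A).toReal * ‖j ψ‖ := by
    intro ψ
    have hψc := ψ.2.1.continuous
    have h1 : ∫⁻ x in U, G x * ‖ψ.1 x‖ₑ = ∫⁻ x, ((m x)⁻¹ : ℝ≥0) * ‖ψ.1 x‖ₑ ∂ν := by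
      rw [hlint _ (by fun_prop)]
      refine lintegral_congr fun x => ?_
      rw [mul_assoc, ← mul_assoc (m x : ℝ≥0∞), ← ENNReal.coe_mul, mul_inv_cancel₀ (hm0 x),
        ENNReal.coe_one, one_mul]
    have h2 := ENNReal.lintegral_mul_le_Lp_mul_Lq ν Real.HolderConjugate.two_two
      (f := fun x => (((m x)⁻¹ : ℝ≥0) : ℝ≥0∞)) (g := fun x => ‖ψ.1 x‖ₑ) (by fun_prop)
      (by fun_prop)
    have h3 : (∫⁻ x, ‖ψ.1 x‖ₑ ^ (2 : ℝ) ∂ν) ^ (1 / (2 : ℝ)) = ‖j ψ‖ₑ := by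
      change _ = ‖(hmem ψ).toLp ψ.1‖ₑ
      rw [Lp.enorm_toLp, eLpNorm_eq_lintegral_rpow_enorm_toReal (by simp) (by simp)]
      simp
    have h4 : ‖Λ ψ‖ₑ ≤ (‖v‖ₑ * A) * ‖j ψ‖ₑ := by
      refine (hb ψ.1 ψ.2).trans ?_
      rw [mul_assoc, h1, ← h3]
      gcongr
      exact h2
    have h5 := ENNReal.toReal_mono (by finiteness) h4
    rwa [ENNReal.toReal_mul, toReal_enorm, toReal_enorm] at h5
  obtain ⟨ℓ, hℓ⟩ := exists_continuousLinearMap_comp_eq j Λ _ hbound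
  set F : Lp ℝ 2 ν := (InnerProductSpace.toDual ℝ (Lp ℝ 2 ν)).symm ℓ with hF
  have hrep : ∀ ψ, Λ ψ = ∫ x, F x * ψ.1 x ∂ν := by
    intro ψ
    rw [← hℓ, ← InnerProductSpace.toDual_symm_apply, L2.inner_def]
    refine integral_congr_ae ?_
    filter_upwards [(hmem ψ).coeFn_toLp] with x hx
    change inner ℝ (F x) ((hmem ψ).toLp ψ.1 x) = _
    rw [hx]
    simp [mul_comm]
  refine ⟨fun x => - (ρ x * F x), ?_, fun ψ hψ => ?_⟩
  · rw [locallyIntegrableOn_iff hU.isLocallyClosed]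
    intro K hKU hK
    have hi : IntegrableOn (fun x => F x) K ν := by
      have : IsFiniteMeasure (ν.restrict K) := ⟨by simpa using hK.measure_lt_top⟩
      exact ((Lp.memLp F).restrict K).integrable (by norm_num)
    have hi' : Integrable (K.indicator fun x => F x) ν :=
      (integrable_indicator_iff hK.measurableSet).2 hi
    have hi' := (integrable_withDensity_iff_integrable_smul hρm).1 hi'
    refine Integrable.neg ?_
    have hi2 : IntegrableOn (fun x => ρ x • K.indicator (fun x => F x) x) K volume :=
      IntegrableOn.mono_set hi' hKU
    refine hi2.congr_fun (fun x hx => ?_) hK.measurableSet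
    simp only [indicator_of_mem hx]
    rfl
  · have := hrep ⟨ψ, hψ⟩
    change ∫ x in U, u x * fderiv ℝ ψ x v = _ at this
    rw [this, ← integral_neg]
    refine (integral_withDensity_eq_integral_smul hρm _).trans ?_
    congr 1
    ext x
    simp [NNReal.smul_def]
    ring

theorem locallyIntegrableOn_of_coord {U : Set (EuclideanSpace ℝ (Fin n))} (hU : IsOpen U)
    {g : EuclideanSpace ℝ (Fin n) → EuclideanSpace ℝ (Fin n)}
    (hg : ∀ i, LocallyIntegrableOn (fun x => g x i) U volume) :
    LocallyIntegrableOn g U volume := by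
  rw [locallyIntegrableOn_iff hU.isLocallyClosed]
  intro K hKU hK
  have h1 : IntegrableOn (fun x => ∑ i, g x i • EuclideanSpace.single i (1 : ℝ)) K volume :=
    integrable_finsetSum _ fun i _ =>
      Integrable.smul_const ((hg i).integrableOn_compact_subset hKU hK) _
  refine h1.congr_fun (fun x _ => ?_) hK.measurableSet
  have := (EuclideanSpace.basisFun (Fin n) ℝ).sum_repr (g x)
  simpa using this

/-- Pointwise G w ≤ w + G^q: if G ≤ 1 the first term suffices, and if G ≥ 1 the second does since w
≤ 1 ≤ q. It serves both for w = 1 on compact sets and for the reciprocal of the polynomial weight on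
all of U. -/
theorem lintegral_restrict_ne_top_of_rpow {U : Set (EuclideanSpace ℝ (Fin n))}
    {G : EuclideanSpace ℝ (Fin n) → ℝ≥0∞} {q : ℝ} (hq : 1 ≤ q)
    (hGq : ∫⁻ x in U, G x ^ q ≠ ⊤) {w : EuclideanSpace ℝ (Fin n) → ℝ≥0∞} (hw : Measurable w)
    (hw1 : ∀ x, w x ≤ 1) (hwi : ∫⁻ x in U, w x ≠ ⊤) : ∫⁻ x in U, G x * w x ≠ ⊤ := by
  refine ne_top_of_le_ne_top (b := (∫⁻ x in U, w x) + ∫⁻ x in U, G x ^ q)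
    (ENNReal.add_ne_top.2 ⟨hwi, hGq⟩) ?_
  rw [← lintegral_add_left hw]
  refine lintegral_mono fun x => ?_
  rcases le_total (G x) 1 with h | h
  · calc G x * w x ≤ 1 * w x := by gcongr
      _ ≤ _ := by rw [one_mul]; exact le_self_add
  · calc G x * w x ≤ G x * 1 := by gcongr; exact hw1 x
      _ ≤ G x ^ q := by
        rw [mul_one]
        conv_lhs => rw [← ENNReal.rpow_one (G x)]
        exact ENNReal.rpow_le_rpow_of_exponent_le h hq
      _ ≤ _ := le_add_self

theorem setLIntegral_compact_ne_top_of_rpow {U : Set (EuclideanSpace ℝ (Fin n))}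
    {G : EuclideanSpace ℝ (Fin n) → ℝ≥0∞} {q : ℝ} (hq : 1 ≤ q)
    (hGq : ∫⁻ x in U, G x ^ q ≠ ⊤) {K : Set (EuclideanSpace ℝ (Fin n))} (hKU : K ⊆ U)
    (hK : IsCompact K) : ∫⁻ x in K, G x ≠ ⊤ := by
  have := lintegral_restrict_ne_top_of_rpow (U := K) (w := 1) hq
    (ne_top_of_le_ne_top hGq (lintegral_mono_set hKU)) measurable_one (fun _ => le_rfl)
    (by simpa using hK.measure_lt_top.ne)
  simpa using this

/-- A function in `L^q` with an upper gradient in `L^q` is a Sobolev function whose gradient is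
dominated by the upper gradient. -/
theorem IsLocalUpperGradient.memSobolevENN {U : Set (EuclideanSpace ℝ (Fin n))} (hU : IsOpen U)
    {u G : EuclideanSpace ℝ (Fin n) → ℝ≥0∞} (hu : Measurable u) (hG : Measurable G)
    (H : IsLocalUpperGradient U u G) {q : ℝ} (hq : 1 ≤ q) (huq : ∫⁻ x in U, u x ^ q ≠ ⊤)
    (hGq : ∫⁻ x in U, G x ^ q ≠ ⊤) :
    MemSobolevENN U q u ∧ ∀ h, HasWeakGradient U (fun x => (u x).toReal) h →
      ∀ᵐ x ∂(volume.restrict U), ‖h x‖ₑ ≤ G x := by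
  have hq0 : 0 < q := by linarith
  have huK := fun K (hKU : K ⊆ U) (hK : IsCompact K) =>
    setLIntegral_compact_ne_top_of_rpow hq huq hKU hK
  have hGK := fun K (hKU : K ⊆ U) (hK : IsCompact K) =>
    setLIntegral_compact_ne_top_of_rpow hq hGq hKU hK
  have hbd := fun ψ (hψ : ψ ∈ testFunctions U) v =>
    H.enorm_integral_mul_fderiv_le hU hu hG huK hGK hψ.1 hψ.2.1 hψ.2.2 v
  have hupper : ∀ h, HasWeakGradient U (fun x => (u x).toReal) h →
      ∀ᵐ x ∂(volume.restrict U), ‖h x‖ₑ ≤ G x := fun h hh =>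
    hh.ae_enorm_le hU hG hGK fun ψ hψ hc hs v => hbd ψ ⟨hψ, hc, hs⟩ v
  have hmemLp : ∀ {F : Type} [NormedAddCommGroup F] (g : EuclideanSpace ℝ (Fin n) → F)
      (G' : EuclideanSpace ℝ (Fin n) → ℝ≥0∞), ∫⁻ x in U, G' x ^ q ≠ ⊤ →
      AEStronglyMeasurable g (volume.restrict U) →
      (∀ᵐ x ∂(volume.restrict U), ‖g x‖ₑ ≤ G' x) →
      MemLp g (ENNReal.ofReal q) (volume.restrict U) := by
    intro F _ g G' hG' hg hle
    refine ⟨hg, ?_⟩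
    rw [eLpNorm_lt_top_iff_lintegral_rpow_enorm_lt_top (by simpa using hq0) (by simp),
      ENNReal.toReal_ofReal hq0.le]
    refine lt_of_le_of_lt (lintegral_mono_ae ?_) hG'.lt_top
    filter_upwards [hle] with x hx
    gcongr
  have hui : LocallyIntegrableOn (fun x => (u x).toReal) U volume := by
    rw [locallyIntegrableOn_iff hU.isLocallyClosed]
    exact fun K hKU hK => integrable_toReal_of_lintegral_ne_top hu.aemeasurable (huK K hKU hK)
  have hGi : ∫⁻ x in U, G x * ((polyWeight x)⁻¹ : ℝ≥0) ≠ ⊤ := by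
    refine lintegral_restrict_ne_top_of_rpow hq hGq
      continuous_polyWeight.measurable.inv.coe_nnreal_ennreal (fun x => ?_)
      (ne_top_of_le_ne_top lintegral_inv_polyWeight_ne_top (setLIntegral_le_lintegral _ _))
    exact_mod_cast inv_le_one_of_one_le₀ (one_le_polyWeight x)
  choose d hd1 hd2 using fun i : Fin n => exists_weak_partial_derivative hU hui hG hGi
    (EuclideanSpace.single i (1 : ℝ)) fun ψ hψ => hbd ψ hψ _
  have hweak : HasWeakGradient U (fun x => (u x).toReal)
      (fun x => WithLp.toLp 2 fun i => d i x) :=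
    ⟨hui, locallyIntegrableOn_of_coord hU hd1, fun ψ hψ hc hs i => hd2 i ψ ⟨hψ, hc, hs⟩⟩
  refine ⟨⟨?_, hmemLp _ u huq ?_ ?_, _, hweak, hmemLp _ G hGq ?_ (hupper _ hweak)⟩, hupper⟩
  · filter_upwards [ae_lt_top (hu.pow_const q) huq] with x hx
    exact ((ENNReal.rpow_lt_top_iff_of_pos hq0).1 hx)
  · exact hu.ennreal_toReal.aestronglyMeasurable
  · refine Eventually.of_forall fun x => ?_
    rw [Real.enorm_of_nonneg ENNReal.toReal_nonneg]
    exact ENNReal.ofReal_toReal_le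
  · exact hweak.2.1.aestronglyMeasurable

/-! ### The Hardy–Littlewood and fractional maximal functions. -/

theorem setLIntegral_ball_eq_iSup (F : EuclideanSpace ℝ (Fin n) → ℝ≥0∞)
    (x : EuclideanSpace ℝ (Fin n)) (r : ℝ) :
    ∫⁻ y in ball x r, F y = ⨆ k : ℕ, ∫⁻ y in ball x (r - 1 / ((k : ℝ) + 1)), F y := by
  have hU : ball x r = ⋃ k : ℕ, ball x (r - 1 / ((k : ℝ) + 1)) := by
    ext y
    simp only [mem_ball, mem_iUnion]
    constructor
    · intro h
      obtain ⟨k, hk⟩ := exists_nat_one_div_lt (sub_pos.2 h)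
      exact ⟨k, by linarith⟩
    · rintro ⟨k, hk⟩
      have : (0 : ℝ) < 1 / ((k : ℝ) + 1) := by positivity
      linarith
  have hmono : Monotone fun k : ℕ => ball x (r - 1 / ((k : ℝ) + 1)) := fun k l hkl =>
    ball_subset_ball (by gcongr)
  simp_rw [← withDensity_apply F measurableSet_ball]
  rw [hU, hmono.measure_iUnion]

/-- A ball with a nearby centre contains a slightly smaller concentric ball, and these exhaust the
open ball. Maximal functions are therefore lower semicontinuous, hence measurable, whatever the
function inside. -/
theorem eventually_lt_mul_setLIntegral_ball {F : EuclideanSpace ℝ (Fin n) → ℝ≥0∞}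
    {x : EuclideanSpace ℝ (Fin n)} {r : ℝ} {a c : ℝ≥0∞} (h : a < c * ∫⁻ y in ball x r, F y) :
    ∀ᶠ x' in 𝓝 x, a < c * ∫⁻ y in ball x' r, F y := by
  rw [setLIntegral_ball_eq_iSup, ENNReal.mul_iSup, lt_iSup_iff] at h
  obtain ⟨k, hk⟩ := h
  filter_upwards [ball_mem_nhds x (show (0 : ℝ) < 1 / ((k : ℝ) + 1) by positivity)] with x' hx'
  refine hk.trans_le ?_
  gcongr
  refine ball_subset_ball' ?_
  rw [dist_comm]
  have := mem_ball.1 hx'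
  linarith

/-- The centred fractional maximal function of order `α` of a nonnegative function. -/
noncomputable def fracMax (α : ℝ) (F : EuclideanSpace ℝ (Fin n) → ℝ≥0∞)
    (x : EuclideanSpace ℝ (Fin n)) : ℝ≥0∞ :=
  ⨆ r ∈ Ioi (0 : ℝ), ENNReal.ofReal (r ^ α) * (volume (ball x r))⁻¹ * ∫⁻ y in ball x r, F y

theorem measurable_fracMax (α : ℝ) (F : EuclideanSpace ℝ (Fin n) → ℝ≥0∞) :
    Measurable (fracMax α F) := by
  refine LowerSemicontinuous.measurable fun x a ha => ?_
  simp only [fracMax, lt_iSup_iff] at ha ⊢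
  obtain ⟨r, hr, h⟩ := ha
  have hvol : ∀ x' : EuclideanSpace ℝ (Fin n), volume (ball x' r) = volume (ball x r) :=
    fun x' => by rw [Measure.addHaar_ball_center, Measure.addHaar_ball_center volume x]
  filter_upwards [eventually_lt_mul_setLIntegral_ball h] with x' hx'
  exact ⟨r, hr, by rwa [hvol x']⟩

theorem volume_ball_eq (x : EuclideanSpace ℝ (Fin n)) {r : ℝ} (hr : 0 < r) :
    volume (ball x r) = ENNReal.ofReal (r ^ n) *
      volume (ball (0 : EuclideanSpace ℝ (Fin n)) 1) := by
  have := Measure.addHaar_ball_of_pos volume x hr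
  simpa using this

theorem volume_closedBall_mul (x : EuclideanSpace ℝ (Fin n)) {r τ : ℝ} (hr : 0 < r) (hτ : 0 < τ) :
    volume (closedBall x (τ * r)) = ENNReal.ofReal (τ ^ n) * volume (ball x r) := by
  rw [volume_ball_eq x hr, Measure.addHaar_closedBall _ x (by positivity), mul_pow,
    ENNReal.ofReal_mul (by positivity), mul_assoc]
  simp

/-- The weak type `(1,1)` inequality for the Hardy–Littlewood maximal function. -/
theorem mul_volume_fracMax_zero_gt_le (hn : 0 < n) (F : EuclideanSpace ℝ (Fin n) → ℝ≥0∞)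
    {t : ℝ≥0∞} (ht : t ≠ 0) (ht' : t ≠ ⊤) :
    t * volume {x | t < fracMax 0 F x} ≤ ENNReal.ofReal (4 ^ n) * ∫⁻ x, F x := by
  rcases eq_or_ne (∫⁻ x, F x) ⊤ with hF | hF
  · rw [hF, ENNReal.mul_top (by simp)]
    exact le_top
  set S := {x | t < fracMax 0 F x} with hS
  have hex : ∀ x : S, ∃ r : ℝ, 0 < r ∧ t * volume (ball x.1 r) ≤ ∫⁻ y in ball x.1 r, F y := by
    rintro ⟨x, hx⟩
    simp only [hS, mem_ofPred_eq, fracMax, lt_iSup_iff] at hx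
    obtain ⟨r, hr, h⟩ := hx
    refine ⟨r, hr, ?_⟩
    rw [Real.rpow_zero, ENNReal.ofReal_one, one_mul, ← ENNReal.div_eq_inv_mul] at h
    exact ENNReal.mul_le_of_le_div h.le
  choose r hr0 hr using hex
  have hv₁ : volume (ball (0 : EuclideanSpace ℝ (Fin n)) 1) ≠ 0 :=
    (measure_ball_pos _ _ one_pos).ne'
  have hv₁' : volume (ball (0 : EuclideanSpace ℝ (Fin n)) 1) ≠ ⊤ := measure_ball_lt_top.ne
  set Q := (∫⁻ x, F x) / (t * volume (ball (0 : EuclideanSpace ℝ (Fin n)) 1)) with hQ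
  have hQtop : Q ≠ ⊤ := (ENNReal.div_lt_top hF (mul_ne_zero ht hv₁)).ne
  -- The covering lemma needs bounded radii. The level `t` bounds r^n by Q, and r ≤ r^n once r ≥ 1.
  have hrb : ∀ x : S, r x ≤ max 1 Q.toReal := by
    intro x
    rcases le_total (r x) 1 with h1 | h1
    · exact h1.trans (le_max_left _ _)
    · refine le_trans ?_ (le_max_right _ _)
      have h2 : r x ≤ r x ^ n := le_self_pow₀ h1 hn.ne'
      refine h2.trans ?_
      rw [← ENNReal.ofReal_le_iff_le_toReal hQtop, hQ, ENNReal.le_div_iff_mul_le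
        (Or.inl (mul_ne_zero ht hv₁)) (Or.inl (ENNReal.mul_ne_top ht' hv₁'))]
      calc ENNReal.ofReal (r x ^ n) * (t * volume (ball (0 : EuclideanSpace ℝ (Fin n)) 1))
          = t * volume (ball x.1 (r x)) := by rw [volume_ball_eq _ (hr0 x)]; ring
        _ ≤ ∫⁻ y in ball x.1 (r x), F y := hr x
        _ ≤ ∫⁻ y, F y := setLIntegral_le_lintegral _ _
  -- Any enlargement factor above 3 serves; the choice 4 is the source of the constant 4^n.
  obtain ⟨u, -, hdisj, hcov⟩ := Vitali.exists_disjoint_subfamily_covering_enlargement_closedBall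
    (univ : Set S) (fun x => x.1) r _ (fun x _ => hrb x) 4 (by norm_num)
  have hcount : u.Countable := hdisj.countable_of_nonempty_interior fun x _ =>
    ⟨x.1, mem_interior_iff_mem_nhds.2 (closedBall_mem_nhds _ (hr0 x))⟩
  have hsub : S ⊆ ⋃ x ∈ u, closedBall x.1 (4 * r x) := fun x hx => by
    obtain ⟨b, hb, hxb⟩ := hcov ⟨x, hx⟩ (mem_univ _)
    exact mem_biUnion hb (hxb (mem_closedBall_self (hr0 _).le))
  have hdisj' : u.PairwiseDisjoint fun x => ball x.1 (r x) :=
    hdisj.mono fun x => ball_subset_closedBall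
  have : Countable u := hcount
  calc t * volume S ≤ t * ∑' x : u, volume (closedBall x.1.1 (4 * r x.1)) := by
        gcongr
        exact (measure_mono hsub).trans (measure_biUnion_le _ hcount _)
    _ = ENNReal.ofReal (4 ^ n) * ∑' x : u, t * volume (ball x.1.1 (r x.1)) := by
        rw [← ENNReal.tsum_mul_left, ← ENNReal.tsum_mul_left]
        refine tsum_congr fun x => ?_
        rw [volume_closedBall_mul _ (hr0 _) (by norm_num)]
        ring
    _ ≤ ENNReal.ofReal (4 ^ n) * ∑' x : u, ∫⁻ y in ball x.1.1 (r x.1), F y := by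
        gcongr with x
        exact hr _
    _ = ENNReal.ofReal (4 ^ n) * ∫⁻ y in ⋃ x ∈ u, ball x.1 (r x), F y := by
        rw [lintegral_biUnion hcount (fun _ _ => measurableSet_ball) hdisj']
    _ ≤ ENNReal.ofReal (4 ^ n) * ∫⁻ y, F y := by
        exact mul_le_mul_right (setLIntegral_le_lintegral _ _) _

theorem setLIntegral_Ioi_indicator_rpow_of_ne_top {a : ℝ≥0∞} (ha : a ≠ ⊤) {c : ℝ} (hc : 0 < c) :
    ∫⁻ t in Ioi (0 : ℝ), {t | ENNReal.ofReal t < a}.indicator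
      (fun t => ENNReal.ofReal (t ^ (c - 1))) t = ENNReal.ofReal (1 / c) * a ^ c := by
  lift a to ℝ≥0 using ha
  have hset : ∀ t ∈ Ioi (0 : ℝ), {t : ℝ | ENNReal.ofReal t < (a : ℝ≥0∞)}.indicator
      (fun t => ENNReal.ofReal (t ^ (c - 1))) t =
      (Iio (a : ℝ)).indicator (fun t => ENNReal.ofReal (t ^ (c - 1))) t := by
    intro t ht
    have : t ∈ {t : ℝ | ENNReal.ofReal t < (a : ℝ≥0∞)} ↔ t ∈ Iio (a : ℝ) := by
      rw [mem_ofPred_eq, ENNReal.ofReal, ENNReal.coe_lt_coe, Real.toNNReal_lt_iff_lt_coe ht.le]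
      rfl
    by_cases h : t ∈ Iio (a : ℝ)
    · rw [indicator_of_mem (this.2 h), indicator_of_mem h]
    · rw [indicator_of_notMem (fun h' => h (this.1 h')), indicator_of_notMem h]
  rw [setLIntegral_congr_fun measurableSet_Ioi hset, lintegral_indicator measurableSet_Iio,
    Measure.restrict_restrict measurableSet_Iio, Iio_inter_Ioi, restrict_Ioo_eq_restrict_Ioc]
  have hi := intervalIntegral.intervalIntegrable_rpow' (a := (0 : ℝ)) (b := (a : ℝ)) (r := c - 1)
    (by linarith)
  replace hi := (intervalIntegrable_iff_integrableOn_Ioc_of_le a.coe_nonneg).1 hi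
  rw [← ofReal_integral_eq_lintegral_ofReal hi, ← intervalIntegral.integral_of_le a.coe_nonneg,
    integral_rpow (Or.inl (by linarith))]
  · rw [sub_add_cancel, Real.zero_rpow hc.ne', sub_zero, div_eq_mul_inv, mul_comm,
      ENNReal.ofReal_mul (by positivity), one_div, ← ENNReal.ofReal_rpow_of_nonneg a.coe_nonneg hc.le,
      ENNReal.ofReal_coe_nnreal]
  · rw [EventuallyLE, ae_restrict_iff' measurableSet_Ioc]
    exact Eventually.of_forall fun t ht => Real.rpow_nonneg ht.1.le _

/-- Layer-cake bound allowing the value ∞, because the maximal function is not yet known to be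
finite when it is applied. -/
theorem le_setLIntegral_Ioi_indicator_rpow (a : ℝ≥0∞) {c : ℝ} (hc : 0 < c) :
    ENNReal.ofReal (1 / c) * a ^ c ≤ ∫⁻ t in Ioi (0 : ℝ), {t | ENNReal.ofReal t < a}.indicator
      (fun t => ENNReal.ofReal (t ^ (c - 1))) t := by
  rcases eq_or_ne a ⊤ with rfl | ha
  · rw [ENNReal.top_rpow_of_pos hc]
    refine le_of_tendsto' (f := fun k : ℕ => ENNReal.ofReal (1 / c) * (k : ℝ≥0∞) ^ c)
      (x := atTop) ?_ fun k => ?_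
    · refine ENNReal.Tendsto.const_mul ?_ (Or.inl (by simp))
      rw [← ENNReal.top_rpow_of_pos hc]
      exact (ENNReal.continuous_rpow_const.tendsto _).comp ENNReal.tendsto_nat_nhds_top
    · rw [← setLIntegral_Ioi_indicator_rpow_of_ne_top (by simp) hc]
      refine lintegral_mono fun t => indicator_le_indicator_of_subset (fun s hs => ?_)
        (fun _ => zero_le) t
      exact lt_of_lt_of_le (show ENNReal.ofReal s < _ from hs) le_top
  · exact (setLIntegral_Ioi_indicator_rpow_of_ne_top ha hc).ge

/-- Truncation at height t: the part of F below t has means at most t. Combined with the weak type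
bound this is the splitting of Marcinkiewicz interpolation. -/
theorem fracMax_zero_le_add (F : EuclideanSpace ℝ (Fin n) → ℝ≥0∞) (t : ℝ≥0∞)
    (x : EuclideanSpace ℝ (Fin n)) :
    fracMax 0 F x ≤ fracMax 0 ({x | t < F x}.indicator F) x + t := by
  refine iSup₂_le fun r hr => ?_
  have hv0 : volume (ball x r) ≠ 0 := (measure_ball_pos _ _ hr).ne'
  have hvt : volume (ball x r) ≠ ⊤ := measure_ball_lt_top.ne
  have hle : ∀ y, F y ≤ {x | t < F x}.indicator F y + t := fun y => by
    by_cases hy : t < F y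
    · rw [indicator_of_mem (show y ∈ {x | t < F x} from hy)]; exact le_self_add
    · exact (not_lt.1 hy).trans le_add_self
  calc ENNReal.ofReal (r ^ (0 : ℝ)) * (volume (ball x r))⁻¹ * ∫⁻ y in ball x r, F y
      ≤ ENNReal.ofReal (r ^ (0 : ℝ)) * (volume (ball x r))⁻¹ *
          ∫⁻ y in ball x r, ({x | t < F x}.indicator F y + t) := by gcongr; exact hle _
    _ = ENNReal.ofReal (r ^ (0 : ℝ)) * (volume (ball x r))⁻¹ *
          (∫⁻ y in ball x r, {x | t < F x}.indicator F y) + t := by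
        rw [lintegral_add_right _ measurable_const, mul_add, setLIntegral_const, Real.rpow_zero,
          ENNReal.ofReal_one, one_mul, mul_comm t, ← mul_assoc, ENNReal.inv_mul_cancel hv0 hvt,
          one_mul]
    _ ≤ _ := by
        gcongr
        exact le_iSup₂ (f := fun r (_ : r ∈ Ioi (0 : ℝ)) => ENNReal.ofReal (r ^ (0 : ℝ)) *
          (volume (ball x r))⁻¹ * ∫⁻ y in ball x r, {x | t < F x}.indicator F y) r hr

/-- The Hardy–Littlewood maximal theorem. -/
theorem lintegral_fracMax_zero_rpow_ne_top (hn : 0 < n) {F : EuclideanSpace ℝ (Fin n) → ℝ≥0∞}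
    (hF : Measurable F) {s : ℝ} (hs : 1 < s) (hFs : ∫⁻ x, F x ^ s ≠ ⊤) :
    ∫⁻ x, fracMax 0 F x ^ s ≠ ⊤ := by
  have hs0 : 0 < s := by linarith
  have hMm := measurable_fracMax 0 F
  have hFfin : ∀ᵐ x ∂(volume : Measure (EuclideanSpace ℝ (Fin n))), F x ≠ ⊤ := by
    filter_upwards [ae_lt_top (hF.pow_const s) hFs] with x hx
    exact ((ENNReal.rpow_lt_top_iff_of_pos hs0).1 hx).ne
  set C : ℝ≥0∞ := ENNReal.ofReal (4 ^ n) with hC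
  -- the weak type estimate for the part of `F` above half the level
  have hweak : ∀ t ∈ Ioi (0 : ℝ), volume {x | ENNReal.ofReal t < fracMax 0 F x} ≤
      C * ENNReal.ofReal (2 / t) * ∫⁻ x, {x | ENNReal.ofReal t < 2 * F x}.indicator F x := by
    intro t ht
    have ht2 : (0 : ℝ) < t / 2 := half_pos ht
    have h1 := mul_volume_fracMax_zero_gt_le hn ({x | ENNReal.ofReal (t / 2) < F x}.indicator F)
      (t := ENNReal.ofReal (t / 2)) (by simpa using ht2) (by simp)
    have hsub : {x | ENNReal.ofReal t < fracMax 0 F x} ⊆ {x | ENNReal.ofReal (t / 2) <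
        fracMax 0 ({x | ENNReal.ofReal (t / 2) < F x}.indicator F) x} := by
      intro x hx
      by_contra hcon
      have hle := (fracMax_zero_le_add F (ENNReal.ofReal (t / 2)) x).trans
        (add_le_add_left (not_lt.1 hcon) _)
      rw [← ENNReal.ofReal_add ht2.le ht2.le, add_halves] at hle
      exact absurd hx (not_lt.2 hle)
    have hset : {x | ENNReal.ofReal (t / 2) < F x} = {x | ENNReal.ofReal t < 2 * F x} := by
      ext x
      have : ENNReal.ofReal t = 2 * ENNReal.ofReal (t / 2) := by
        rw [← ENNReal.ofReal_ofNat, ← ENNReal.ofReal_mul (by norm_num)]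
        congr 1; ring
      rw [mem_ofPred_eq, mem_ofPred_eq, this,
        ENNReal.mul_lt_mul_iff_right (by norm_num) (by norm_num)]
    have h2 : ENNReal.ofReal (2 / t) * ENNReal.ofReal (t / 2) = 1 := by
      rw [← ENNReal.ofReal_mul (by have := mem_Ioi.1 ht; positivity), ← ENNReal.ofReal_one]
      congr 1
      field_simp [(mem_Ioi.1 ht).ne']
    calc volume {x | ENNReal.ofReal t < fracMax 0 F x}
        ≤ ENNReal.ofReal (2 / t) * (ENNReal.ofReal (t / 2) * volume {x | ENNReal.ofReal (t / 2) <
          fracMax 0 ({x | ENNReal.ofReal (t / 2) < F x}.indicator F) x}) := by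
          rw [← mul_assoc, h2, one_mul]
          exact measure_mono hsub
      _ ≤ _ := by
          rw [mul_comm C, mul_assoc, ← hset]
          gcongr
  have hmeas1 : Measurable (Function.uncurry fun (x : EuclideanSpace ℝ (Fin n)) (t : ℝ) =>
      {t | ENNReal.ofReal t < fracMax 0 F x}.indicator
        (fun t => ENNReal.ofReal (t ^ (s - 1))) t) := by
    have : (Function.uncurry fun (x : EuclideanSpace ℝ (Fin n)) (t : ℝ) =>
      {t | ENNReal.ofReal t < fracMax 0 F x}.indicator
        (fun t => ENNReal.ofReal (t ^ (s - 1))) t) =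
        {z : EuclideanSpace ℝ (Fin n) × ℝ | ENNReal.ofReal z.2 < fracMax 0 F z.1}.indicator
          (fun z => ENNReal.ofReal (z.2 ^ (s - 1))) := by
      ext ⟨x, t⟩; simp [indicator]
    rw [this]
    refine Measurable.indicator (by fun_prop) (measurableSet_lt (by fun_prop) ?_)
    exact hMm.comp measurable_fst
  have hmeas2 : Measurable (Function.uncurry fun (t : ℝ) (x : EuclideanSpace ℝ (Fin n)) =>
      F x * {t | ENNReal.ofReal t < 2 * F x}.indicator
        (fun t => ENNReal.ofReal (t ^ (s - 1 - 1))) t) := by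
    have : (Function.uncurry fun (t : ℝ) (x : EuclideanSpace ℝ (Fin n)) =>
      F x * {t | ENNReal.ofReal t < 2 * F x}.indicator
        (fun t => ENNReal.ofReal (t ^ (s - 1 - 1))) t) = fun z => F z.2 *
        {z : ℝ × EuclideanSpace ℝ (Fin n) | ENNReal.ofReal z.1 < 2 * F z.2}.indicator
          (fun z => ENNReal.ofReal (z.1 ^ (s - 1 - 1))) z := by
      ext ⟨t, x⟩; simp [indicator]
    rw [this]
    refine (hF.comp measurable_snd).mul
      (Measurable.indicator (by fun_prop) (measurableSet_lt (by fun_prop) (by fun_prop)))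
  -- Layer cake for the maximal function, the weak type bound at each level, Tonelli, and layer cake
  -- for 2F with exponent s - 1, which is positive because s > 1.
  have key : ENNReal.ofReal (1 / s) * ∫⁻ x, fracMax 0 F x ^ s ≤
      C * 2 * (ENNReal.ofReal (1 / (s - 1)) * (2 ^ (s - 1) * ∫⁻ x, F x ^ s)) := by
    calc ENNReal.ofReal (1 / s) * ∫⁻ x, fracMax 0 F x ^ s
        ≤ ∫⁻ x, ∫⁻ t in Ioi (0 : ℝ), {t | ENNReal.ofReal t < fracMax 0 F x}.indicator
            (fun t => ENNReal.ofReal (t ^ (s - 1))) t := by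
          rw [← lintegral_const_mul' _ _ (by simp)]
          exact lintegral_mono fun x => le_setLIntegral_Ioi_indicator_rpow _ hs0
      _ = ∫⁻ t in Ioi (0 : ℝ), ∫⁻ x, {t | ENNReal.ofReal t < fracMax 0 F x}.indicator
            (fun t => ENNReal.ofReal (t ^ (s - 1))) t :=
          lintegral_lintegral_swap hmeas1.aemeasurable
      _ = ∫⁻ t in Ioi (0 : ℝ), ENNReal.ofReal (t ^ (s - 1)) *
            volume {x | ENNReal.ofReal t < fracMax 0 F x} := by
          refine lintegral_congr fun t => ?_
          rw [← lintegral_indicator_const (measurableSet_lt measurable_const hMm)]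
          refine lintegral_congr fun x => ?_
          simp [indicator]
      _ ≤ ∫⁻ t in Ioi (0 : ℝ), C * 2 * ∫⁻ x, F x * {t | ENNReal.ofReal t < 2 * F x}.indicator
            (fun t => ENNReal.ofReal (t ^ (s - 1 - 1))) t := by
          refine setLIntegral_mono' measurableSet_Ioi fun t ht => ?_
          have ht0 : 0 < t := ht
          have e1 : ∀ x, F x * {t | ENNReal.ofReal t < 2 * F x}.indicator
              (fun t => ENNReal.ofReal (t ^ (s - 1 - 1))) t = ENNReal.ofReal (t ^ (s - 1 - 1)) *
              {x | ENNReal.ofReal t < 2 * F x}.indicator F x := fun x => by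
            by_cases h : ENNReal.ofReal t < 2 * F x
            · simp [indicator, mul_comm]
            · simp [indicator, h]
          simp_rw [e1]
          rw [lintegral_const_mul' _ _ (by simp), ← mul_assoc]
          refine (mul_le_mul_right (hweak t ht) _).trans (le_of_eq ?_)
          rw [← mul_assoc]
          congr 1
          rw [← mul_assoc, mul_comm _ C, mul_assoc, mul_assoc]
          congr 1
          rw [← ENNReal.ofReal_mul (by positivity), ← ENNReal.ofReal_ofNat,
            ← ENNReal.ofReal_mul (by norm_num)]
          congr 1
          rw [Real.rpow_sub_one ht0.ne' (s - 1)]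
          ring
      _ = C * 2 * ∫⁻ x, F x * ∫⁻ t in Ioi (0 : ℝ), {t | ENNReal.ofReal t < 2 * F x}.indicator
            (fun t => ENNReal.ofReal (t ^ (s - 1 - 1))) t := by
          rw [lintegral_const_mul' _ _ (by rw [hC]; finiteness)]
          rw [lintegral_lintegral_swap hmeas2.aemeasurable]
          congr 1
          refine lintegral_congr fun x => ?_
          rw [lintegral_const_mul]
          exact Measurable.indicator (by fun_prop) (measurableSet_lt (by fun_prop) (by fun_prop))
      _ = C * 2 * ∫⁻ x, ENNReal.ofReal (1 / (s - 1)) * (2 ^ (s - 1) * F x ^ s) := by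
          congr 1
          refine lintegral_congr_ae ?_
          filter_upwards [hFfin] with x hx
          rw [setLIntegral_Ioi_indicator_rpow_of_ne_top (by finiteness) (by linarith),
            ENNReal.mul_rpow_of_nonneg _ _ (by linarith)]
          have e2 : F x ^ s = F x * F x ^ (s - 1) := by
            have h1 := ENNReal.rpow_add_of_nonneg (x := F x) 1 (s - 1) (by norm_num) (by linarith)
            rwa [ENNReal.rpow_one, add_sub_cancel] at h1
          rw [e2]
          ring
      _ = _ := by
          rw [lintegral_const_mul' _ _ (by simp), lintegral_const_mul' _ _ (by finiteness)]
  intro htop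
  rw [htop, ENNReal.mul_top (by simpa using hs0)] at key
  exact absurd (top_le_iff.1 key) (by rw [hC]; finiteness)

/-- The Hardy–Littlewood–Sobolev theorem for the fractional maximal function. -/
theorem lintegral_fracMax_rpow_ne_top (hn : 0 < n) {F : EuclideanSpace ℝ (Fin n) → ℝ≥0∞}
    (hF : Measurable F) {s α q : ℝ} (hs : 1 < s) (hα : 0 ≤ α) (hαs : α * s < n)
    (hq : 1 / q = 1 / s - α / n) (hFs : ∫⁻ x, F x ^ s ≠ ⊤) :
    ∫⁻ x, fracMax α F x ^ q ≠ ⊤ := by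
  have hn' : (0 : ℝ) < n := by exact_mod_cast hn
  have hs0 : 0 < s := by linarith
  -- Hedberg's exponent. A mean over B(x, r) is at most the Hardy–Littlewood maximal function and,
  -- by Hölder, at most |B|^{-1/s}‖F‖_s. In the product of these bounds to the powers 1 - θ and θ
  -- the factor r^α cancels, and (1 - θ)q = s.
  set θ := α * s / n with hθ
  have hθ0 : 0 ≤ θ := by positivity
  have hθ1 : θ < 1 := (div_lt_one hn').2 hαs
  have h1q : 1 / q = (1 - θ) / s := by rw [hq, hθ]; field_simp
  have hq0 : 0 < q := by
    have : 0 < 1 / q := by rw [h1q]; exact div_pos (by linarith) hs0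
    exact one_div_pos.1 this
  have hθq : (1 - θ) * q = s := by
    rw [div_eq_div_iff hq0.ne' hs0.ne'] at h1q; linarith
  set v₁ := volume (ball (0 : EuclideanSpace ℝ (Fin n)) 1) with hv
  have hv₁ : v₁ ≠ 0 := (measure_ball_pos _ _ one_pos).ne'
  have hv₁' : v₁ ≠ ⊤ := measure_ball_lt_top.ne
  set N := (∫⁻ x, F x ^ s) ^ (1 / s) with hN
  have hNtop : N ≠ ⊤ := ENNReal.rpow_ne_top_of_nonneg (by positivity) hFs
  set D := (v₁ ^ (-(1 / s)) * N) ^ θ with hD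
  have hDtop : D ≠ ⊤ := by
    refine ENNReal.rpow_ne_top_of_nonneg hθ0 (ENNReal.mul_ne_top ?_ hNtop)
    exact ENNReal.rpow_ne_top_of_ne_zero hv₁ hv₁'
  have hpt : ∀ x, fracMax α F x ≤ D * fracMax 0 F x ^ (1 - θ) := by
    intro x
    refine iSup₂_le fun r hr => ?_
    have hr0 : 0 < r := hr
    set V := volume (ball x r) with hV
    have hV0 : V ≠ 0 := (measure_ball_pos _ _ hr).ne'
    have hVt : V ≠ ⊤ := measure_ball_lt_top.ne
    set A := V⁻¹ * ∫⁻ y in ball x r, F y with hA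
    have hA1 : A ≤ fracMax 0 F x := by
      refine le_trans (le_of_eq ?_) (le_iSup₂ (f := fun r (_ : r ∈ Ioi (0 : ℝ)) =>
        ENNReal.ofReal (r ^ (0 : ℝ)) * (volume (ball x r))⁻¹ * ∫⁻ y in ball x r, F y) r hr)
      simp [hA, hV]
    have hA2 : A ≤ V ^ (-(1 / s)) * N := by
      have hc : s.HolderConjugate (Real.conjExponent s) := Real.HolderConjugate.conjExponent hs
      have h1 := ENNReal.lintegral_mul_le_Lp_mul_Lq (volume.restrict (ball x r)) hc
        (f := F) (g := fun _ => 1) hF.aemeasurable aemeasurable_const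
      simp only [Pi.mul_apply, mul_one, ENNReal.one_rpow, lintegral_const, one_mul,
        Measure.restrict_apply_univ] at h1
      have h2 : (∫⁻ y in ball x r, F y ^ s) ^ (1 / s) ≤ N :=
        ENNReal.rpow_le_rpow (setLIntegral_le_lintegral _ _) (by positivity)
      have h3 : V⁻¹ * V ^ (1 / Real.conjExponent s) = V ^ (-(1 / s)) := by
        rw [← ENNReal.rpow_neg_one, ← ENNReal.rpow_add _ _ hV0 hVt]
        congr 1
        have := hc.inv_add_inv_eq_one
        simp only [one_div]
        linarith
      calc A ≤ V⁻¹ * (N * V ^ (1 / Real.conjExponent s)) := by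
            rw [hA]; gcongr; exact h1.trans (by gcongr)
        _ = _ := by rw [← h3]; ring
    have hVr : V = ENNReal.ofReal r ^ (n : ℝ) * v₁ := by
      rw [hV, volume_ball_eq x hr0, ENNReal.ofReal_pow hr0.le, ENNReal.rpow_natCast]
    have hR0 : ENNReal.ofReal r ≠ 0 := by simpa using hr0
    have hRt : ENNReal.ofReal r ≠ ⊤ := by simp
    have hcancel : ENNReal.ofReal (r ^ α) * (V ^ (-(1 / s))) ^ θ = (v₁ ^ (-(1 / s))) ^ θ := by
      have hRn : ENNReal.ofReal r ^ (n : ℝ) ≠ ⊤ := ENNReal.rpow_ne_top_of_nonneg hn'.le hRt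
      rw [hVr, ENNReal.mul_rpow_of_ne_top hRn hv₁', ENNReal.mul_rpow_of_nonneg _ _ hθ0,
        ← ENNReal.rpow_mul, ← ENNReal.rpow_mul, ← ENNReal.ofReal_rpow_of_pos hr0, ← mul_assoc,
        ← ENNReal.rpow_add _ _ hR0 hRt]
      have : α + (n : ℝ) * (-(1 / s) * θ) = 0 := by rw [hθ]; field_simp; ring
      rw [this, ENNReal.rpow_zero, one_mul]
    calc ENNReal.ofReal (r ^ α) * V⁻¹ * ∫⁻ y in ball x r, F y
        = ENNReal.ofReal (r ^ α) * A := by rw [hA, mul_assoc]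
      _ = ENNReal.ofReal (r ^ α) * (A ^ θ * A ^ (1 - θ)) := by
          rw [← ENNReal.rpow_add_of_nonneg _ _ hθ0 (by linarith), add_sub_cancel,
            ENNReal.rpow_one]
      _ ≤ ENNReal.ofReal (r ^ α) * ((V ^ (-(1 / s)) * N) ^ θ * fracMax 0 F x ^ (1 - θ)) := by
          have : 0 ≤ 1 - θ := by linarith
          gcongr
      _ = _ := by
          rw [hD, ENNReal.mul_rpow_of_nonneg _ _ hθ0, ENNReal.mul_rpow_of_nonneg _ _ hθ0,
            ← hcancel]
          ring
  have hM := lintegral_fracMax_zero_rpow_ne_top hn hF hs hFs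
  refine ne_top_of_le_ne_top (b := D ^ q * ∫⁻ x, fracMax 0 F x ^ s) ?_ ?_
  · exact ENNReal.mul_ne_top (ENNReal.rpow_ne_top_of_nonneg hq0.le hDtop) hM
  · rw [← lintegral_const_mul' _ _ (ENNReal.rpow_ne_top_of_nonneg hq0.le hDtop)]
    refine lintegral_mono fun x => ?_
    calc fracMax α F x ^ q ≤ (D * fracMax 0 F x ^ (1 - θ)) ^ q := by gcongr; exact hpt x
      _ = _ := by rw [ENNReal.mul_rpow_of_nonneg _ _ hq0.le, ← ENNReal.rpow_mul (fracMax 0 F x), hθq]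

/-! ### The radial weight and its growth. -/

/-- The factor of the fractional maximal function after rescaling the ball of radius `r` to the
unit ball. -/
noncomputable def radialWeight (n : ℕ) (γ β r : ℝ) : ℝ :=
  r ^ β * (1 + r ^ n) ^ (γ * β / n) /
    ((1 + volume.real (ball (0 : EuclideanSpace ℝ (Fin n)) 1) * r ^ n) ^ γ *
      volume.real (ball (0 : EuclideanSpace ℝ (Fin n)) 1))

/-- An upper bound for the logarithmic derivative of `radialWeight`. -/
noncomputable def radialGrowth (n : ℕ) (γ β r : ℝ) : ℝ :=
  β * (1 + γ * (r ^ n / (1 + r ^ n))) / r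

theorem volume_real_unitBall_pos :
    0 < volume.real (ball (0 : EuclideanSpace ℝ (Fin n)) 1) :=
  ENNReal.toReal_pos (measure_ball_pos _ _ one_pos).ne' measure_ball_lt_top.ne

theorem radialWeight_pos (γ β : ℝ) {r : ℝ} (hr : 0 < r) : 0 < radialWeight n γ β r := by
  have := volume_real_unitBall_pos (n := n)
  unfold radialWeight
  positivity

theorem measurable_radialWeight (γ β : ℝ) : Measurable (radialWeight n γ β) := by
  unfold radialWeight
  fun_prop

theorem measurable_radialGrowth (γ β : ℝ) : Measurable (radialGrowth n γ β) := by
  unfold radialGrowth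
  fun_prop

theorem radialGrowth_nonneg {γ β : ℝ} (hγ : 0 ≤ γ) (hβ : 0 ≤ β) {r : ℝ} (hr : 0 < r) :
    0 ≤ radialGrowth n γ β r := by
  unfold radialGrowth
  positivity

theorem continuousOn_radialGrowth (γ β : ℝ) : ContinuousOn (radialGrowth n γ β) (Ioi 0) := by
  unfold radialGrowth
  intro r hr
  have hr0 : (0 : ℝ) < r := hr
  have h1 : (1 : ℝ) + r ^ n ≠ 0 := by positivity
  refine ContinuousAt.continuousWithinAt ?_
  exact (continuousAt_const.mul (continuousAt_const.add (continuousAt_const.mul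
    ((by fun_prop : ContinuousAt (fun r : ℝ => r ^ n) r).div (by fun_prop) h1)))).div
    continuousAt_id hr0.ne'

/-- The logarithmic derivative of the numerator is exactly `radialGrowth`. The factor of φ in the
denominator only lowers it, so that contribution is dropped. -/
theorem exists_hasDerivAt_radialWeight (hn : 0 < n) {γ : ℝ} (hγ : 0 ≤ γ) (β : ℝ) {r : ℝ}
    (hr : 0 < r) : ∃ k', HasDerivAt (radialWeight n γ β) k' r ∧
      k' ≤ radialGrowth n γ β r * radialWeight n γ β r := by
  have hn' : (0 : ℝ) < n := by exact_mod_cast hn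
  set b := volume.real (ball (0 : EuclideanSpace ℝ (Fin n)) 1) with hb
  have hb0 : 0 < b := volume_real_unitBall_pos
  have h1 : (0 : ℝ) < 1 + r ^ n := by positivity
  have h2 : (0 : ℝ) < 1 + b * r ^ n := by positivity
  have hp : HasDerivAt (fun r : ℝ => r ^ n) (n * r ^ (n - 1)) r := hasDerivAt_pow n r
  have hrn : r ^ (n - 1) = r ^ n / r := by
    rw [eq_div_iff hr.ne', ← pow_succ, Nat.sub_add_cancel hn]
  have hA : HasDerivAt (fun r : ℝ => r ^ β) (r ^ β * (β / r)) r := by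
    refine (Real.hasDerivAt_rpow_const (Or.inl hr.ne')).congr_deriv ?_
    rw [Real.rpow_sub_one hr.ne']; ring
  have hB : HasDerivAt (fun r : ℝ => (1 + r ^ n) ^ (γ * β / n))
      ((1 + r ^ n) ^ (γ * β / n) * (γ * β * (r ^ n / r) / (1 + r ^ n))) r := by
    refine ((hp.const_add 1).rpow_const (p := γ * β / n) (Or.inl h1.ne')).congr_deriv ?_
    rw [Real.rpow_sub_one h1.ne', hrn]
    field_simp
  have hC : HasDerivAt (fun r : ℝ => (1 + b * r ^ n) ^ γ)
      ((1 + b * r ^ n) ^ γ * (γ * b * n * (r ^ n / r) / (1 + b * r ^ n))) r := by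
    refine (((hp.const_mul b).const_add 1).rpow_const (p := γ) (Or.inl h2.ne')).congr_deriv ?_
    rw [Real.rpow_sub_one h2.ne', hrn]
    field_simp
  have hCpos : 0 < (1 + b * r ^ n) ^ γ := Real.rpow_pos_of_pos h2 _
  have hk := (hA.mul hB).div (hC.mul_const b) (by positivity)
  refine ⟨_, hk, ?_⟩
  have hW : radialWeight n γ β r = r ^ β * (1 + r ^ n) ^ (γ * β / n) /
    ((1 + b * r ^ n) ^ γ * b) := rfl
  have hWpos := radialWeight_pos (n := n) γ β hr
  have e : radialGrowth n γ β r * radialWeight n γ β r -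
      radialWeight n γ β r * (γ * b * n * (r ^ n / r) / (1 + b * r ^ n)) =
      ((r ^ β * (β / r) * (1 + r ^ n) ^ (γ * β / n) + r ^ β * ((1 + r ^ n) ^ (γ * β / n) *
        (γ * β * (r ^ n / r) / (1 + r ^ n)))) * ((1 + b * r ^ n) ^ γ * b) -
        r ^ β * (1 + r ^ n) ^ (γ * β / n) * ((1 + b * r ^ n) ^ γ * (γ * b * n * (r ^ n / r) /
          (1 + b * r ^ n)) * b)) / ((1 + b * r ^ n) ^ γ * b) ^ 2 := by
    rw [hW, radialGrowth]
    field_simp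
  have h3 : 0 ≤ radialWeight n γ β r * (γ * b * n * (r ^ n / r) / (1 + b * r ^ n)) := by
    positivity
  simp only [Pi.mul_apply]
  rw [← e]
  linarith

theorem continuousOn_radialWeight (hn : 0 < n) {γ : ℝ} (hγ : 0 ≤ γ) (β : ℝ) :
    ContinuousOn (radialWeight n γ β) (Ioi 0) := fun r hr => by
  obtain ⟨k', hk', -⟩ := exists_hasDerivAt_radialWeight hn hγ β hr
  exact hk'.continuousAt.continuousWithinAt

theorem radialWeight_eq_mul_sub_one (hn : 0 < n) (γ β : ℝ) {r : ℝ} (hr : 0 < r) :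
    radialWeight n γ β r = r * (1 + r ^ n) ^ (γ / n) * radialWeight n γ (β - 1) r := by
  have hn' : (n : ℝ) ≠ 0 := by exact_mod_cast hn.ne'
  have h1 : (0 : ℝ) < 1 + r ^ n := by positivity
  have e1 : r ^ β = r * r ^ (β - 1) := by rw [Real.rpow_sub_one hr.ne']; field_simp
  have e2 : (1 + r ^ n : ℝ) ^ (γ * β / n) =
      (1 + r ^ n) ^ (γ / n) * (1 + r ^ n) ^ (γ * (β - 1) / n) := by
    rw [← Real.rpow_add h1]; congr 1; field_simp; ring
  rw [radialWeight, radialWeight, e1, e2]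
  ring

/-- Lowering the order by one costs r(1 + r^n)^{γ/n}, whose r cancels the 1/r of the growth. For r <
1 the fraction r^n/(1 + r^n) is at most 1/2, and γ ≤ n gives (1 + r^n)^{γ/n} ≤ 2; hence β(1 + γ/2)·2
= γβ + 2β ≤ γn + 2β. -/
theorem radialGrowth_mul_radialWeight_le (hn : 0 < n) {γ β : ℝ} (hγ : 0 ≤ γ) (hγn : γ ≤ n)
    (hβ : 0 ≤ β) (hβn : β ≤ n) {r : ℝ} (hr : 0 < r) (hr1 : r < 1) :
    radialGrowth n γ β r * radialWeight n γ β r ≤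
      (γ * n + 2 * β) * radialWeight n γ (β - 1) r := by
  have hn' : (0 : ℝ) < n := by exact_mod_cast hn
  have hs0 : 0 < r ^ n := by positivity
  have hs1 : r ^ n ≤ 1 := pow_le_one₀ hr.le hr1.le
  rw [radialWeight_eq_mul_sub_one hn γ β hr, ← mul_assoc]
  refine mul_le_mul_of_nonneg_right ?_ (radialWeight_pos _ _ hr).le
  have h1 : (1 + r ^ n : ℝ) ^ (γ / n) ≤ 2 := by
    calc (1 + r ^ n : ℝ) ^ (γ / n) ≤ (1 + r ^ n) ^ (1 : ℝ) := by
          refine Real.rpow_le_rpow_of_exponent_le (by linarith) ?_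
          rw [div_le_one hn']; exact hγn
      _ ≤ 2 := by rw [Real.rpow_one]; linarith
  have h2 : r ^ n / (1 + r ^ n) ≤ 1 / 2 := by
    rw [div_le_div_iff₀ (by positivity) (by norm_num)]; linarith
  have h3 : radialGrowth n γ β r * (r * (1 + r ^ n) ^ (γ / n))
      = β * (1 + γ * (r ^ n / (1 + r ^ n))) * (1 + r ^ n) ^ (γ / n) := by
    rw [radialGrowth]; field_simp
  rw [h3]
  calc β * (1 + γ * (r ^ n / (1 + r ^ n))) * (1 + r ^ n) ^ (γ / n)
      ≤ β * (1 + γ * (1 / 2)) * 2 := by gcongr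
    _ = γ * β + 2 * β := by ring
    _ ≤ γ * n + 2 * β := by gcongr

theorem radialGrowth_le {γ β : ℝ} (hγ : 0 ≤ γ) (hβ : 0 ≤ β) (hβn : β ≤ n) {r : ℝ} (hr : 1 ≤ r) :
    radialGrowth n γ β r ≤ γ * n + β := by
  have h1 : r ^ n / (1 + r ^ n) ≤ 1 := by
    rw [div_le_one (by positivity)]; linarith
  calc radialGrowth n γ β r ≤ β * (1 + γ * (r ^ n / (1 + r ^ n))) :=
        div_le_self (by positivity) hr
    _ ≤ β * (1 + γ * 1) := by gcongr
    _ = γ * β + β := by ring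
    _ ≤ γ * n + β := by gcongr

/-- Since α ≤ n, the factor (1 + r^n)^{γα/n} is at most (1 + r^n)^γ, which φ(|B|) absorbs up to a
constant. The maximal function is thus dominated by the classical fractional one of the same order.
-/
theorem exists_radialWeight_le (hn : 0 < n) {γ α : ℝ} (hγ : 0 ≤ γ) (hαn : α ≤ n) :
    ∃ C : ℝ, 0 ≤ C ∧ ∀ r > 0, radialWeight n γ α r ≤
      C * (r ^ α / volume.real (ball (0 : EuclideanSpace ℝ (Fin n)) 1)) := by
  have hn' : (0 : ℝ) < n := by exact_mod_cast hn
  set b := volume.real (ball (0 : EuclideanSpace ℝ (Fin n)) 1) with hb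
  have hb0 : 0 < b := volume_real_unitBall_pos
  refine ⟨(max 1 b⁻¹) ^ γ, by positivity, fun r hr => ?_⟩
  have hrn : 0 < r ^ n := by positivity
  have h1 : (1 + r ^ n : ℝ) ≤ max 1 b⁻¹ * (1 + b * r ^ n) := by
    rw [mul_add, mul_one]
    gcongr
    · exact le_max_left _ _
    · calc r ^ n = b⁻¹ * (b * r ^ n) := by field_simp
        _ ≤ _ := by gcongr; exact le_max_right _ _
  have h2 : (1 + r ^ n : ℝ) ^ (γ * α / n) ≤ (max 1 b⁻¹) ^ γ * (1 + b * r ^ n) ^ γ := by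
    calc (1 + r ^ n : ℝ) ^ (γ * α / n) ≤ (1 + r ^ n) ^ γ := by
          refine Real.rpow_le_rpow_of_exponent_le (by linarith) ?_
          rw [div_le_iff₀ hn']; gcongr
      _ ≤ (max 1 b⁻¹ * (1 + b * r ^ n)) ^ γ := by gcongr
      _ = _ := Real.mul_rpow (by positivity) (by positivity)
  have hC : 0 < (1 + b * r ^ n) ^ γ := by positivity
  calc radialWeight n γ α r
      ≤ r ^ α * ((max 1 b⁻¹) ^ γ * (1 + b * r ^ n) ^ γ) / ((1 + b * r ^ n) ^ γ * b) := by
        unfold radialWeight; gcongr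
    _ = _ := by field_simp

/-- The integral over the ball `B(x, r)`, rescaled to the unit ball. -/
noncomputable def unitBallIntegral (F : EuclideanSpace ℝ (Fin n) → ℝ≥0∞)
    (x : EuclideanSpace ℝ (Fin n)) (r : ℝ) : ℝ≥0∞ :=
  ∫⁻ y in ball (0 : EuclideanSpace ℝ (Fin n)) 1, F (x + r • y)

theorem ofReal_pow_mul_unitBallIntegral (F : EuclideanSpace ℝ (Fin n) → ℝ≥0∞)
    (x : EuclideanSpace ℝ (Fin n)) {r : ℝ} (hr : 0 < r) :
    ENNReal.ofReal (r ^ n) * unitBallIntegral F x r = ∫⁻ y in ball x r, F y := by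
  rw [unitBallIntegral, ← lintegral_indicator measurableSet_ball,
    ← lintegral_indicator measurableSet_ball,
    ← lintegral_add_left_eq_self ((ball x r).indicator F) x]
  have h : ∫⁻ y, (ball x r).indicator F (x + r • y) = ENNReal.ofReal |(r ^ n)⁻¹| *
      ∫⁻ y, (ball x r).indicator F (x + y) := by
    have h1 := (Homeomorph.smulOfNeZero r hr.ne').measurableEmbedding.lintegral_map
      (μ := (volume : Measure (EuclideanSpace ℝ (Fin n))))
      fun y => (ball x r).indicator F (x + y)
    have h2 := Measure.map_addHaar_smul
      (volume : Measure (EuclideanSpace ℝ (Fin n))) hr.ne'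
    rw [finrank_euclideanSpace_fin] at h2
    change ∫⁻ y, (ball x r).indicator F (x + y) ∂(volume.map fun y => r • y) = _ at h1
    rw [h2, lintegral_smul_measure] at h1
    exact h1.symm
  have e : ∀ y, (ball (0 : EuclideanSpace ℝ (Fin n)) 1).indicator (fun y => F (x + r • y)) y
      = (ball x r).indicator F (x + r • y) := fun y => by
    have hiff : y ∈ ball (0 : EuclideanSpace ℝ (Fin n)) 1 ↔ x + r • y ∈ ball x r := by
      rw [mem_ball_zero_iff, mem_ball, dist_self_add_left, norm_smul, Real.norm_of_nonneg hr.le]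
      exact (mul_lt_iff_lt_one_right hr).symm
    by_cases hy : y ∈ ball (0 : EuclideanSpace ℝ (Fin n)) 1
    · rw [indicator_of_mem hy, indicator_of_mem (hiff.1 hy)]
    · rw [indicator_of_notMem hy, indicator_of_notMem fun h => hy (hiff.2 h)]
  simp_rw [e]
  rw [h, ← mul_assoc, ← ENNReal.ofReal_mul (by positivity),
    abs_of_pos (by positivity), mul_inv_cancel₀ (by positivity), ENNReal.ofReal_one, one_mul]

theorem unitBallIntegral_eq (F : EuclideanSpace ℝ (Fin n) → ℝ≥0∞)
    (x : EuclideanSpace ℝ (Fin n)) {r : ℝ} (hr : 0 < r) :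
    unitBallIntegral F x r = ENNReal.ofReal ((r ^ n)⁻¹) * ∫⁻ y in ball x r, F y := by
  rw [← ofReal_pow_mul_unitBallIntegral F x hr, ← mul_assoc, ← ENNReal.ofReal_mul (by positivity),
    inv_mul_cancel₀ (by positivity), ENNReal.ofReal_one, one_mul]

theorem maximalOn_eq {F : Type*} [NormedAddCommGroup F] (I : Set ℝ) (γ β : ℝ)
    (Ω : Set (EuclideanSpace ℝ (Fin n))) (f : EuclideanSpace ℝ (Fin n) → F)
    (x : EuclideanSpace ℝ (Fin n)) : maximalOn I γ β Ω f x =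
      ⨆ r ∈ {r : ℝ | r ∈ I ∧ 0 < r ∧ ENNReal.ofReal r < infEDist x Ωᶜ},
        ENNReal.ofReal (radialWeight n γ β r) * unitBallIntegral (fun y => ‖f y‖ₑ) x r := by
  unfold maximalOn
  refine iSup_congr fun r => iSup_congr fun hr => ?_
  have hr0 : 0 < r := hr.2.1
  rw [unitBallIntegral_eq _ x hr0, ← mul_assoc,
    ← ENNReal.ofReal_mul (radialWeight_pos _ _ hr0).le]
  congr 2
  have hv : volume.real (ball x r) =
      volume.real (ball (0 : EuclideanSpace ℝ (Fin n)) 1) * r ^ n := by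
    rw [Measure.real, volume_ball_eq x hr0, ENNReal.toReal_mul,
      ENNReal.toReal_ofReal (by positivity), mul_comm]
    rfl
  have := volume_real_unitBall_pos (n := n)
  rw [hv, phi, radialWeight]
  field_simp

theorem le_maximalOn {F : Type*} [NormedAddCommGroup F] {I : Set ℝ} {γ β : ℝ}
    {Ω : Set (EuclideanSpace ℝ (Fin n))} {f : EuclideanSpace ℝ (Fin n) → F}
    {x : EuclideanSpace ℝ (Fin n)} {r : ℝ} (hI : r ∈ I) (hr : 0 < r)
    (hσ : ENNReal.ofReal r < infEDist x Ωᶜ) :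
    ENNReal.ofReal (radialWeight n γ β r) * unitBallIntegral (fun y => ‖f y‖ₑ) x r ≤
      maximalOn I γ β Ω f x := by
  rw [maximalOn_eq]
  exact le_iSup₂ (f := fun r (_ : r ∈ {r : ℝ | r ∈ I ∧ 0 < r ∧
    ENNReal.ofReal r < infEDist x Ωᶜ}) => ENNReal.ofReal (radialWeight n γ β r) *
      unitBallIntegral (fun y => ‖f y‖ₑ) x r) r ⟨hI, hr, hσ⟩

theorem measurable_maximalOn {F : Type*} [NormedAddCommGroup F] (I : Set ℝ) (γ β : ℝ)
    (Ω : Set (EuclideanSpace ℝ (Fin n))) (f : EuclideanSpace ℝ (Fin n) → F) :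
    Measurable (maximalOn I γ β Ω f) := by
  refine LowerSemicontinuous.measurable fun x a ha => ?_
  simp only [maximalOn, lt_iSup_iff] at ha ⊢
  obtain ⟨r, ⟨hI, hr, hσ⟩, h⟩ := ha
  have hvol : ∀ x' : EuclideanSpace ℝ (Fin n), volume.real (ball x' r) = volume.real (ball x r) :=
    fun x' => by
      rw [Measure.real, Measure.addHaar_ball_center, Measure.real,
        Measure.addHaar_ball_center volume x]
  filter_upwards [eventually_lt_mul_setLIntegral_ball h,
    continuous_infEDist.continuousAt.eventually (lt_mem_nhds hσ)] with x' hx' hσ'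
  exact ⟨r, ⟨hI, hr, hσ'⟩, by rwa [hvol x']⟩

/-! ### Moving balls and the upper gradient of the maximal function. -/

/-- The fundamental theorem of calculus along s ↦ k(r - s c) w(x + s z + (r - s c) y). The velocity
of the point is z - c y, of norm at most 2‖z‖, whence the factor 2; the shrinking radius contributes
c k' w ≤ ‖z‖ D k w, where w ≥ 0 allows the use of an upper bound for k'. -/
theorem radialWeight_mul_le_add_lintegral (hn : 0 < n) {γ β : ℝ} (hγ : 0 ≤ γ) (hβ : 0 ≤ β)
    {w : EuclideanSpace ℝ (Fin n) → ℝ} (hw : ContDiff ℝ 1 w) (hw0 : ∀ x, 0 ≤ w x)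
    (x z : EuclideanSpace ℝ (Fin n)) {r c : ℝ} (hc : 0 ≤ c) (hcz : c ≤ ‖z‖) (hcr : c < r)
    {y : EuclideanSpace ℝ (Fin n)} (hy : ‖y‖ ≤ 1) :
    ENNReal.ofReal (radialWeight n γ β r) * ‖w (x + r • y)‖ₑ ≤
      ENNReal.ofReal (radialWeight n γ β (r - c)) * ‖w (x + z + (r - c) • y)‖ₑ +
      ‖z‖ₑ * ∫⁻ s in Icc (0 : ℝ) 1,
        (ENNReal.ofReal (radialGrowth n γ β (r - s * c) * radialWeight n γ β (r - s * c)) *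
          ‖w (x + s • z + (r - s * c) • y)‖ₑ +
        2 * (ENNReal.ofReal (radialWeight n γ β (r - s * c)) *
          ‖fderiv ℝ w (x + s • z + (r - s * c) • y)‖ₑ)) := by
  set k := radialWeight n γ β with hk
  set D := radialGrowth n γ β with hD
  set p : ℝ → EuclideanSpace ℝ (Fin n) := fun s => x + s • z + (r - s * c) • y with hp
  have hrs : ∀ s ∈ Icc (0 : ℝ) 1, 0 < r - s * c := fun s hs => by
    have : s * c ≤ 1 * c := by gcongr; exact hs.2
    linarith
  have hpc : Continuous p := by rw [hp]; fun_prop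
  have hpd : ∀ s, HasDerivAt p (z - c • y) s := fun s => by
    have h1 : HasDerivAt (fun s : ℝ => r - s * c) (-c) s := by
      simpa using ((hasDerivAt_id s).mul_const c).const_sub r
    have h2 := (((hasDerivAt_id s).smul_const z).const_add x).add (h1.smul_const y)
    refine h2.congr_deriv ?_
    module
  have hpn : ‖z - c • y‖ ≤ 2 * ‖z‖ := by
    calc ‖z - c • y‖ ≤ ‖z‖ + ‖c • y‖ := norm_sub_le _ _
      _ ≤ ‖z‖ + c * 1 := by rw [norm_smul, Real.norm_of_nonneg hc]; gcongr
      _ ≤ 2 * ‖z‖ := by linarith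
  have hmaps : MapsTo (fun s : ℝ => r - s * c) (Icc 0 1) (Ioi 0) := hrs
  have hrc : ContinuousOn (fun s : ℝ => r - s * c) (Icc 0 1) := by fun_prop
  have hkc : ContinuousOn (fun s => k (r - s * c)) (Icc 0 1) :=
    (continuousOn_radialWeight hn hγ β).comp hrc hmaps
  have hDc : ContinuousOn (fun s => D (r - s * c)) (Icc 0 1) :=
    (continuousOn_radialGrowth γ β).comp hrc hmaps
  have hwp : Continuous fun s => w (p s) := hw.continuous.comp hpc
  have hdwp : Continuous fun s => ‖fderiv ℝ w (p s)‖ :=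
    ((hw.continuous_fderiv one_ne_zero).comp hpc).norm
  set φ : ℝ → ℝ := fun s => ‖z‖ * (D (r - s * c) * k (r - s * c) * w (p s) +
    2 * (k (r - s * c) * ‖fderiv ℝ w (p s)‖)) with hφ
  have hφc : ContinuousOn φ (Icc 0 1) := continuousOn_const.mul
    (((hDc.mul hkc).mul hwp.continuousOn).add
      (continuousOn_const.mul (hkc.mul hdwp.continuousOn)))
  have hφ0 : ∀ s ∈ Icc (0 : ℝ) 1, 0 ≤ φ s := fun s hs => by
    have h1 := radialGrowth_nonneg (n := n) hγ hβ (hrs s hs)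
    have h2 := (radialWeight_pos (n := n) γ β (hrs s hs)).le
    have h3 := hw0 (p s)
    positivity
  choose! k' hk' hk'le using fun s (hs : s ∈ Icc (0 : ℝ) 1) =>
    exists_hasDerivAt_radialWeight (n := n) hn hγ β (hrs s hs)
  -- This one-sided form needs integrability of the majorant `φ` only, not of the derivative.
  have hFTC := intervalIntegral.sub_le_integral_of_hasDeriv_right_of_le
    (g := fun s => -(k (r - s * c) * w (p s)))
    (g' := fun s => c * k' s * w (p s) - k (r - s * c) * fderiv ℝ w (p s) (z - c • y))
    (φ := φ) zero_le_one (hkc.mul hwp.continuousOn).neg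
    (fun s hs => by
      have hs' := Ioo_subset_Icc_self hs
      have h1 : HasDerivAt (fun s : ℝ => r - s * c) (-c) s := by
        simpa using ((hasDerivAt_id s).mul_const c).const_sub r
      have h2 : HasDerivAt (fun s => k (r - s * c)) (k' s * -c) s :=
        HasDerivAt.comp (h₂ := k) s (hk' s hs') h1
      have h3 : HasDerivAt (fun s => w (p s)) (fderiv ℝ w (p s) (z - c • y)) s :=
        ((hw.differentiable one_ne_zero (p s)).hasFDerivAt).comp_hasDerivAt s (hpd s)
      refine ((h2.mul h3).neg.congr_deriv ?_).hasDerivWithinAt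
      ring)
    (hφc.integrableOn_compact isCompact_Icc)
    (fun s hs => by
      have hs' := Ioo_subset_Icc_self hs
      have h1 := radialGrowth_nonneg (n := n) hγ hβ (hrs s hs')
      have h2 := (radialWeight_pos (n := n) γ β (hrs s hs')).le
      have h3 := hw0 (p s)
      have h4 : c * k' s * w (p s) ≤ ‖z‖ * (D (r - s * c) * k (r - s * c)) * w (p s) := by
        refine mul_le_mul_of_nonneg_right ?_ h3
        calc c * k' s ≤ c * (D (r - s * c) * k (r - s * c)) :=
              mul_le_mul_of_nonneg_left (hk'le s hs') hc
          _ ≤ _ := by gcongr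
      have h5 : -(fderiv ℝ w (p s) (z - c • y)) ≤ ‖fderiv ℝ w (p s)‖ * (2 * ‖z‖) := by
        refine (neg_le_abs _).trans (((fderiv ℝ w (p s)).le_opNorm _).trans ?_)
        gcongr
      have h6 := mul_le_mul_of_nonneg_left h5 h2
      simp only [hφ]
      nlinarith)
  simp only [hp, one_smul, zero_smul, zero_mul, sub_zero, one_mul, add_zero] at hFTC
  have hreal : k r * w (x + r • y) ≤ k (r - c) * w (x + z + (r - c) • y) +
      ∫ s in Icc (0 : ℝ) 1, φ s := by
    rw [integral_Icc_eq_integral_Ioc, ← intervalIntegral.integral_of_le zero_le_one]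
    linarith
  have hint : ENNReal.ofReal (∫ s in Icc (0 : ℝ) 1, φ s) =
      ‖z‖ₑ * ∫⁻ s in Icc (0 : ℝ) 1, (ENNReal.ofReal (D (r - s * c) * k (r - s * c)) *
        ‖w (p s)‖ₑ + 2 * (ENNReal.ofReal (k (r - s * c)) * ‖fderiv ℝ w (p s)‖ₑ)) := by
    rw [ofReal_integral_eq_lintegral_ofReal (hφc.integrableOn_compact isCompact_Icc)
      ((ae_restrict_iff' measurableSet_Icc).2 (Eventually.of_forall hφ0)),
      ← lintegral_const_mul' _ _ enorm_ne_top]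
    refine setLIntegral_congr_fun measurableSet_Icc fun s hs => ?_
    have h1 : 0 ≤ D (r - s * c) := radialGrowth_nonneg (n := n) hγ hβ (hrs s hs)
    have h2 : 0 ≤ k (r - s * c) := (radialWeight_pos (n := n) γ β (hrs s hs)).le
    have h3 := hw0 (p s)
    simp only [hφ]
    rw [ENNReal.ofReal_mul (norm_nonneg _), ENNReal.ofReal_add (mul_nonneg (mul_nonneg h1 h2) h3) (by positivity),
      ENNReal.ofReal_mul (mul_nonneg h1 h2), ENNReal.ofReal_mul (p := 2) (by norm_num),
      ENNReal.ofReal_mul h2, ofReal_norm, ofReal_norm, Real.enorm_of_nonneg h3,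
      ENNReal.ofReal_ofNat]
  have h2 := (radialWeight_pos (n := n) γ β (hc.trans_lt hcr)).le
  have h2' := (radialWeight_pos (n := n) γ β (sub_pos.2 hcr)).le
  rw [← hint, Real.enorm_of_nonneg (hw0 _), Real.enorm_of_nonneg (hw0 _), ← ENNReal.ofReal_mul h2,
    ← ENNReal.ofReal_mul h2', ← ENNReal.ofReal_add (mul_nonneg h2' (hw0 _))
      (setIntegral_nonneg measurableSet_Icc hφ0)]
  exact ENNReal.ofReal_le_ofReal hreal

/-- The behaviour of weighted ball integrals of a nonnegative `C¹` function when the centre moves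
along a segment and the radius shrinks at most as fast as the centre moves. -/
theorem radialWeight_mul_unitBallIntegral_le_of_contDiff (hn : 0 < n) {γ β : ℝ} (hγ : 0 ≤ γ)
    (hβ : 0 ≤ β) {w : EuclideanSpace ℝ (Fin n) → ℝ} (hw : ContDiff ℝ 1 w) (hw0 : ∀ x, 0 ≤ w x)
    (x z : EuclideanSpace ℝ (Fin n)) {r c : ℝ} (hc : 0 ≤ c) (hcz : c ≤ ‖z‖) (hcr : c < r) :
    ENNReal.ofReal (radialWeight n γ β r) * unitBallIntegral (fun y => ‖w y‖ₑ) x r ≤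
      ENNReal.ofReal (radialWeight n γ β (r - c)) *
        unitBallIntegral (fun y => ‖w y‖ₑ) (x + z) (r - c) +
      ‖z‖ₑ * ∫⁻ s in Icc (0 : ℝ) 1,
        (ENNReal.ofReal (radialGrowth n γ β (r - s * c) * radialWeight n γ β (r - s * c)) *
          unitBallIntegral (fun y => ‖w y‖ₑ) (x + s • z) (r - s * c) +
        2 * (ENNReal.ofReal (radialWeight n γ β (r - s * c)) *
          unitBallIntegral (fun y => ‖fderiv ℝ w y‖ₑ) (x + s • z) (r - s * c))) := by
  have hwm : Measurable fun y => ‖w y‖ₑ := hw.continuous.enorm.measurable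
  have hdm : Measurable fun y => ‖fderiv ℝ w y‖ₑ :=
    (hw.continuous_fderiv one_ne_zero).enorm.measurable
  have hkm := measurable_radialWeight (n := n) γ β
  have hDm := measurable_radialGrowth (n := n) γ β
  have hm1 : Measurable fun p : EuclideanSpace ℝ (Fin n) × ℝ =>
      ENNReal.ofReal (radialGrowth n γ β (r - p.2 * c) * radialWeight n γ β (r - p.2 * c)) *
        ‖w (x + p.2 • z + (r - p.2 * c) • p.1)‖ₑ := by
    refine Measurable.mul (by fun_prop) (hwm.comp (by fun_prop))
  have hm2 : Measurable fun p : EuclideanSpace ℝ (Fin n) × ℝ =>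
      2 * (ENNReal.ofReal (radialWeight n γ β (r - p.2 * c)) *
        ‖fderiv ℝ w (x + p.2 • z + (r - p.2 * c) • p.1)‖ₑ) := by
    refine Measurable.const_mul (Measurable.mul (by fun_prop) (hdm.comp (by fun_prop))) _
  have hpre0 : Measurable fun y => ‖w (x + z + (r - c) • y)‖ₑ := hwm.comp (by fun_prop)
  have hpre : ∀ (s : ℝ), Measurable fun y => ‖w (x + s • z + (r - s * c) • y)‖ₑ := fun s =>
    hwm.comp (by fun_prop)
  have hpre' : ∀ (s : ℝ), Measurable fun y => ‖fderiv ℝ w (x + s • z + (r - s * c) • y)‖ₑ :=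
    fun s => hdm.comp (by fun_prop)
  calc ENNReal.ofReal (radialWeight n γ β r) * unitBallIntegral (fun y => ‖w y‖ₑ) x r
      = ∫⁻ y in ball (0 : EuclideanSpace ℝ (Fin n)) 1,
          ENNReal.ofReal (radialWeight n γ β r) * ‖w (x + r • y)‖ₑ := by
        rw [lintegral_const_mul' _ _ ENNReal.ofReal_ne_top]; rfl
    _ ≤ ∫⁻ y in ball (0 : EuclideanSpace ℝ (Fin n)) 1,
        (ENNReal.ofReal (radialWeight n γ β (r - c)) * ‖w (x + z + (r - c) • y)‖ₑ +
        ‖z‖ₑ * ∫⁻ s in Icc (0 : ℝ) 1,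
          (ENNReal.ofReal (radialGrowth n γ β (r - s * c) * radialWeight n γ β (r - s * c)) *
            ‖w (x + s • z + (r - s * c) • y)‖ₑ +
          2 * (ENNReal.ofReal (radialWeight n γ β (r - s * c)) *
            ‖fderiv ℝ w (x + s • z + (r - s * c) • y)‖ₑ))) := by
        refine setLIntegral_mono' measurableSet_ball fun y hy => ?_
        exact radialWeight_mul_le_add_lintegral hn hγ hβ hw hw0 x z hc hcz hcr
          (mem_ball_zero_iff.1 hy).le
    _ = _ := by
        rw [lintegral_add_left (hpre0.const_mul _),
          lintegral_const_mul' _ _ ENNReal.ofReal_ne_top, lintegral_const_mul' _ _ enorm_ne_top,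
          lintegral_lintegral_swap (hm1.add hm2).aemeasurable]
        congr 2
        refine lintegral_congr fun s => ?_
        rw [lintegral_add_left ((hpre s).const_mul _),
          lintegral_const_mul' _ _ ENNReal.ofReal_ne_top, lintegral_const_mul' _ _ (by simp),
          lintegral_const_mul' _ _ ENNReal.ofReal_ne_top]
        rfl

/-- On compact sets, the absolute value of a function with a weak gradient is approximated by
nonnegative `C¹` functions whose gradients are almost dominated by the weak gradient. -/
theorem HasWeakGradient.exists_contDiff_approx_abs {U : Set (EuclideanSpace ℝ (Fin n))}
    (hU : IsOpen U) {f : EuclideanSpace ℝ (Fin n) → ℝ}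
    {g : EuclideanSpace ℝ (Fin n) → EuclideanSpace ℝ (Fin n)} (H : HasWeakGradient U f g)
    {K : Set (EuclideanSpace ℝ (Fin n))} (hK : IsCompact K) (hKU : K ⊆ U) {ε : ℝ≥0∞}
    (hε : ε ≠ 0) :
    ∃ w : EuclideanSpace ℝ (Fin n) → ℝ, ContDiff ℝ 1 w ∧ (∀ x, 0 ≤ w x) ∧
      ∫⁻ x in K, ‖w x - |f x|‖ₑ ≤ ε ∧ ∫⁻ x in K, (‖fderiv ℝ w x‖ₑ - ‖g x‖ₑ) ≤ ε := by
  have hε2 : ε / 2 ≠ 0 := (ENNReal.half_pos hε).ne'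
  obtain ⟨φ, Φ, hφ, hΦ, hφΦ, h1, h2⟩ := H.exists_contDiff_approx hU hK hKU hε2
  -- The absolute value is regularised as √(φ² + η²), which is within η of |φ| and has gradient no
  -- longer than that of φ. Keeping η|K| ≤ ε/2 leaves ε/2 for the approximation of f by φ.
  obtain ⟨η, hη, hηε⟩ : ∃ η : ℝ≥0, 0 < η ∧ (η : ℝ≥0∞) * volume K ≤ ε / 2 := by
    have hlim : Tendsto (fun η : ℝ≥0 => (η : ℝ≥0∞) * volume K) (𝓝[>] 0) (𝓝 (0 * volume K)) :=
      ENNReal.Tendsto.mul_const ((ENNReal.continuous_coe.tendsto 0).mono_left nhdsWithin_le_nhds)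
        (Or.inr hK.measure_lt_top.ne)
    rw [zero_mul] at hlim
    obtain ⟨η, h, h'⟩ := ((ENNReal.tendsto_nhds_zero.1 hlim _ hε2.bot_lt).and
      self_mem_nhdsWithin).exists
    exact ⟨η, h', h⟩
  have hpos : ∀ x, 0 < φ x ^ 2 + (η : ℝ) ^ 2 := fun x => by positivity
  have hw : ContDiff ℝ 1 fun x => √(φ x ^ 2 + (η : ℝ) ^ 2) :=
    ContDiff.sqrt (((hφ.of_le (by simp)).pow 2).add contDiff_const) fun x => (hpos x).ne'
  refine ⟨fun x => √(φ x ^ 2 + (η : ℝ) ^ 2), hw, fun x => Real.sqrt_nonneg _, ?_, ?_⟩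
  · calc ∫⁻ x in K, ‖√(φ x ^ 2 + (η : ℝ) ^ 2) - |f x|‖ₑ
        ≤ ∫⁻ x in K, ((η : ℝ≥0∞) + ‖φ x - f x‖ₑ) := by
          refine lintegral_mono fun x => ?_
          have e1 : ‖√(φ x ^ 2 + (η : ℝ) ^ 2) - |φ x|‖ₑ ≤ (η : ℝ≥0∞) := by
            rw [← ofReal_norm, ← ENNReal.ofReal_coe_nnreal]
            refine ENNReal.ofReal_le_ofReal ?_
            have h3 : |φ x| ≤ √(φ x ^ 2 + (η : ℝ) ^ 2) := Real.abs_le_sqrt (by nlinarith)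
            have h4 : √(φ x ^ 2 + (η : ℝ) ^ 2) ≤ |φ x| + η := by
              refine Real.sqrt_le_iff.2 ⟨by positivity, ?_⟩
              nlinarith [sq_abs (φ x), abs_nonneg (φ x), η.coe_nonneg]
            rw [Real.norm_of_nonneg (by linarith)]
            linarith
          have e2 : ‖|φ x| - |f x|‖ₑ ≤ ‖φ x - f x‖ₑ := by
            rw [← ofReal_norm, ← ofReal_norm]
            exact ENNReal.ofReal_le_ofReal (abs_abs_sub_abs_le _ _)
          calc ‖√(φ x ^ 2 + (η : ℝ) ^ 2) - |f x|‖ₑ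
              = ‖(√(φ x ^ 2 + (η : ℝ) ^ 2) - |φ x|) + (|φ x| - |f x|)‖ₑ := by
                rw [sub_add_sub_cancel]
            _ ≤ _ := (enorm_add_le _ _).trans (add_le_add e1 e2)
      _ = (η : ℝ≥0∞) * volume K + ∫⁻ x in K, ‖φ x - f x‖ₑ := by
          rw [lintegral_add_left measurable_const, setLIntegral_const]
      _ ≤ ε / 2 + ε / 2 := add_le_add hηε h1
      _ = ε := ENNReal.add_halves ε
  · refine le_trans (setLIntegral_mono' hK.measurableSet fun x hx => ?_)
      (h2.trans ENNReal.half_le_self)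
    have h3 : ‖fderiv ℝ (fun x => √(φ x ^ 2 + (η : ℝ) ^ 2)) x‖ ≤ ‖Φ x‖ := by
      have hd := (((hφ.differentiable (by simp) x).hasFDerivAt.pow 2).add_const
        ((η : ℝ) ^ 2)).sqrt (hpos x).ne'
      rw [HasFDerivAt.fderiv hd]
      refine ContinuousLinearMap.opNorm_le_bound _ (norm_nonneg _) fun v => ?_
      have hs : |φ x| ≤ √(φ x ^ 2 + (η : ℝ) ^ 2) := Real.abs_le_sqrt (by nlinarith)
      have hs0 : 0 < √(φ x ^ 2 + (η : ℝ) ^ 2) := Real.sqrt_pos.2 (hpos x)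
      have e3 : ‖fderiv ℝ φ x v‖ ≤ ‖Φ x‖ * ‖v‖ := by
        rw [hφΦ x hx v]; exact norm_inner_le_norm _ _
      have e4 : (1 / (2 * √(φ x ^ 2 + (η : ℝ) ^ 2))) * (2 * φ x * fderiv ℝ φ x v) =
          (φ x / √(φ x ^ 2 + (η : ℝ) ^ 2)) * fderiv ℝ φ x v := by field_simp
      have e5 : ‖(φ x / √(φ x ^ 2 + (η : ℝ) ^ 2)) * fderiv ℝ φ x v‖ ≤ ‖Φ x‖ * ‖v‖ := by
        rw [norm_mul, norm_div, Real.norm_of_nonneg hs0.le, Real.norm_eq_abs]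
        calc _ ≤ 1 * ‖fderiv ℝ φ x v‖ := by
              gcongr; exact div_le_one_of_le₀ hs hs0.le
          _ ≤ _ := by rw [one_mul]; exact e3
      rw [← e4] at e5
      refine le_trans (le_of_eq ?_) e5
      congr 1
      simp
    rw [tsub_le_iff_right]
    calc ‖fderiv ℝ (fun x => √(φ x ^ 2 + (η : ℝ) ^ 2)) x‖ₑ ≤ ‖Φ x‖ₑ := by
          rw [← ofReal_norm, ← ofReal_norm]; exact ENNReal.ofReal_le_ofReal h3
      _ = ‖(Φ x - g x) + g x‖ₑ := by rw [sub_add_cancel]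
      _ ≤ _ := enorm_add_le _ _

theorem ENNReal.mul_add_two_mul_add_le {D k M F G c e : ℝ≥0∞} (hD : D ≤ M) (hk : k ≤ M) :
    D * (F + c * e) + 2 * (k * (G + c * e)) ≤
      D * F + 2 * (k * G) + (M * c + 2 * (M * c)) * e := by
  calc _ = D * F + 2 * (k * G) + (D * c + 2 * (k * c)) * e := by ring
    _ ≤ _ := by gcongr

theorem ENNReal.mul_add_mul_add_le {k M F J v c d e : ℝ≥0∞} (hk : k ≤ M) :
    k * (F + c * e) + v * (J + d * e) + M * (c * e) ≤
      k * F + v * J + (M * c + M * c + v * d) * e := by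
  calc _ = k * F + v * J + (k * c + M * c + v * d) * e := by ring
    _ ≤ _ := by gcongr

theorem unitBallIntegral_le_add {A B e : EuclideanSpace ℝ (Fin n) → ℝ≥0∞}
    {x : EuclideanSpace ℝ (Fin n)} {ρ r : ℝ} (hρ : 0 < ρ) (hρr : ρ ≤ r)
    {K : Set (EuclideanSpace ℝ (Fin n))} (hK : ball x r ⊆ K)
    (he : AEMeasurable e (volume.restrict K)) (h : ∀ y, A y ≤ B y + e y) :
    unitBallIntegral A x r ≤
      unitBallIntegral B x r + ENNReal.ofReal ((ρ ^ n)⁻¹) * ∫⁻ y in K, e y := by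
  rw [unitBallIntegral_eq _ _ (hρ.trans_le hρr), unitBallIntegral_eq _ _ (hρ.trans_le hρr)]
  calc ENNReal.ofReal ((r ^ n)⁻¹) * ∫⁻ y in ball x r, A y
      ≤ ENNReal.ofReal ((r ^ n)⁻¹) * ∫⁻ y in ball x r, (B y + e y) := by
        gcongr with y; exact h y
    _ = ENNReal.ofReal ((r ^ n)⁻¹) * (∫⁻ y in ball x r, B y) +
        ENNReal.ofReal ((r ^ n)⁻¹) * ∫⁻ y in ball x r, e y := by
        rw [lintegral_add_right' _ (he.mono_measure (Measure.restrict_mono_set _ hK)), mul_add]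
    _ ≤ _ := add_le_add_right (mul_le_mul' (ENNReal.ofReal_le_ofReal (by gcongr))
        (lintegral_mono_set hK)) _

/-- The smooth case applied to approximations of |f| on the compact set swept by the moving balls.
The radii stay in [r - c, r] with r - c > 0, so the weights and the rescaling factors are bounded
and the approximation errors tend to zero. -/
theorem HasWeakGradient.radialWeight_mul_unitBallIntegral_le
    {Ω : Set (EuclideanSpace ℝ (Fin n))} (hΩ : IsOpen Ω) {f : EuclideanSpace ℝ (Fin n) → ℝ}
    {g : EuclideanSpace ℝ (Fin n) → EuclideanSpace ℝ (Fin n)} (H : HasWeakGradient Ω f g)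
    (hn : 0 < n) {γ β : ℝ} (hγ : 0 ≤ γ) (hβ : 0 ≤ β) {x z : EuclideanSpace ℝ (Fin n)} {r c : ℝ}
    (hc : 0 ≤ c) (hcz : c ≤ ‖z‖) (hcr : c < r)
    (hsub : ∀ s ∈ Icc (0 : ℝ) 1, closedBall (x + s • z) (r - s * c) ⊆ Ω) :
    ENNReal.ofReal (radialWeight n γ β r) * unitBallIntegral (fun y => ‖f y‖ₑ) x r ≤
      ENNReal.ofReal (radialWeight n γ β (r - c)) *
        unitBallIntegral (fun y => ‖f y‖ₑ) (x + z) (r - c) +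
      ‖z‖ₑ * ∫⁻ s in Icc (0 : ℝ) 1,
        (ENNReal.ofReal (radialGrowth n γ β (r - s * c) * radialWeight n γ β (r - s * c)) *
          unitBallIntegral (fun y => ‖f y‖ₑ) (x + s • z) (r - s * c) +
        2 * (ENNReal.ofReal (radialWeight n γ β (r - s * c)) *
          unitBallIntegral (fun y => ‖g y‖ₑ) (x + s • z) (r - s * c))) := by
  have hρ : 0 < r - c := sub_pos.2 hcr
  have hrs : ∀ s ∈ Icc (0 : ℝ) 1, r - s * c ∈ Icc (r - c) r := fun s hs => by
    have h1 : s * c ≤ 1 * c := by gcongr; exact hs.2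
    have h2 : 0 ≤ s * c := mul_nonneg hs.1 hc
    exact ⟨by linarith, by linarith⟩
  set K : Set (EuclideanSpace ℝ (Fin n)) :=
    (fun q : ℝ × EuclideanSpace ℝ (Fin n) => x + q.1 • z + (r - q.1 * c) • q.2) ''
      (Icc 0 1 ×ˢ closedBall 0 1) with hKdef
  have hK : IsCompact K :=
    (isCompact_Icc.prod (isCompact_closedBall _ _)).image (by fun_prop)
  have hKΩ : K ⊆ Ω := by
    rintro _ ⟨⟨s, y⟩, ⟨hs, hy⟩, rfl⟩
    refine hsub s hs ?_
    have h1 : 0 ≤ r - s * c := hρ.le.trans (hrs s hs).1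
    rw [mem_closedBall_iff_norm, add_sub_cancel_left, norm_smul, Real.norm_of_nonneg h1]
    exact mul_le_of_le_one_right h1 (mem_closedBall_zero_iff.1 hy)
  have hball : ∀ s ∈ Icc (0 : ℝ) 1, ball (x + s • z) (r - s * c) ⊆ K := fun s hs y hy => by
    have h1 : 0 < r - s * c := hρ.trans_le (hrs s hs).1
    refine ⟨(s, (r - s * c)⁻¹ • (y - (x + s • z))), ⟨hs, ?_⟩, ?_⟩
    · rw [mem_ball_iff_norm] at hy
      rw [mem_closedBall_zero_iff, norm_smul, norm_inv, Real.norm_of_nonneg h1.le,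
        inv_mul_le_iff₀ h1, mul_one]
      exact hy.le
    · simp only [smul_smul, mul_inv_cancel₀ h1.ne', one_smul]
      abel
  have hball0 : ball x r ⊆ K := by simpa using hball 0 (by simp)
  have hball1 : ball (x + z) (r - c) ⊆ K := by simpa using hball 1 (by simp)
  have hpos : Icc (r - c) r ⊆ Ioi 0 := fun t ht => hρ.trans_le ht.1
  obtain ⟨M₁, hM₁⟩ := isCompact_Icc.exists_bound_of_continuousOn
    ((continuousOn_radialWeight (n := n) hn hγ β).mono hpos)
  obtain ⟨M₂, hM₂⟩ := isCompact_Icc.exists_bound_of_continuousOn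
    (((continuousOn_radialGrowth (n := n) γ β).mul
      (continuousOn_radialWeight (n := n) hn hγ β)).mono hpos)
  set M := ENNReal.ofReal (max M₁ M₂) with hM
  have hkM : ∀ t ∈ Icc (r - c) r, ENNReal.ofReal (radialWeight n γ β t) ≤ M := fun t ht =>
    ENNReal.ofReal_le_ofReal (((le_abs_self _).trans (hM₁ t ht)).trans (le_max_left _ _))
  have hDM : ∀ t ∈ Icc (r - c) r,
      ENNReal.ofReal (radialGrowth n γ β t * radialWeight n γ β t) ≤ M := fun t ht =>
    ENNReal.ofReal_le_ofReal (((le_abs_self _).trans (hM₂ t ht)).trans (le_max_right _ _))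
  set c₀ := ENNReal.ofReal (((r - c) ^ n)⁻¹) with hc₀
  -- The summands collect the errors at the two end positions and along the segment.
  set C := M * c₀ + M * c₀ + ‖z‖ₑ * (M * c₀ + 2 * (M * c₀)) with hC
  have hCtop : C ≠ ⊤ := by finiteness
  refine ENNReal.le_of_forall_pos_le_add fun ε₀ hε₀ _ => ?_
  obtain ⟨w, hw, hw0, he₁, he₂⟩ := H.exists_contDiff_approx_abs hΩ hK hKΩ
    (ε := ε₀ / C) (ENNReal.div_pos (by simpa using hε₀.ne') hCtop).ne'
  set ε := ε₀ / C with hε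
  have hfm : AEStronglyMeasurable f (volume.restrict K) :=
    (H.1.integrableOn_compact_subset hKΩ hK).aestronglyMeasurable
  have hgm : AEStronglyMeasurable g (volume.restrict K) :=
    (H.2.1.integrableOn_compact_subset hKΩ hK).aestronglyMeasurable
  have hm₁ : AEMeasurable (fun y => ‖w y - |f y|‖ₑ) (volume.restrict K) :=
    (hw.continuous.aestronglyMeasurable.sub hfm.norm).enorm
  have hm₂ : AEMeasurable (fun y => ‖fderiv ℝ w y‖ₑ - ‖g y‖ₑ) (volume.restrict K) :=
    ((hw.continuous_fderiv one_ne_zero).enorm.measurable.aemeasurable).sub hgm.enorm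
  have hfw : ∀ y, ‖f y‖ₑ ≤ ‖w y‖ₑ + ‖w y - |f y|‖ₑ := fun y => by
    calc ‖f y‖ₑ = ‖w y - (w y - |f y|)‖ₑ := by
          rw [sub_sub_cancel, ← ofReal_norm, ← ofReal_norm, Real.norm_eq_abs, Real.norm_eq_abs,
            abs_abs]
      _ ≤ _ := enorm_sub_le
  have hwf : ∀ y, ‖w y‖ₑ ≤ ‖f y‖ₑ + ‖w y - |f y|‖ₑ := fun y => by
    calc ‖w y‖ₑ = ‖|f y| + (w y - |f y|)‖ₑ := by rw [add_sub_cancel]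
      _ ≤ ‖|f y|‖ₑ + ‖w y - |f y|‖ₑ := enorm_add_le _ _
      _ = _ := by
          congr 1
          rw [← ofReal_norm, ← ofReal_norm, Real.norm_eq_abs, Real.norm_eq_abs, abs_abs]
  have h0 : unitBallIntegral (fun y => ‖f y‖ₑ) x r ≤
      unitBallIntegral (fun y => ‖w y‖ₑ) x r + c₀ * ε :=
    (unitBallIntegral_le_add hρ (by linarith) hball0 hm₁ hfw).trans (by gcongr)
  have h1 : unitBallIntegral (fun y => ‖w y‖ₑ) (x + z) (r - c) ≤
      unitBallIntegral (fun y => ‖f y‖ₑ) (x + z) (r - c) + c₀ * ε :=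
    (unitBallIntegral_le_add hρ le_rfl hball1 hm₁ hwf).trans (by gcongr)
  have h2 : ∀ s ∈ Icc (0 : ℝ) 1, unitBallIntegral (fun y => ‖w y‖ₑ) (x + s • z) (r - s * c) ≤
      unitBallIntegral (fun y => ‖f y‖ₑ) (x + s • z) (r - s * c) + c₀ * ε := fun s hs =>
    (unitBallIntegral_le_add hρ (hrs s hs).1 (hball s hs) hm₁ hwf).trans (by gcongr)
  have h3 : ∀ s ∈ Icc (0 : ℝ) 1,
      unitBallIntegral (fun y => ‖fderiv ℝ w y‖ₑ) (x + s • z) (r - s * c) ≤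
      unitBallIntegral (fun y => ‖g y‖ₑ) (x + s • z) (r - s * c) + c₀ * ε := fun s hs =>
    (unitBallIntegral_le_add hρ (hrs s hs).1 (hball s hs) hm₂
      (fun y => le_add_tsub)).trans (by gcongr)
  have hr : r ∈ Icc (r - c) r := ⟨by linarith, le_rfl⟩
  have hr' : r - c ∈ Icc (r - c) r := ⟨le_rfl, by linarith⟩
  have hmain := radialWeight_mul_unitBallIntegral_le_of_contDiff hn hγ hβ hw hw0 x z hc hcz hcr
  have hI : ∫⁻ s in Icc (0 : ℝ) 1,
        (ENNReal.ofReal (radialGrowth n γ β (r - s * c) * radialWeight n γ β (r - s * c)) *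
          unitBallIntegral (fun y => ‖w y‖ₑ) (x + s • z) (r - s * c) +
        2 * (ENNReal.ofReal (radialWeight n γ β (r - s * c)) *
          unitBallIntegral (fun y => ‖fderiv ℝ w y‖ₑ) (x + s • z) (r - s * c))) ≤
      (∫⁻ s in Icc (0 : ℝ) 1,
        (ENNReal.ofReal (radialGrowth n γ β (r - s * c) * radialWeight n γ β (r - s * c)) *
          unitBallIntegral (fun y => ‖f y‖ₑ) (x + s • z) (r - s * c) +
        2 * (ENNReal.ofReal (radialWeight n γ β (r - s * c)) *
          unitBallIntegral (fun y => ‖g y‖ₑ) (x + s • z) (r - s * c)))) +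
      (M * c₀ + 2 * (M * c₀)) * ε := by
    calc _ ≤ ∫⁻ s in Icc (0 : ℝ) 1,
          ((ENNReal.ofReal (radialGrowth n γ β (r - s * c) * radialWeight n γ β (r - s * c)) *
            unitBallIntegral (fun y => ‖f y‖ₑ) (x + s • z) (r - s * c) +
          2 * (ENNReal.ofReal (radialWeight n γ β (r - s * c)) *
            unitBallIntegral (fun y => ‖g y‖ₑ) (x + s • z) (r - s * c))) +
          (M * c₀ + 2 * (M * c₀)) * ε) := by
          refine setLIntegral_mono' measurableSet_Icc fun s hs => ?_
          refine (add_le_add (mul_le_mul_right (h2 s hs) _)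
            (mul_le_mul_right (mul_le_mul_right (h3 s hs) _) _)).trans ?_
          exact ENNReal.mul_add_two_mul_add_le (hDM _ (hrs s hs)) (hkM _ (hrs s hs))
      _ = _ := by
          rw [lintegral_add_right _ measurable_const, setLIntegral_const, Real.volume_Icc]
          simp
  calc ENNReal.ofReal (radialWeight n γ β r) * unitBallIntegral (fun y => ‖f y‖ₑ) x r
      ≤ ENNReal.ofReal (radialWeight n γ β r) *
          (unitBallIntegral (fun y => ‖w y‖ₑ) x r + c₀ * ε) := mul_le_mul_right h0 _
    _ = ENNReal.ofReal (radialWeight n γ β r) * unitBallIntegral (fun y => ‖w y‖ₑ) x r +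
          ENNReal.ofReal (radialWeight n γ β r) * (c₀ * ε) := mul_add _ _ _
    _ ≤ _ + M * (c₀ * ε) := add_le_add hmain (mul_le_mul_left (hkM r hr) _)
    _ ≤ _ := add_le_add_left (add_le_add (mul_le_mul_right h1 _) (mul_le_mul_right hI _)) _
    _ ≤ _ + C * ε := ENNReal.mul_add_mul_add_le (hkM _ hr')
    _ ≤ _ := add_le_add_right ENNReal.mul_div_le _

theorem ofReal_lt_infEDist_add {S : Set (EuclideanSpace ℝ (Fin n))}
    {x v : EuclideanSpace ℝ (Fin n)} {t r : ℝ} (hr : 0 ≤ r)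
    (ht : ENNReal.ofReal t < infEDist x S) (hvr : r + ‖v‖ ≤ t) :
    ENNReal.ofReal r < infEDist (x + v) S := by
  by_contra! h
  refine ht.not_ge ?_
  calc infEDist x S ≤ infEDist (x + v) S + edist x (x + v) := infEDist_le_infEDist_add_edist
    _ ≤ ENNReal.ofReal r + ENNReal.ofReal ‖v‖ := by
        gcongr
        rw [edist_comm, edist_eq_enorm_sub, add_sub_cancel_left, ← ofReal_norm]
    _ = ENNReal.ofReal (r + ‖v‖) := (ENNReal.ofReal_add hr (norm_nonneg _)).symm
    _ ≤ _ := ENNReal.ofReal_le_ofReal hvr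

theorem closedBall_subset_of_lt_infEDist_compl {Ω : Set (EuclideanSpace ℝ (Fin n))}
    {x : EuclideanSpace ℝ (Fin n)} {r : ℝ} (h : ENNReal.ofReal r < infEDist x Ωᶜ) :
    closedBall x r ⊆ Ω := fun y hy => by
  by_contra hyΩ
  refine h.not_ge ((infEDist_le_edist_of_mem hyΩ).trans ?_)
  rw [edist_comm, edist_dist]
  exact ENNReal.ofReal_le_ofReal (mem_closedBall.1 hy)

/-- A pointwise bound for the rate of change of the weighted ball integrals yields an upper
gradient of the maximal function. The radii have to be stable under shrinking, down to the
threshold `a`. -/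
theorem HasWeakGradient.isLocalUpperGradient_maximalOn
    {Ω : Set (EuclideanSpace ℝ (Fin n))} (hΩ : IsOpen Ω) {f : EuclideanSpace ℝ (Fin n) → ℝ}
    {g : EuclideanSpace ℝ (Fin n) → EuclideanSpace ℝ (Fin n)} (H : HasWeakGradient Ω f g)
    (hn : 0 < n) {γ β : ℝ} (hγ : 0 ≤ γ) (hβ : 0 ≤ β) {a : ℝ} (ha : 0 ≤ a) {I : Set ℝ}
    (hI : ∀ r ∈ I, ∀ r', a < r' → r' ≤ r → r' ∈ I) {G : EuclideanSpace ℝ (Fin n) → ℝ≥0∞}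
    (hG : ∀ x, ∀ r ∈ I, 0 < r → ENNReal.ofReal r < infEDist x Ωᶜ →
      ENNReal.ofReal (radialGrowth n γ β r * radialWeight n γ β r) *
          unitBallIntegral (fun y => ‖f y‖ₑ) x r +
        2 * (ENNReal.ofReal (radialWeight n γ β r) *
          unitBallIntegral (fun y => ‖g y‖ₑ) x r) ≤ G x) :
    IsLocalUpperGradient {x | ENNReal.ofReal a < infEDist x Ωᶜ} (maximalOn I γ β Ω f) G := by
  intro K hKU hK
  -- The distance attains its minimum on `K`; a finite number t strictly between `a` and that
  -- minimum covers the case of infinite distance, and δ = (t - a)/2.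
  obtain ⟨δ, hδ, hδK⟩ : ∃ δ > 0, ∀ x ∈ K, ENNReal.ofReal (a + 2 * δ) < infEDist x Ωᶜ := by
    rcases K.eq_empty_or_nonempty with rfl | hne
    · exact ⟨1, one_pos, by simp⟩
    obtain ⟨x₀, hx₀, hmin⟩ := hK.exists_isMinOn hne
      (continuous_infEDist (s := Ωᶜ)).continuousOn
    obtain ⟨t, -, hat, htm⟩ := ENNReal.lt_iff_exists_real_btwn.1 (hKU hx₀)
    have hat' : a < t := (ENNReal.ofReal_lt_ofReal_iff_of_nonneg ha).1 hat
    refine ⟨(t - a) / 2, by linarith, fun x hx => ?_⟩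
    rw [mul_div_cancel₀ _ two_ne_zero, add_sub_cancel]
    exact htm.trans_le (hmin hx)
  refine ⟨δ, hδ, fun x hx z hz => ?_⟩
  have key : ∀ r ∈ I, 0 < r → ∀ c, 0 ≤ c → c ≤ ‖z‖ → c < r →
      (∀ s ∈ Icc (0 : ℝ) 1, r - s * c ∈ I ∧ ENNReal.ofReal (r - s * c) < infEDist (x + s • z) Ωᶜ) →
      ENNReal.ofReal (radialWeight n γ β r) * unitBallIntegral (fun y => ‖f y‖ₑ) x r ≤
        maximalOn I γ β Ω f (x + z) + ‖z‖ₑ * ∫⁻ s in Icc (0 : ℝ) 1, G (x + s • z) := by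
    intro r hrI hr c hc hcz hcr hs
    refine (H.radialWeight_mul_unitBallIntegral_le hΩ hn hγ hβ hc hcz hcr fun s hs' =>
      closedBall_subset_of_lt_infEDist_compl (hs s hs').2).trans ?_
    have h1 := hs 1 (by simp)
    rw [one_mul, one_smul] at h1
    refine add_le_add (le_maximalOn h1.1 (sub_pos.2 hcr) h1.2) (mul_le_mul_right ?_ _)
    refine setLIntegral_mono' measurableSet_Icc fun s hs' => ?_
    have hpos : 0 < r - s * c := by
      have : s * c ≤ 1 * c := by gcongr; exact hs'.2
      linarith
    exact hG _ _ (hs s hs').1 hpos (hs s hs').2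
  rw [maximalOn_eq]
  refine iSup₂_le fun r hr => ?_
  obtain ⟨hrI, hr0, hrσ⟩ := hr
  have hsz : ∀ s ∈ Icc (0 : ℝ) 1, ‖s • z‖ = s * ‖z‖ := fun s hs => by
    rw [norm_smul, Real.norm_of_nonneg hs.1]
  -- A radius near the threshold is kept fixed (c = 0): the room 2δ lets the centre move without
  -- leaving Ω, and the radius cannot drop out of `I`. A larger radius shrinks with the motion (c =
  -- ‖z‖), so r - s‖z‖ + s‖z‖ = r stays below the original distance while the radius remains above
  -- `a`, hence in `I`.
  rcases le_or_gt r (a + δ) with hra | hra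
  · refine key r hrI hr0 0 le_rfl (norm_nonneg _) hr0 fun s hs => ?_
    rw [mul_zero, sub_zero]
    refine ⟨hrI, ofReal_lt_infEDist_add hr0.le (hδK x hx) ?_⟩
    rw [hsz s hs]
    have : s * ‖z‖ ≤ 1 * ‖z‖ := by gcongr; exact hs.2
    linarith
  · refine key r hrI hr0 ‖z‖ (norm_nonneg _) le_rfl (by linarith) fun s hs => ?_
    have h1 : s * ‖z‖ ≤ 1 * ‖z‖ := by gcongr; exact hs.2
    have h2 : 0 ≤ s * ‖z‖ := mul_nonneg hs.1 (norm_nonneg _)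
    refine ⟨hI r hrI _ (by linarith) (by linarith), ?_⟩
    refine ofReal_lt_infEDist_add (by linarith) hrσ ?_
    rw [hsz s hs]
    linarith

/-! ### Integrability of the maximal functions and conclusion. -/

/-- Domination by the classical fractional maximal function of f cut off outside Ω, which admissible
balls do not see. The second order α' allows a trade: bounded radii permit α' < α, and otherwise α'
= α with R = 1. -/
theorem lintegral_maximalOn_rpow_ne_top {E : Type*} [NormedAddCommGroup E] (hn : 0 < n)
    {γ α α' s q R : ℝ} (hγ : 0 ≤ γ) (hα : α ≤ n) (hα' : 0 ≤ α') (hs : 1 < s) (hαs : α' * s < n)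
    (hq : 1 / q = 1 / s - α' / n) {Ω : Set (EuclideanSpace ℝ (Fin n))} (hΩ : IsOpen Ω)
    (I : Set ℝ) (hR : ∀ x, ∀ r > 0, ENNReal.ofReal r < infEDist x Ωᶜ → r ^ α ≤ R * r ^ α')
    {f : EuclideanSpace ℝ (Fin n) → E} (hf : MemLp f (ENNReal.ofReal s) (volume.restrict Ω)) :
    ∫⁻ x, maximalOn I γ α Ω f x ^ q ≠ ⊤ := by
  have hn' : (0 : ℝ) < n := by exact_mod_cast hn
  have hs0 : 0 < s := one_pos.trans hs
  have hq0 : 0 < q := by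
    rw [← one_div_pos, hq, sub_pos, div_lt_div_iff₀ hn' hs0]
    linarith
  obtain ⟨C, hC, hCk⟩ := exists_radialWeight_le (n := n) hn hγ hα
  set b := volume.real (ball (0 : EuclideanSpace ℝ (Fin n)) 1) with hb
  have hb0 : 0 < b := volume_real_unitBall_pos
  have hbv : volume (ball (0 : EuclideanSpace ℝ (Fin n)) 1) = ENNReal.ofReal b :=
    (ENNReal.ofReal_toReal measure_ball_lt_top.ne).symm
  have hfe : AEMeasurable (fun y => ‖f y‖ₑ) (volume.restrict Ω) := hf.1.enorm
  set F : EuclideanSpace ℝ (Fin n) → ℝ≥0∞ := Ω.indicator (hfe.mk _) with hF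
  have hFm : Measurable F := hfe.measurable_mk.indicator hΩ.measurableSet
  have hFs : ∫⁻ x, F x ^ s ≠ ⊤ := by
    have h1 : ∫⁻ x, F x ^ s = ∫⁻ x in Ω, ‖f x‖ₑ ^ s := by
      have h3 : ∀ x, F x ^ s = Ω.indicator (fun x => hfe.mk _ x ^ s) x := fun x => by
        by_cases hx : x ∈ Ω
        · rw [hF, indicator_of_mem hx, indicator_of_mem hx]
        · rw [hF, indicator_of_notMem hx, indicator_of_notMem hx, ENNReal.zero_rpow_of_pos hs0]
      simp_rw [h3]
      rw [lintegral_indicator hΩ.measurableSet]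
      exact lintegral_congr_ae (hfe.ae_eq_mk.symm.fun_comp (· ^ s))
    rw [h1]
    have h2 := lintegral_rpow_enorm_lt_top_of_eLpNorm_lt_top (by simpa using hs0)
      ENNReal.ofReal_ne_top hf.2
    rw [ENNReal.toReal_ofReal hs0.le] at h2
    exact h2.ne
  have hle : ∀ x, maximalOn I γ α Ω f x ≤ ENNReal.ofReal (C * R) * fracMax α' F x := fun x => by
    rw [maximalOn_eq]
    refine iSup₂_le fun r hr => ?_
    obtain ⟨-, hr0, hrσ⟩ := hr
    have hball : ball x r ⊆ Ω :=
      ball_subset_closedBall.trans (closedBall_subset_of_lt_infEDist_compl hrσ)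
    have e1 : ∫⁻ y in ball x r, ‖f y‖ₑ = ∫⁻ y in ball x r, F y := by
      refine lintegral_congr_ae ?_
      filter_upwards [ae_restrict_of_ae_restrict_of_subset hball hfe.ae_eq_mk,
        ae_restrict_mem measurableSet_ball] with y hy hyb
      rw [hF, indicator_of_mem (hball hyb)]
      exact hy
    have hrn : 0 < r ^ n := by positivity
    have e2 : ENNReal.ofReal (r ^ α' / b) * ENNReal.ofReal ((r ^ n)⁻¹) =
        ENNReal.ofReal (r ^ α') * (volume (ball x r))⁻¹ := by
      rw [volume_ball_eq x hr0, hbv, ← ENNReal.ofReal_mul hrn.le,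
        ← ENNReal.ofReal_inv_of_pos (by positivity), ← ENNReal.ofReal_mul (by positivity),
        ← ENNReal.ofReal_mul (by positivity)]
      congr 1
      field_simp
    have e3 : radialWeight n γ α r ≤ C * R * (r ^ α' / b) := by
      calc radialWeight n γ α r ≤ C * (r ^ α / b) := hCk r hr0
        _ ≤ C * (R * r ^ α' / b) := by gcongr; exact hR x r hr0 hrσ
        _ = _ := by ring
    have e4 : ENNReal.ofReal (radialWeight n γ α r) ≤
        ENNReal.ofReal (C * R) * ENNReal.ofReal (r ^ α' / b) := by
      rw [← ENNReal.ofReal_mul' (by positivity)]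
      exact ENNReal.ofReal_le_ofReal e3
    calc ENNReal.ofReal (radialWeight n γ α r) * unitBallIntegral (fun y => ‖f y‖ₑ) x r
        ≤ ENNReal.ofReal (C * R) * ENNReal.ofReal (r ^ α' / b) *
            (ENNReal.ofReal ((r ^ n)⁻¹) * ∫⁻ y in ball x r, F y) := by
          rw [unitBallIntegral_eq _ x hr0, e1]
          exact mul_le_mul_left e4 _
      _ = ENNReal.ofReal (C * R) * (ENNReal.ofReal (r ^ α') * (volume (ball x r))⁻¹ *
            ∫⁻ y in ball x r, F y) := by rw [← e2]; ring
      _ ≤ _ := mul_le_mul_right (le_iSup₂ (f := fun r (_ : r ∈ Ioi (0 : ℝ)) =>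
            ENNReal.ofReal (r ^ α') * (volume (ball x r))⁻¹ * ∫⁻ y in ball x r, F y) r hr0) _
  refine ne_top_of_le_ne_top ?_ (lintegral_mono fun x => ENNReal.rpow_le_rpow (hle x) hq0.le)
  simp_rw [ENNReal.mul_rpow_of_nonneg _ _ hq0.le]
  rw [lintegral_const_mul' _ _ (by finiteness)]
  exact ENNReal.mul_ne_top (by finiteness)
    (lintegral_fracMax_rpow_ne_top hn hFm hs hα' hαs hq hFs)

/-- Admissible balls lie in Ω, so finite volume bounds their radii, and one factor r can be replaced
by a constant. The maximum with 1 is there because r ≤ r^n requires r ≥ 1. -/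
theorem exists_rpow_le_mul_rpow_sub_one (hn : 0 < n) {Ω : Set (EuclideanSpace ℝ (Fin n))}
    (hΩ : volume Ω < ⊤) (β : ℝ) :
    ∃ R : ℝ, ∀ x, ∀ r > 0, ENNReal.ofReal r < infEDist x Ωᶜ → r ^ β ≤ R * r ^ (β - 1) := by
  set b := volume.real (ball (0 : EuclideanSpace ℝ (Fin n)) 1) with hb
  have hb0 : 0 < b := volume_real_unitBall_pos
  refine ⟨max 1 (volume.real Ω / b), fun x r hr hσ => ?_⟩
  have h1 : r ^ n ≤ volume.real Ω / b := by
    rw [le_div_iff₀ hb0]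
    have h2 : volume.real (ball x r) ≤ volume.real Ω := measureReal_mono
      (ball_subset_closedBall.trans (closedBall_subset_of_lt_infEDist_compl hσ)) hΩ.ne
    rw [Measure.real, volume_ball_eq x hr, ENNReal.toReal_mul,
      ENNReal.toReal_ofReal (by positivity)] at h2
    exact h2
  have h3 : r ≤ max 1 (volume.real Ω / b) := by
    rcases le_total r 1 with h | h
    · exact h.trans (le_max_left _ _)
    · exact ((le_self_pow₀ h hn.ne').trans h1).trans (le_max_right _ _)
  calc r ^ β = r * r ^ (β - 1) := by rw [Real.rpow_sub_one hr.ne']; field_simp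
    _ ≤ _ := by gcongr

theorem lintegral_rpow_add_ne_top {X : Type*} [MeasurableSpace X] {μ : Measure X} {q : ℝ}
    (hq : 1 ≤ q) {u v : X → ℝ≥0∞} (hu : Measurable u) (h1 : ∫⁻ x, u x ^ q ∂μ ≠ ⊤)
    (h2 : ∫⁻ x, v x ^ q ∂μ ≠ ⊤) : ∫⁻ x, (u x + v x) ^ q ∂μ ≠ ⊤ :=
  (ENNReal.lintegral_rpow_add_lt_top_of_lintegral_rpow_lt_top hu.aemeasurable h1.lt_top
    h2.lt_top hq).ne

theorem lintegral_rpow_const_mul_ne_top {X : Type*} [MeasurableSpace X] {μ : Measure X} {q : ℝ}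
    (hq : 0 ≤ q) {c : ℝ≥0∞} (hc : c ≠ ⊤) {u : X → ℝ≥0∞} (h : ∫⁻ x, u x ^ q ∂μ ≠ ⊤) :
    ∫⁻ x, (c * u x) ^ q ∂μ ≠ ⊤ := by
  simp_rw [ENNReal.mul_rpow_of_nonneg _ _ hq]
  rw [lintegral_const_mul' _ _ (by finiteness)]
  finiteness

theorem ofReal_radialGrowth_mul_le_of_lt_one {E : Type*} [NormedAddCommGroup E] (hn : 0 < n)
    {γ β : ℝ} (hγ : 0 ≤ γ) (hγn : γ ≤ n) (hβ : 0 ≤ β) (hβn : β ≤ n) {I : Set ℝ}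
    {Ω : Set (EuclideanSpace ℝ (Fin n))} {f : EuclideanSpace ℝ (Fin n) → E}
    {x : EuclideanSpace ℝ (Fin n)} {r : ℝ} (hI : r ∈ I) (hr : 0 < r) (hr1 : r < 1)
    (hσ : ENNReal.ofReal r < infEDist x Ωᶜ) :
    ENNReal.ofReal (radialGrowth n γ β r * radialWeight n γ β r) *
        unitBallIntegral (fun y => ‖f y‖ₑ) x r ≤
      ENNReal.ofReal (γ * n + 2 * β) * maximalOn I γ (β - 1) Ω f x := by
  refine le_trans ?_ (mul_le_mul_right (le_maximalOn hI hr hσ) _)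
  rw [← mul_assoc, ← ENNReal.ofReal_mul (by positivity)]
  exact mul_le_mul_left (ENNReal.ofReal_le_ofReal
    (radialGrowth_mul_radialWeight_le hn hγ hγn hβ hβn hr hr1)) _

theorem ofReal_radialGrowth_mul_le_of_one_le {E : Type*} [NormedAddCommGroup E]
    {γ β : ℝ} (hγ : 0 ≤ γ) (hβ : 0 ≤ β) (hβn : β ≤ n) {I : Set ℝ}
    {Ω : Set (EuclideanSpace ℝ (Fin n))} {f : EuclideanSpace ℝ (Fin n) → E}
    {x : EuclideanSpace ℝ (Fin n)} {r : ℝ} (hI : r ∈ I) (hr1 : 1 ≤ r)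
    (hσ : ENNReal.ofReal r < infEDist x Ωᶜ) :
    ENNReal.ofReal (radialGrowth n γ β r * radialWeight n γ β r) *
        unitBallIntegral (fun y => ‖f y‖ₑ) x r ≤
      ENNReal.ofReal (γ * n + β) * maximalOn I γ β Ω f x := by
  have hr : 0 < r := one_pos.trans_le hr1
  refine le_trans ?_ (mul_le_mul_right (le_maximalOn hI hr hσ) _)
  rw [← mul_assoc, ← ENNReal.ofReal_mul (by positivity)]
  exact mul_le_mul_left (ENNReal.ofReal_le_ofReal (mul_le_mul_of_nonneg_right
    (radialGrowth_le hγ hβ hβn hr1) (radialWeight_pos _ _ hr).le)) _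

theorem maximalOn_mono {E : Type*} [NormedAddCommGroup E] {I J : Set ℝ} (hIJ : I ⊆ J) (γ β : ℝ)
    (Ω : Set (EuclideanSpace ℝ (Fin n))) (f : EuclideanSpace ℝ (Fin n) → E)
    (x : EuclideanSpace ℝ (Fin n)) : maximalOn I γ β Ω f x ≤ maximalOn J γ β Ω f x :=
  biSup_mono fun _ hr => ⟨hIJ hr.1, hr.2⟩

theorem maximalLarge_eq_zero {E : Type*} [NormedAddCommGroup E] (γ β : ℝ)
    {Ω : Set (EuclideanSpace ℝ (Fin n))} (f : EuclideanSpace ℝ (Fin n) → E)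
    {x : EuclideanSpace ℝ (Fin n)} (hx : x ∉ largePart Ω) : maximalLarge γ β Ω f x = 0 := by
  refine le_antisymm (iSup₂_le fun r hr => ?_) zero_le
  refine absurd (lt_of_le_of_lt ?_ hr.2.2) hx
  exact ENNReal.one_le_ofReal.2 hr.1

theorem isOpen_largePart (Ω : Set (EuclideanSpace ℝ (Fin n))) : IsOpen (largePart Ω) :=
  isOpen_lt continuous_const continuous_infEDist

theorem setOf_infEDist_compl_pos {Ω : Set (EuclideanSpace ℝ (Fin n))} (hΩ : IsOpen Ω) :
    {x | ENNReal.ofReal 0 < infEDist x Ωᶜ} = Ω := by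
  ext x
  rw [mem_ofPred_eq, ENNReal.ofReal_zero, infEDist_pos_iff_notMem_closure,
    hΩ.isClosed_compl.closure_eq, notMem_compl_iff]

theorem largePart_subset {Ω : Set (EuclideanSpace ℝ (Fin n))} (hΩ : IsOpen Ω) :
    largePart Ω ⊆ Ω := fun x hx => by
  rw [← setOf_infEDist_compl_pos hΩ]
  exact lt_of_le_of_lt (by simp) (show 1 < infEDist x Ωᶜ from hx)

theorem MemSobolev.memLp_weakGradient {Ω : Set (EuclideanSpace ℝ (Fin n))} (hΩ : IsOpen Ω) {p : ℝ}
    {f : EuclideanSpace ℝ (Fin n) → ℝ} {g : EuclideanSpace ℝ (Fin n) → EuclideanSpace ℝ (Fin n)}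
    (hf : MemSobolev Ω p f) (hg : HasWeakGradient Ω f g) :
    MemLp g (ENNReal.ofReal p) (volume.restrict Ω) := by
  obtain ⟨-, g₀, hg₀, hp⟩ := hf
  exact hp.ae_eq (HasWeakGradient.ae_eq hΩ hg₀ hg)

/-- The integrability of all the maximal functions that enter the estimates over all radii and over
the radii below `1`. -/
theorem one_lt_and_lintegral_maximalOn_rpow_ne_top {p β γ q : ℝ} (hp : 1 < p) (hpn : p < n)
    (hβ : 1 ≤ β) (hβn : β * p < n) (hγ : 0 ≤ γ) {Ω : Set (EuclideanSpace ℝ (Fin n))}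
    (hΩ : IsOpen Ω) {f : EuclideanSpace ℝ (Fin n) → ℝ}
    {g : EuclideanSpace ℝ (Fin n) → EuclideanSpace ℝ (Fin n)} (hg : HasWeakGradient Ω f g)
    (hfp : MemLp f (ENNReal.ofReal p) (volume.restrict Ω))
    (hgp : MemLp g (ENNReal.ofReal p) (volume.restrict Ω))
    (hq : (AdmitsSobolevEmbedding Ω p ∧ 1 / q = 1 / p - β / n) ∨
      (volume Ω < ⊤ ∧ 1 / q = 1 / p - (β - 1) / n)) :
    1 < q ∧ ∀ I, ∫⁻ x, maximalOn I γ (β - 1) Ω f x ^ q ≠ ⊤ ∧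
      ∫⁻ x, maximalOn I γ β Ω f x ^ q ≠ ⊤ ∧ ∫⁻ x, maximalOn I γ β Ω g x ^ q ≠ ⊤ := by
  have hp0 : 0 < p := one_pos.trans hp
  have hn' : (0 : ℝ) < n := hp0.trans hpn
  have hn : 0 < n := by exact_mod_cast hn'
  have hβn1 : β ≤ n := by nlinarith
  have hβ1 : β - 1 ≤ n := by linarith
  have hβ0 : 0 ≤ β - 1 := by linarith
  have h1p : 1 / p < 1 := (div_lt_one hp0).2 hp
  have hβp : β / n < 1 / p := by rw [div_lt_div_iff₀ hn' hp0]; linarith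
  have hββ : (β - 1) / n ≤ β / n := by gcongr; linarith
  have hβ1n : 0 ≤ (β - 1) / n := by positivity
  have hq1 : 1 < q := by
    have h : 0 < 1 / q ∧ 1 / q < 1 := by
      rcases hq with ⟨-, h⟩ | ⟨-, h⟩ <;> rw [h] <;> constructor <;> linarith
    have hq0 : 0 < q := one_div_pos.1 h.1
    exact (div_lt_one hq0).1 h.2
  have htriv : ∀ α : ℝ, ∀ x : EuclideanSpace ℝ (Fin n), ∀ r > 0,
      ENNReal.ofReal r < infEDist x Ωᶜ → r ^ α ≤ 1 * r ^ α := fun α x r _ _ => by rw [one_mul]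
  refine ⟨hq1, fun I => ?_⟩
  rcases hq with ⟨⟨C, hC⟩, hq⟩ | ⟨hvol, hq⟩
  · refine ⟨?_, lintegral_maximalOn_rpow_ne_top hn hγ hβn1 (by linarith) hp hβn hq hΩ I (htriv β)
      hfp, lintegral_maximalOn_rpow_ne_top hn hγ hβn1 (by linarith) hp hβn hq hΩ I (htriv β) hgp⟩
    have hnp : 0 < n - p := by linarith
    -- The embedding compensates for the lower order: 1/p* - (β - 1)/n = 1/p - β/n, and (β - 1)p* <
    -- n is equivalent to βp < n.
    have hf' : MemLp f (ENNReal.ofReal (n * p / (n - p))) (volume.restrict Ω) := by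
      refine ⟨hfp.1, (hC f g hfp hg hgp).trans_lt ?_⟩
      exact ENNReal.mul_lt_top ENNReal.coe_lt_top (ENNReal.add_lt_top.2 ⟨hfp.2, hgp.2⟩)
    refine lintegral_maximalOn_rpow_ne_top hn hγ hβ1 hβ0 (s := n * p / (n - p)) ?_ ?_ ?_ hΩ I
      (htriv (β - 1)) hf'
    · rw [lt_div_iff₀ hnp]; nlinarith
    · rw [← mul_div_assoc, div_lt_iff₀ hnp]; nlinarith
    · rw [hq]; field_simp; ring
  · have hβp1 : (β - 1) * p < n := by nlinarith
    obtain ⟨R, hR⟩ := exists_rpow_le_mul_rpow_sub_one hn hvol β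
    exact ⟨lintegral_maximalOn_rpow_ne_top hn hγ hβ1 hβ0 hp hβp1 hq hΩ I (htriv (β - 1)) hfp,
      lintegral_maximalOn_rpow_ne_top hn hγ hβn1 hβ0 hp hβp1 hq hΩ I hR hfp,
      lintegral_maximalOn_rpow_ne_top hn hγ hβn1 hβ0 hp hβp1 hq hΩ I hR hgp⟩

/-- For radii at least 1 the upper gradient involves only order β, so neither the Sobolev embedding
nor finite volume nor γ ≤ n is needed. The threshold a = 1 turns the domain of the upper gradient
into `largePart Ω`. -/
theorem HasWeakGradient.memSobolevENN_maximalLarge {p β γ q : ℝ} (hp : 1 < p) (hpn : p < n)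
    (hβ : 1 ≤ β) (hβn : β * p < n) (hγ : 0 ≤ γ) {Ω : Set (EuclideanSpace ℝ (Fin n))}
    (hΩ : IsOpen Ω) {f : EuclideanSpace ℝ (Fin n) → ℝ}
    {g : EuclideanSpace ℝ (Fin n) → EuclideanSpace ℝ (Fin n)} (hg : HasWeakGradient Ω f g)
    (hfp : MemLp f (ENNReal.ofReal p) (volume.restrict Ω))
    (hgp : MemLp g (ENNReal.ofReal p) (volume.restrict Ω)) (hq : 1 / q = 1 / p - β / n) :
    MemSobolevENN (largePart Ω) q (maximalLarge γ β Ω f) ∧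
      ∀ h, HasWeakGradient (largePart Ω) (fun x => (maximalLarge γ β Ω f x).toReal) h →
        ∀ᵐ x ∂(volume.restrict (largePart Ω)),
          ‖h x‖ₑ ≤ ENNReal.ofReal (γ * n + β) * maximalLarge γ β Ω f x +
            2 * maximalLarge γ β Ω g x := by
  have hp0 : 0 < p := one_pos.trans hp
  have hn' : (0 : ℝ) < n := hp0.trans hpn
  have hn : 0 < n := by exact_mod_cast hn'
  have hβn1 : β ≤ n := by nlinarith
  have hβ0 : 0 ≤ β := by linarith
  have h1p : 1 / p < 1 := (div_lt_one hp0).2 hp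
  have hβp : β / n < 1 / p := by rw [div_lt_div_iff₀ hn' hp0]; linarith
  have hβn0 : 0 ≤ β / n := by positivity
  have hq0 : 0 < q := by rw [← one_div_pos, hq]; linarith
  have hq1 : 1 ≤ q := ((div_lt_one hq0).1 (by rw [hq]; linarith)).le
  have htriv : ∀ x : EuclideanSpace ℝ (Fin n), ∀ r > 0,
      ENNReal.ofReal r < infEDist x Ωᶜ → r ^ β ≤ 1 * r ^ β := fun x r _ _ => by rw [one_mul]
  have hLf : ∫⁻ x, maximalLarge γ β Ω f x ^ q ≠ ⊤ :=
    lintegral_maximalOn_rpow_ne_top hn hγ hβn1 hβ0 hp hβn hq hΩ _ htriv hfp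
  have hLg : ∫⁻ x, maximalLarge γ β Ω g x ^ q ≠ ⊤ :=
    lintegral_maximalOn_rpow_ne_top hn hγ hβn1 hβ0 hp hβn hq hΩ _ htriv hgp
  have hmf : Measurable (maximalLarge γ β Ω f) := measurable_maximalOn _ _ _ _ _
  have hmg : Measurable (maximalLarge γ β Ω g) := measurable_maximalOn _ _ _ _ _
  have hset : {x | ENNReal.ofReal 1 < infEDist x Ωᶜ} = largePart Ω := by
    rw [ENNReal.ofReal_one]; rfl
  have H := hg.isLocalUpperGradient_maximalOn hΩ hn hγ hβ0 zero_le_one (I := Ici 1)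
    (fun r _ r' hr' _ => hr'.le)
    (G := fun x => ENNReal.ofReal (γ * n + β) * maximalLarge γ β Ω f x +
            2 * maximalLarge γ β Ω g x)
    (fun x r hr hr0 hσ => add_le_add (ofReal_radialGrowth_mul_le_of_one_le hγ hβ0 hβn1 hr hr hσ)
      (mul_le_mul_right (le_maximalOn hr hr0 hσ) _))
  rw [hset] at H
  refine H.memSobolevENN (isOpen_largePart Ω) hmf (by fun_prop) hq1 ?_ ?_
  · exact ne_top_of_le_ne_top hLf (setLIntegral_le_lintegral _ _)
  · refine ne_top_of_le_ne_top (lintegral_rpow_add_ne_top hq1 (hmf.const_mul _)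
      (lintegral_rpow_const_mul_ne_top hq0.le ENNReal.ofReal_ne_top hLf)
      (lintegral_rpow_const_mul_ne_top hq0.le (by simp) hLg)) (setLIntegral_le_lintegral _ _)

theorem theorem1p1 (n : ℕ) (p β γ : ℝ) (hp : 1 < p) (hpn : p < n) (hβ : 1 ≤ β)
    (hβn : β < n / p) (hγ : 0 ≤ γ) (Ω : Set (EuclideanSpace ℝ (Fin n))) (hΩ : IsOpen Ω)
    (f : EuclideanSpace ℝ (Fin n) → ℝ)
    (g : EuclideanSpace ℝ (Fin n) → EuclideanSpace ℝ (Fin n))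
    (hf : MemSobolev Ω p f) (hg : HasWeakGradient Ω f g) :
    -- under (a) or (b), with `γ ≤ n`
    (γ ≤ n → ∀ q : ℝ,
      ((AdmitsSobolevEmbedding Ω p ∧ 1 / q = 1 / p - β / n) ∨
        (volume Ω < ⊤ ∧ 1 / q = 1 / p - (β - 1) / n)) →
      -- the whole maximal function; the estimate depends on which radii give the supremum
      (MemSobolevENN Ω q (maximal γ β Ω f) ∧
        ∀ h, HasWeakGradient Ω (fun x => (maximal γ β Ω f x).toReal) h →
          ∀ᵐ x ∂(volume.restrict Ω),
            (maximal γ β Ω f x = maximalSmall γ β Ω f x →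
              ‖h x‖ₑ ≤ ENNReal.ofReal (γ * n + 2 * β) * maximal γ (β - 1) Ω f x +
                2 * maximal γ β Ω g x) ∧
            (maximal γ β Ω f x = maximalLarge γ β Ω f x →
              ‖h x‖ₑ ≤ ENNReal.ofReal (γ * n + β) * maximal γ β Ω f x +
                2 * maximal γ β Ω g x)) ∧
      -- the regime `0 < r < 1`
      (MemSobolevENN Ω q (maximalSmall γ β Ω f) ∧
        ∀ h, HasWeakGradient Ω (fun x => (maximalSmall γ β Ω f x).toReal) h →
          ∀ᵐ x ∂(volume.restrict Ω),
            ‖h x‖ₑ ≤ ENNReal.ofReal (γ * n + 2 * β) * maximalSmall γ (β - 1) Ω f x +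
              2 * maximalSmall γ β Ω g x)) ∧
    -- the regime `1 ≤ r < dist(x, Ωᶜ)`, on the set of the points `x` that have such a radius
    (∀ q : ℝ, 1 / q = 1 / p - β / n →
      MemSobolevENN (largePart Ω) q (maximalLarge γ β Ω f) ∧
        ∀ h, HasWeakGradient (largePart Ω) (fun x => (maximalLarge γ β Ω f x).toReal) h →
          ∀ᵐ x ∂(volume.restrict (largePart Ω)),
            ‖h x‖ₑ ≤ ENNReal.ofReal (γ * n + β) * maximalLarge γ β Ω f x +
              2 * maximalLarge γ β Ω g x) := by
  have hp0 : 0 < p := one_pos.trans hp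
  have hn' : (0 : ℝ) < n := hp0.trans hpn
  have hn : 0 < n := by exact_mod_cast hn'
  have hβp : β * p < n := (lt_div_iff₀ hp0).1 hβn
  have hβn1 : β ≤ n := by nlinarith
  have hβ0 : 0 ≤ β := by linarith
  have hfp := hf.1
  have hgp := hf.memLp_weakGradient hΩ hg
  refine ⟨fun hγn q hq => ?_, fun q hq =>
    hg.memSobolevENN_maximalLarge hp hpn hβ hβp hγ hΩ hfp hgp hq⟩
  obtain ⟨hq1, hfin⟩ :=
    one_lt_and_lintegral_maximalOn_rpow_ne_top hp hpn hβ hβp hγ hΩ hg hfp hgp hq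
  have hq0 : 0 ≤ q := by linarith
  have hset := setOf_infEDist_compl_pos hΩ
  have hm : ∀ (I : Set ℝ) (α : ℝ), Measurable (maximalOn I γ α Ω f) := fun I α =>
    measurable_maximalOn I γ α Ω f
  have hmg : ∀ (I : Set ℝ) (α : ℝ), Measurable (maximalOn I γ α Ω g) := fun I α =>
    measurable_maximalOn I γ α Ω g
  have hsmall : MemSobolevENN Ω q (maximalSmall γ β Ω f) ∧
      ∀ h, HasWeakGradient Ω (fun x => (maximalSmall γ β Ω f x).toReal) h →
        ∀ᵐ x ∂(volume.restrict Ω),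
          ‖h x‖ₑ ≤ ENNReal.ofReal (γ * n + 2 * β) * maximalSmall γ (β - 1) Ω f x +
            2 * maximalSmall γ β Ω g x := by
    obtain ⟨h1, h2, h3⟩ := hfin (Iio 1)
    have H := hg.isLocalUpperGradient_maximalOn hΩ hn hγ hβ0 le_rfl (I := Iio 1)
      (fun r hr r' _ hr' => hr'.trans_lt hr)
      (G := fun x => ENNReal.ofReal (γ * n + 2 * β) * maximalSmall γ (β - 1) Ω f x +
              2 * maximalSmall γ β Ω g x)
      (fun x r hr hr0 hσ => add_le_add
        (ofReal_radialGrowth_mul_le_of_lt_one hn hγ hγn hβ0 hβn1 hr hr0 hr hσ)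
        (mul_le_mul_right (le_maximalOn hr hr0 hσ) _))
    rw [hset] at H
    refine H.memSobolevENN hΩ (hm _ _) (((hm _ _).const_mul _).add ((hmg _ _).const_mul _)) hq1.le
      (ne_top_of_le_ne_top h2 (setLIntegral_le_lintegral _ _)) ?_
    exact ne_top_of_le_ne_top (lintegral_rpow_add_ne_top hq1.le ((hm _ _).const_mul _)
      (lintegral_rpow_const_mul_ne_top hq0 ENNReal.ofReal_ne_top h1)
      (lintegral_rpow_const_mul_ne_top hq0 (by simp) h3)) (setLIntegral_le_lintegral _ _)
  -- Only membership is taken from this crude upper gradient, the sum of the bounds for the two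
  -- regimes.
  have hfull : MemSobolevENN Ω q (maximal γ β Ω f) := by
    obtain ⟨h1, h2, h3⟩ := hfin univ
    have H := hg.isLocalUpperGradient_maximalOn hΩ hn hγ hβ0 le_rfl (I := univ)
      (fun _ _ _ _ _ => mem_univ _)
      (G := fun x => (ENNReal.ofReal (γ * n + 2 * β) * maximal γ (β - 1) Ω f x +
        ENNReal.ofReal (γ * n + β) * maximal γ β Ω f x) + 2 * maximal γ β Ω g x)
      (fun x r hr hr0 hσ => by
        refine add_le_add ?_ (mul_le_mul_right (le_maximalOn hr hr0 hσ) _)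
        rcases lt_or_ge r 1 with h | h
        · exact (ofReal_radialGrowth_mul_le_of_lt_one hn hγ hγn hβ0 hβn1 hr hr0 h hσ).trans
            le_self_add
        · exact (ofReal_radialGrowth_mul_le_of_one_le hγ hβ0 hβn1 hr h hσ).trans le_add_self)
    rw [hset] at H
    refine (H.memSobolevENN hΩ (hm _ _) ((((hm _ _).const_mul _).add ((hm _ _).const_mul _)).add
      ((hmg _ _).const_mul _)) hq1.le
      (ne_top_of_le_ne_top h2 (setLIntegral_le_lintegral _ _)) ?_).1
    exact ne_top_of_le_ne_top (lintegral_rpow_add_ne_top hq1.le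
      (((hm _ _).const_mul _).add ((hm _ _).const_mul _))
      (lintegral_rpow_add_ne_top hq1.le ((hm _ _).const_mul _)
        (lintegral_rpow_const_mul_ne_top hq0 ENNReal.ofReal_ne_top h1)
        (lintegral_rpow_const_mul_ne_top hq0 ENNReal.ofReal_ne_top h2))
      (lintegral_rpow_const_mul_ne_top hq0 (by simp) h3)) (setLIntegral_le_lintegral _ _)
  refine ⟨⟨hfull, fun h hh => ?_⟩, hsmall⟩
  obtain ⟨hS, hSgrad, -⟩ := hsmall.1.2.2
  -- Under (b) this exponent differs from `q`. That is harmless, as only the weak gradient on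
  -- `largePart Ω` and its pointwise bound are used.
  have hlarge := hg.memSobolevENN_maximalLarge hp hpn hβ hβp hγ hΩ hfp hgp
    (q := (1 / p - β / n)⁻¹) (by rw [one_div, inv_inv])
  obtain ⟨hL, hLgrad, -⟩ := hlarge.1.2.2
  have hLarge : ∀ᵐ x ∂(volume.restrict Ω), x ∈ largePart Ω →
      maximal γ β Ω f x = maximalLarge γ β Ω f x →
      ‖h x‖ₑ ≤ ENNReal.ofReal (γ * n + β) * maximalLarge γ β Ω f x +
        2 * maximalLarge γ β Ω g x := by
    refine ae_restrict_of_ae ((ae_restrict_iff' (isOpen_largePart Ω).measurableSet).1 ?_)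
    filter_upwards [hlarge.2 hL hLgrad, ((hh.mono (largePart_subset hΩ)).sub
      hLgrad).ae_eq_zero_of_eq_zero (isOpen_largePart Ω)] with x h1 h2 hx
    rw [sub_eq_zero.1 (h2 (by rw [hx, sub_self]))]
    exact h1
  -- Locality: where the full maximal function equals that of one regime, their difference vanishes,
  -- so the weak gradients agree almost everywhere there.
  filter_upwards [hLarge, hsmall.2 hS hSgrad, (hh.sub hSgrad).ae_eq_zero_of_eq_zero hΩ,
    hh.ae_eq_zero_of_eq_zero hΩ] with x h1 h2 h3 h4
  refine ⟨fun hx => ?_, fun hx => ?_⟩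
  · rw [sub_eq_zero.1 (h3 (by rw [hx, sub_self]))]
    exact h2.trans (add_le_add (mul_le_mul_right (maximalOn_mono (subset_univ _) ..) _)
      (mul_le_mul_right (maximalOn_mono (subset_univ _) ..) _))
  · by_cases hxL : x ∈ largePart Ω
    · exact (h1 hxL hx).trans (add_le_add (mul_le_mul_right (maximalOn_mono (subset_univ _) ..) _)
        (mul_le_mul_right (maximalOn_mono (subset_univ _) ..) _))
    -- Without a radius of size at least 1 the supremum over large radii is 0, so equality forces
    -- the full maximal function to vanish, and its gradient is zero almost everywhere on that set.
    · rw [h4 (by rw [hx, maximalLarge_eq_zero γ β f hxL, ENNReal.toReal_zero]), enorm_zero]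
      exact zero_le
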